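/- Let $k$ be an algebraically closed field (of any characteristic), let $n\ge 2$, and let $Q_n\subset\mathbb P^{n+1}_k$ be a smooth quadric hypersurface with $\mathcal O(d)=\mathcal O_{\mathbb P^{n+1}}(d)|_{Q_n}$; for a coherent sheaf $F$ on $Q_n$ write $F(d)=F\otimes\mathcal O(d)$. Let $\Sigma_*$ denote the spinor bundles of $Q_n$: two bundles $\Sigma_1,\Sigma_2$ if $n$ is even, one bundle $\Sigma$ if $n$ is odd, normalized to be globally generated with $H^0(\Sigma_*(-1))=0$. (Explicitly, they are the cokernels of the maps $\varphi:\mathcal O(-1)^N\to\mathcal O^N$, $N=2^{\lfloor (n+1)/2\rfloor}$, where $\varphi$ runs over the $N\times N$ matrices of linear forms for which there is an $N\times N$ matrix of linear forms $\psi$ with $\varphi\psi=\psi\varphi=q\cdot\mathrm{Id}$, $q$ being the equation of $Q_n$.) For $m\in\mathbb Z$, a coherent sheaf $F$ on $Q_n$ is called $m$-Qregular if $$H^i(Q_n,F(m-i))=0\quad\text{for } i=1,\dots,n-1,\qquad\text{and}\qquad H^n(Q_n,F(m)\otimes\Sigma_*(-n))=0,$$ the last condition being required for every spinor bundle of $Q_n$.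 Let $F$ be an $m$-Qregular coherent sheaf on $Q_n$. Then: 1. $F$ is $l$-Qregular for every integer $l\ge m$; 2. for every integer $l>m$ the group $H^0(F(l))$ is spanned by $H^0(F(l-1))\otimes H^0(\mathcal O(1))$, i.e. the multiplication map $H^0(F(l-1))\otimes H^0(\mathcal O(1))\to H^0(F(l))$ is surjective. -/

import Mathlib

universe u

namespace QuadricSheaf

open AlgebraicGeometry CategoryTheory TopologicalSpace Opposite

noncomputable section Twist

variable {A : Type u} [CommRing A] {σ : Type*} [SetLike σ A] [AddSubgroupClass σ A]
variable (𝒜 : ℕ → σ) [GradedRing 𝒜]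

/-- The homogeneous prime ideal of `A` corresponding to a point `x` of `Proj 𝒜`. -/
def idealAt (x : ProjectiveSpectrum.top 𝒜) : Ideal A :=
  (ProjectiveSpectrum.asHomogeneousIdeal (𝒜 := 𝒜) x).toIdeal

instance (x : ProjectiveSpectrum.top 𝒜) : (idealAt 𝒜 x).IsPrime :=
  ProjectiveSpectrum.isPrime (𝒜 := 𝒜) x

/-- The localization of `A` at the homogeneous prime ideal `x`. -/
def LocAt (x : ProjectiveSpectrum.top 𝒜) : Type u :=
  Localization.AtPrime (idealAt 𝒜 x)

instance (x : ProjectiveSpectrum.top 𝒜) : CommRing (LocAt 𝒜 x) :=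
  inferInstanceAs (CommRing
    (Localization.AtPrime (idealAt 𝒜 x)))

variable {𝒜} in
/-- The fraction `a / b` in the localization of `A` at `x`. -/
def frac {x : ProjectiveSpectrum.top 𝒜} (a b : A)
    (hb : b ∉ (idealAt 𝒜 x)) : LocAt 𝒜 x :=
  Localization.mk (S := (idealAt 𝒜 x).primeCompl) a ⟨b, hb⟩

variable {𝒜} in
/-- `f` is of the form `x ↦ a / b` on `U`, with `a`, `b` homogeneous elements of `A` such that
`deg a - deg b = d` and `b` does not vanish at any point of `U`. -/
def IsTwistedFraction (d : ℤ) {U : Opens (ProjectiveSpectrum.top 𝒜)}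
    (f : ∀ x : U, LocAt 𝒜 x.1) : Prop :=
  ∃ (i j : ℕ) (a b : A), a ∈ 𝒜 i ∧ b ∈ 𝒜 j ∧ (i : ℤ) = j + d ∧
    ∀ x : U, ∃ hb : b ∉ (idealAt 𝒜 x.1),
      f x = frac a b hb

/-- Being a fraction of degree `d` is stable under restriction. -/
def twistedFractionPrelocal (d : ℤ) : TopCat.PrelocalPredicate (LocAt 𝒜) where
  pred f := IsTwistedFraction d f
  res := by
    rintro V U i f ⟨a, b, c, e, h1, h2, h3, w⟩
    exact ⟨a, b, c, e, h1, h2, h3, fun x => w (i x)⟩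

/-- Being locally a fraction of degree `d`. -/
def twistedLocally (d : ℤ) : TopCat.LocalPredicate (LocAt 𝒜) :=
  (twistedFractionPrelocal 𝒜 d).sheafify

lemma frac_zero {x : ProjectiveSpectrum.top 𝒜} (b : A)
    (hb : b ∉ (idealAt 𝒜 x)) :
    frac (𝒜 := 𝒜) (x := x) 0 b hb = 0 :=
  Localization.mk_zero _

lemma frac_neg {x : ProjectiveSpectrum.top 𝒜} (a b : A)
    (hb : b ∉ (idealAt 𝒜 x)) :
    -frac (𝒜 := 𝒜) (x := x) a b hb = frac (-a) b hb :=
  Localization.neg_mk _ _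

lemma frac_add {x : ProjectiveSpectrum.top 𝒜} (a b a' b' : A)
    (hb : b ∉ (idealAt 𝒜 x))
    (hb' : b' ∉ (idealAt 𝒜 x))
    (h : b * b' ∉ (idealAt 𝒜 x)) :
    frac (𝒜 := 𝒜) (x := x) a b hb + frac a' b' hb' = frac (b * a' + b' * a) (b * b') h :=
  Localization.add_mk _ _ _ _

lemma frac_mul {x : ProjectiveSpectrum.top 𝒜} (a b a' b' : A)
    (hb : b ∉ (idealAt 𝒜 x))
    (hb' : b' ∉ (idealAt 𝒜 x))
    (h : b * b' ∉ (idealAt 𝒜 x)) :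
    frac (𝒜 := 𝒜) (x := x) a b hb * frac a' b' hb' = frac (a * a') (b * b') h :=
  Localization.mk_mul _ _ _ _

lemma mul_notMem {x : ProjectiveSpectrum.top 𝒜} {b b' : A}
    (hb : b ∉ (idealAt 𝒜 x))
    (hb' : b' ∉ (idealAt 𝒜 x)) :
    b * b' ∉ (idealAt 𝒜 x) :=
  (ProjectiveSpectrum.isPrime (𝒜 := 𝒜) x).mul_notMem hb hb'

lemma exists_denominator (x : ProjectiveSpectrum.top 𝒜) (N : ℕ) :
    ∃ (j : ℕ) (b : A), b ∈ 𝒜 j ∧ N ≤ j ∧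
      b ∉ (idealAt 𝒜 x) := by
  have hx := ProjectiveSpectrum.not_irrelevant_le (𝒜 := 𝒜) x
  have : ∃ (j : ℕ) (b : A), 0 < j ∧ b ∈ 𝒜 j ∧
      b ∉ (idealAt 𝒜 x) := by
    by_contra! H
    apply hx
    intro a ha
    classical
    rw [← DirectSum.sum_support_decompose 𝒜 a]
    refine Ideal.sum_mem _ fun i _ => ?_
    rcases Nat.eq_zero_or_pos i with rfl | hi
    · have : GradedRing.proj 𝒜 0 a = 0 := (HomogeneousIdeal.mem_irrelevant_iff 𝒜 a).1 ha
      rw [GradedRing.proj_apply] at this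
      rw [this]
      exact Ideal.zero_mem _
    · exact H i _ hi (SetLike.coe_mem _)
  obtain ⟨j, b, hj, hb, hbx⟩ := this
  refine ⟨N • j, b ^ N, SetLike.pow_mem_graded N hb, ?_, ?_⟩
  · exact Nat.le_mul_of_pos_right N hj
  · exact fun h => hbx ((ProjectiveSpectrum.isPrime (𝒜 := 𝒜) x).mem_of_pow_mem N h)

/-- The sections of `𝒪(d)` over `U`: the functions on `U` with values in the localizations `A_x`
that are locally fractions of homogeneous elements with `deg (numerator) - deg (denominator) = d`. -/
def twistSections (d : ℤ) (U : Opens (ProjectiveSpectrum.top 𝒜)) :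
    AddSubgroup (∀ x : U, LocAt 𝒜 x.1) where
  carrier := {f | (twistedLocally 𝒜 d).pred f}
  zero_mem' := fun x => by
    obtain ⟨j, b, hb, hj, hbx⟩ := exists_denominator 𝒜 x.1 (-d).toNat
    refine ⟨U ⊓ ProjectiveSpectrum.basicOpen 𝒜 b, ⟨x.2, hbx⟩, Opens.infLELeft _ _,
      (j + d).toNat, j, 0, b, zero_mem _, hb, by omega, fun y => ⟨y.2.2, ?_⟩⟩
    exact (frac_zero 𝒜 _ _).symm
  add_mem' := fun {f g} hf hg x => by
    obtain ⟨V, hV, iV, i, j, a, b, ha, hb, hij, w⟩ := hf x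
    obtain ⟨V', hV', iV', i', j', a', b', ha', hb', hij', w'⟩ := hg x
    refine ⟨V ⊓ V', ⟨hV, hV'⟩, Opens.infLELeft _ _ ≫ iV, j + i', j + j', b * a' + b' * a, b * b',
      add_mem (SetLike.mul_mem_graded hb ha') ?_, SetLike.mul_mem_graded hb hb', by omega,
      fun y => ?_⟩
    · have : j + i' = j' + i := by omega
      rw [this]
      exact SetLike.mul_mem_graded hb' ha
    · obtain ⟨h, e⟩ := w ⟨y.1, y.2.1⟩
      obtain ⟨h', e'⟩ := w' ⟨y.1, y.2.2⟩
      exact ⟨mul_notMem 𝒜 h h', (congrArg₂ (· + ·) e e').trans (frac_add 𝒜 _ _ _ _ _ _ _)⟩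
  neg_mem' := fun {f} hf x => by
    obtain ⟨V, hV, iV, i, j, a, b, ha, hb, hij, w⟩ := hf x
    refine ⟨V, hV, iV, i, j, -a, b, neg_mem ha, hb, hij, fun y => ?_⟩
    obtain ⟨h, e⟩ := w y
    exact ⟨h, (congrArg Neg.neg e).trans (frac_neg 𝒜 _ _ _)⟩

/-- The value in `LocAt 𝒜 x` of a section `r` of the structure sheaf. -/
def value {U : Opens (ProjectiveSpectrum.top 𝒜)} (x : U) :
    ((ProjectiveSpectrum.Proj.structureSheaf 𝒜).1.obj (op U)) →+* LocAt 𝒜 x.1 :=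
  (algebraMap (HomogeneousLocalization.AtPrime 𝒜
      (idealAt 𝒜 x.1))
    (Localization.AtPrime (idealAt 𝒜 x.1))).comp
  (openToLocalization 𝒜 U x.1 x.2).hom

lemma mul_mem_twistSections {d e : ℤ} {U : Opens (ProjectiveSpectrum.top 𝒜)}
    {f g : ∀ x : U, LocAt 𝒜 x.1} (hf : f ∈ twistSections 𝒜 d U) (hg : g ∈ twistSections 𝒜 e U) :
    f * g ∈ twistSections 𝒜 (d + e) U := fun x => by
  obtain ⟨V, hV, iV, i, j, a, b, ha, hb, hij, w⟩ := hf x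
  obtain ⟨V', hV', iV', i', j', a', b', ha', hb', hij', w'⟩ := hg x
  refine ⟨V ⊓ V', ⟨hV, hV'⟩, Opens.infLELeft _ _ ≫ iV, i + i', j + j', a * a', b * b',
    SetLike.mul_mem_graded ha ha', SetLike.mul_mem_graded hb hb', by push_cast; omega, fun y => ?_⟩
  obtain ⟨h, e⟩ := w ⟨y.1, y.2.1⟩
  obtain ⟨h', e'⟩ := w' ⟨y.1, y.2.2⟩
  exact ⟨mul_notMem 𝒜 h h', (congrArg₂ (· * ·) e e').trans (frac_mul 𝒜 _ _ _ _ _ _ _)⟩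

lemma value_mem_twistSections {U : Opens (ProjectiveSpectrum.top 𝒜)}
    (r : (ProjectiveSpectrum.Proj.structureSheaf 𝒜).1.obj (op U)) :
    (fun x => value 𝒜 x r) ∈ twistSections 𝒜 0 U := fun x => by
  obtain ⟨V, hV, iV, i, a, b, hb, w⟩ := r.2 x
  refine ⟨V, hV, iV, i, i, a, b, a.2, b.2, by simp, fun y => ⟨hb y, ?_⟩⟩
  exact (congrArg HomogeneousLocalization.val (w y)).trans (HomogeneousLocalization.val_mk _)

/-- Sections of `𝒪(d)` are multiplied pointwise by sections of the structure sheaf. -/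
instance twistModule (d : ℤ) (U : Opens (ProjectiveSpectrum.top 𝒜)) :
    Module ((ProjectiveSpectrum.Proj.structureSheaf 𝒜).1.obj (op U)) (twistSections 𝒜 d U) where
  smul r s := ⟨fun x => value 𝒜 x r * s.1 x, by
    have := mul_mem_twistSections 𝒜 (value_mem_twistSections 𝒜 r) s.2
    rw [zero_add] at this
    exact this⟩
  one_smul s := Subtype.ext (funext fun x => by
    change value 𝒜 x 1 * s.1 x = s.1 x
    rw [map_one, one_mul])
  mul_smul r t s := Subtype.ext (funext fun x => by
    change value 𝒜 x (r * t) * s.1 x = value 𝒜 x r * (value 𝒜 x t * s.1 x)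
    rw [map_mul, mul_assoc])
  smul_zero r := Subtype.ext (funext fun x => mul_zero (value 𝒜 x r))
  smul_add r s t := Subtype.ext (funext fun x => mul_add (value 𝒜 x r) (s.1 x) (t.1 x))
  add_smul r t s := Subtype.ext (funext fun x => by
    change value 𝒜 x (r + t) * s.1 x = value 𝒜 x r * s.1 x + value 𝒜 x t * s.1 x
    rw [map_add, add_mul])
  zero_smul s := Subtype.ext (funext fun x => by
    change value 𝒜 x 0 * s.1 x = 0
    rw [map_zero, zero_mul])

/-- The presheaf of abelian groups underlying `𝒪(d)`. -/
def twistAb (d : ℤ) : TopCat.Presheaf Ab.{u} (ProjectiveSpectrum.top 𝒜) where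
  obj U := AddCommGrpCat.of (twistSections 𝒜 d U.unop)
  map {U V} i := AddCommGrpCat.ofHom
    { toFun := fun s => ⟨fun x => s.1 ⟨x.1, i.unop.le x.2⟩,
        (twistedLocally 𝒜 d).res i.unop s.1 s.2⟩
      map_zero' := rfl
      map_add' := fun _ _ => rfl }

/-- Serre's twisting sheaf `𝒪(d)` on `Proj 𝒜`. -/
def twist (d : ℤ) : (Proj 𝒜).Modules where
  val :=
    letI (U : (Proj 𝒜).Opensᵒᵖ) : Module ((Proj 𝒜).ringCatSheaf.obj.obj U)
        ((twistAb 𝒜 d).obj U) :=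
      twistModule 𝒜 d U.unop
    .ofPresheaf (R := (Proj 𝒜).ringCatSheaf.obj) (twistAb 𝒜 d) fun _ _ _ _ _ ↦ rfl
  isSheaf := (TopCat.Presheaf.isSheaf_iff_isSheaf_comp (forget AddCommGrpCat) (twistAb 𝒜 d)).2
    (TopCat.subsheafToTypes (twistedLocally 𝒜 d)).2

/-- Multiplication by a global section `l` of `𝒪(e)`, as a morphism `𝒪(d) ⟶ 𝒪(e + d)`. -/
def mulGlobal {e : ℤ} (l : (twist 𝒜 e).presheaf.obj (op ⊤)) {d d' : ℤ} (h : e + d = d') :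
    twist 𝒜 d ⟶ twist 𝒜 d' where
  val := PresheafOfModules.homMk
    { app := fun U => AddCommGrpCat.ofHom
        { toFun := fun s : twistSections 𝒜 d U.unop =>
            show twistSections 𝒜 d' U.unop from
            ⟨fun x => (show twistSections 𝒜 e ⊤ from l).1 ⟨x.1, trivial⟩ * s.1 x, by
              rw [← h]
              exact mul_mem_twistSections 𝒜
                ((twistedLocally 𝒜 e).res U.unop.leTop _
                  (show twistSections 𝒜 e ⊤ from l).2) s.2⟩
          map_zero' := Subtype.ext (funext fun x => mul_zero _)
          map_add' := fun s t => Subtype.ext (funext fun x => mul_add _ _ _) }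
      naturality := fun _ _ _ => rfl }
    (fun U r s => Subtype.ext (funext fun x => mul_left_comm _ _ _))

/-- The global section `a / 1` of `𝒪(d)` given by a homogeneous element `a` of degree `d`. -/
def globalOfHomogeneous {d : ℕ} (a : A) (ha : a ∈ 𝒜 d) : (twist 𝒜 d).presheaf.obj (op ⊤) :=
  show twistSections 𝒜 d ⊤ from
  ⟨fun x => frac a 1 (Ideal.IsPrime.one_notMem inferInstance), fun x =>
    ⟨⊤, trivial, 𝟙 _, d, 0, a, 1, ha, SetLike.GradedOne.one_mem, by simp, fun _ => ⟨_, rfl⟩⟩⟩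

end Twist

noncomputable section Tensor
variable {X : Scheme.{u}}

/-- The tensor product `F ⊗ G` over the structure sheaf: the sheaf associated with the presheaf
`U ↦ F(U) ⊗ G(U)`, the tensor product being over the ring of functions on `U`. -/
def tensor (F G : X.Modules) : X.Modules :=
  (PresheafOfModules.sheafification (𝟙 X.ringCatSheaf.obj)).obj
    (MonoidalCategoryStruct.tensorObj (C := PresheafOfModules (X.presheaf ⋙ forget₂ _ _))
      F.val G.val)

/-- The morphism `F ⊗ f`. -/
def tensorMap (F : X.Modules) {G G' : X.Modules} (f : G ⟶ G') : tensor F G ⟶ tensor F G' :=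
  (PresheafOfModules.sheafification (𝟙 X.ringCatSheaf.obj)).map
    (MonoidalCategoryStruct.whiskerLeft (C := PresheafOfModules (X.presheaf ⋙ forget₂ _ _))
      F.val f.val)

/-- Coherent sheaves on a (locally Noetherian) scheme: quasi-coherent modules of finite type. -/
def IsCoherent (F : X.Modules) : Prop :=
  SheafOfModules.IsQuasicoherent F ∧ SheafOfModules.IsFiniteType F

/-- The sheaf cohomology group `Hⁱ(X, F)`. -/
abbrev H (i : ℕ) (F : X.Modules) : Type u :=
  Sheaf.H.{u} ((SheafOfModules.toSheaf X.ringCatSheaf).obj F) i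
/-- The group `H⁰(X, F)` of global sections. -/
abbrev H0 (F : X.Modules) : Type u := F.presheaf.obj (op ⊤)

end Tensor

noncomputable section Quadrics
open MvPolynomial Limits
attribute [local instance] MvPolynomial.gradedAlgebra Abelian.hasFiniteBiproducts
variable (k : Type u) [Field k]

/-- A smooth quadric hypersurface of dimension `n` in the projective space of dimension `n + 1` over
an algebraically closed field `k`, given by its equation: a quadratic form `form` in
`x₀, …, xₙ₊₁` such that no point of the hypersurface is a common zero of the partial derivatives
of `form` (in particular `form ≠ 0`, since `n + 2 > 0`). -/
structure SmoothQuadric (n : ℕ) where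
  /-- the equation of the quadric -/
  form : MvPolynomial (Fin (n + 2)) k
  isHomogeneous : form.IsHomogeneous 2
  smooth : ∀ v : Fin (n + 2) → k, eval v form = 0 → (∀ i, eval v (pderiv i form) = 0) → v = 0

namespace SmoothQuadric
variable {k} {n : ℕ} (Q : SmoothQuadric k n)

/-- The homogeneous coordinate ring `k[x₀, …, xₙ₊₁] / (form)`. -/
abbrev coordRing : Type u := MvPolynomial (Fin (n + 2)) k ⧸ Ideal.span {Q.form}

/-- The homogeneous part of degree `d` of the coordinate ring: the classes of the homogeneous
polynomials of degree `d`. -/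
def grading (d : ℕ) : Submodule k Q.coordRing :=
  (homogeneousSubmodule (Fin (n + 2)) k d).map
    (Ideal.Quotient.mkₐ k (Ideal.span {Q.form})).toLinearMap

lemma mk_mem_grading {d : ℕ} {p : MvPolynomial (Fin (n + 2)) k} (hp : p.IsHomogeneous d) :
    Ideal.Quotient.mk (Ideal.span {Q.form}) p ∈ Q.grading d :=
  ⟨p, hp, rfl⟩

instance : SetLike.GradedMonoid Q.grading where
  one_mem := ⟨1, isHomogeneous_one _ _, rfl⟩
  mul_mem := by
    rintro i j _ _ ⟨p, hp, rfl⟩ ⟨r, hr, rfl⟩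
    exact ⟨p * r, IsHomogeneous.mul hp hr, map_mul (Ideal.Quotient.mk (Ideal.span {Q.form})) _ _⟩

/-- The classes of the homogeneous components of a polynomial. -/
def componentsPoly : MvPolynomial (Fin (n + 2)) k →+ DirectSum ℕ (fun d => Q.grading d) :=
  (DirectSum.map fun d : ℕ =>
    (((Ideal.Quotient.mkₐ k (Ideal.span {Q.form})).toLinearMap.submoduleMap
      (homogeneousSubmodule (Fin (n + 2)) k d)).toAddMonoidHom :
        homogeneousSubmodule (Fin (n + 2)) k d →+ Q.grading d)).comp
  (DirectSum.decomposeAddEquiv (homogeneousSubmodule (Fin (n + 2)) k)).toAddMonoidHom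

lemma componentsPoly_apply (p : MvPolynomial (Fin (n + 2)) k) (d : ℕ) :
    (Q.componentsPoly p d : Q.coordRing) =
      Ideal.Quotient.mk (Ideal.span {Q.form})
        (DirectSum.decompose (homogeneousSubmodule (Fin (n + 2)) k) p d :
          MvPolynomial (Fin (n + 2)) k) := by
  rfl

lemma componentsPoly_of_isHomogeneous {d : ℕ} {p : MvPolynomial (Fin (n + 2)) k}
    (hp : p.IsHomogeneous d) :
    Q.componentsPoly p = DirectSum.of (fun d => Q.grading d) d ⟨_, Q.mk_mem_grading hp⟩ := by
  refine DFinsupp.ext fun e => Subtype.ext ?_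
  refine (Q.componentsPoly_apply p e).trans ?_
  by_cases h : d = e
  · subst h
    rw [DirectSum.decompose_of_mem_same _ hp, DirectSum.of_eq_same]
  · rw [DirectSum.decompose_of_mem_ne _ hp h, DirectSum.of_eq_of_ne _ _ _ (Ne.symm h), map_zero]
    rfl

/-- The decomposition of an element of the quotient ring into homogeneous components. -/
def components : Q.coordRing →+ DirectSum ℕ (fun d => Q.grading d) :=
  QuotientAddGroup.lift _ Q.componentsPoly (by
    intro p hp
    have hI : (Ideal.span {Q.form}).IsHomogeneous (homogeneousSubmodule (Fin (n + 2)) k) :=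
      Ideal.homogeneous_span _ _ (by
        intro x hx
        rw [Set.mem_singleton_iff.1 hx]
        exact ⟨2, Q.isHomogeneous⟩)
    refine DFinsupp.ext fun d => Subtype.ext ?_
    refine (Q.componentsPoly_apply p d).trans ?_
    exact Ideal.Quotient.eq_zero_iff_mem.2 (hI d hp))

lemma components_mk (p : MvPolynomial (Fin (n + 2)) k) :
    Q.components (Ideal.Quotient.mk _ p) = Q.componentsPoly p := rfl

instance : DirectSum.Decomposition Q.grading where
  decompose' := Q.components
  left_inv := by
    intro a
    obtain ⟨p, rfl⟩ := Ideal.Quotient.mk_surjective a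
    classical
    rw [← DirectSum.sum_support_decompose (homogeneousSubmodule (Fin (n + 2)) k) p]
    simp only [map_sum]
    refine Finset.sum_congr rfl fun d _ => ?_
    rw [components_mk, Q.componentsPoly_of_isHomogeneous
      (DirectSum.decompose (homogeneousSubmodule (Fin (n + 2)) k) p d).2]
    exact DirectSum.coeAddMonoidHom_of _ _ _
  right_inv := by
    intro a
    induction a using DirectSum.induction_on with
    | zero => simp
    | of d x =>
      obtain ⟨_, p, hp, rfl⟩ := x
      rw [DirectSum.coeAddMonoidHom_of]
      exact Q.componentsPoly_of_isHomogeneous hp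
    | add x y hx hy => rw [map_add, map_add, hx, hy]

instance : GradedAlgebra Q.grading where

/-- The quadric hypersurface `Q_n`, as the scheme `Proj k[x₀, …, xₙ₊₁] / (form)`. -/
def scheme : Scheme.{u} := Proj Q.grading

/-- The line bundle `𝒪(d)` on the quadric. -/
def lineBundle (d : ℤ) : Q.scheme.Modules := twist Q.grading d

/-- `F(d) = F ⊗ 𝒪(d)`. -/
def serreTwist (F : Q.scheme.Modules) (d : ℤ) : Q.scheme.Modules := tensor F (Q.lineBundle d)

/-- The multiplication map `H⁰(F(d)) × H⁰(𝒪(1)) → H⁰(F(e))` for `e = 1 + d`, sending `(s, l)` to the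
image of `s` under `F ⊗ (l · -) : F ⊗ 𝒪(d) ⟶ F ⊗ 𝒪(e)`. -/
def mulSection (F : Q.scheme.Modules) {d e : ℤ} (h : 1 + d = e) (l : H0 (Q.lineBundle 1))
    (s : H0 (Q.serreTwist F d)) : H0 (Q.serreTwist F e) :=
  (tensorMap F (mulGlobal Q.grading l h)).app ⊤ s

/-- The global section of `𝒪(1)` given by a linear form. -/
def linearSection (p : MvPolynomial (Fin (n + 2)) k) (hp : p.IsHomogeneous 1) :
    H0 (Q.lineBundle 1) :=
  globalOfHomogeneous Q.grading (d := 1) _ (Q.mk_mem_grading hp)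

/-- The data defining a spinor bundle: a matrix factorization `φ ψ = ψ φ = form` by matrices of
linear forms of size `2 ^ ⌊(n + 1) / 2⌋`. Writing `φ = ∑ xᵢ φᵢ`, `ψ = ∑ xᵢ ψᵢ`, this is the same as
an irreducible `ℤ/2`-graded module over the Clifford algebra of `form`, its even and odd parts
having dimension `2 ^ ⌊(n + 1) / 2⌋` and being half-spin representations (`n` even) or the spin
representation (`n` odd). Up to isomorphism there are two of them if `n` is even,
`(φ, ψ)` and `(ψ, φ)`, and one if `n` is odd. -/
structure SpinorFactorization where
  /-- the first matrix -/
  φ : Matrix (Fin (2 ^ ((n + 1) / 2))) (Fin (2 ^ ((n + 1) / 2))) (MvPolynomial (Fin (n + 2)) k)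
  /-- the second matrix -/
  ψ : Matrix (Fin (2 ^ ((n + 1) / 2))) (Fin (2 ^ ((n + 1) / 2))) (MvPolynomial (Fin (n + 2)) k)
  linear_φ : ∀ i j, (φ i j).IsHomogeneous 1
  linear_ψ : ∀ i j, (ψ i j).IsHomogeneous 1
  φ_mul_ψ : φ * ψ = Q.form • (1 : Matrix _ _ _)
  ψ_mul_φ : ψ * φ = Q.form • (1 : Matrix _ _ _)

/-- The spinor bundle `Σ` of a spinor factorization, i.e. the cokernel of
`φ : 𝒪(-1)^N ⟶ 𝒪^N` with `N = 2 ^ ⌊(n + 1) / 2⌋`, so that there is an exact sequence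
`0 ⟶ Σ'(-1) ⟶ 𝒪^N ⟶ Σ ⟶ 0` with `Σ'` the spinor bundle of `(ψ, φ)`. For `n` even one obtains the two
spinor bundles `Σ₁`, `Σ₂` and for `n` odd the spinor bundle `Σ`, normalized to be globally
generated with `H⁰(Σ(-1)) = 0` (for `n = 2`: `𝒪(1, 0)` and `𝒪(0, 1)` on `ℙ¹ × ℙ¹`). -/
def SpinorFactorization.bundle (S : Q.SpinorFactorization) : Q.scheme.Modules :=
  cokernel (biproduct.matrix
    (f := fun _ : Fin (2 ^ ((n + 1) / 2)) => Q.lineBundle (-1))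
    (g := fun _ : Fin (2 ^ ((n + 1) / 2)) => Q.lineBundle 0)
    fun j i => mulGlobal Q.grading (Q.linearSection (S.φ i j) (S.linear_φ i j)) (by norm_num))

/-- `F` is `m`-Qregular: `Hⁱ(F(m - i)) = 0` for `i = 1, …, n - 1`, and `Hⁿ(F(m) ⊗ Σ(-n)) = 0` for
every spinor bundle `Σ` of the quadric. -/
def IsQregular (F : Q.scheme.Modules) (m : ℤ) : Prop :=
  (∀ i : ℕ, 1 ≤ i → i < n → Subsingleton (H i (Q.serreTwist F (m - i)))) ∧
  ∀ S : Q.SpinorFactorization, Subsingleton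
    (H n (tensor (Q.serreTwist F m) (Q.serreTwist S.bundle (-n))))

end SmoothQuadric
end Quadrics
end QuadricSheaf

/-! Write `(φ, ψ)` for a spinor factorization of size N and q for the equation. Over the coordinate
ring `φψ = ψφ = 0`. Differentiating `φψ = q` gives `φ·∂ψ + ∂φ·ψ = ∂q`, and by smoothness some
partial derivative of q is invertible near each point. Hence the two-periodic complex given by `φ`
and `ψ` is locally contractible, and it stays exact after tensoring with an arbitrary sheaf F.

Let K(d) and K'(d) be the kernels of `φ` and `ψ` on F(d)^N. Exactness gives short exact sequences 0
→ K'(d) → F(d)^N → K(d+1) → 0 and the same with K and K' exchanged (`ExactPair.isSES_syz`). Moreover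
F(m) ⊗ Σ(-n) is isomorphic to K(m+1-n) (`isIso_tensorCokerToSyz`). So m-Qregularity says that
H^i(F(m-i)) = 0 for 0 < i < n and that H^n vanishes on K(m+1-n) and K'(m+1-n). Descending induction
on i along these sequences yields H^i(K(m+1-i)) = H^i(K'(m+1-i)) = 0 for 1 ≤ i ≤ n: both kernels are
(m+1)-regular in the sense of Castelnuovo and Mumford.

Classical regularity passes from m+1 to m+2. Therefore, in the sequence for F(m+1-i)^N, the outer
terms K'(m+1-i) and K(m+2-i) have no H^i, so F is (m+1)-Qregular (`ExactPair.IsRegular.succ`). For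
generation, a section t of F(m+1) is placed in one coordinate of F(m+1)^N. Its image under `ψ` is a
combination of linear forms times sections of K(m+1), and these lift to F(m)^N. What remains lies in
K'(m+1), the image of `φ`, and comes from a global section of F(m)^N, so it too is a combination of
linear forms times sections of F(m) (`ExactPair.IsRegular.exists_eq_sum`).

The classical statement is proved for a `GradedFamily`, a notion stable under finite sums and
kernels, so that it applies to K and to all its syzygies. Instead of the Koszul complex it uses the
larger resolution produced by iterating `LinearCover.next`. The resolution can be cut off because
H^{n+1} = 0: projection from a point off the quadric provides n+1 linear forms without common zero
there, hence a cover by n+1 affine open sets, and `subsingleton_H_of_cover` applies. Finally, every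
quadratic form has a matrix factorization of the required size (`nonempty_spinorFactorization`), so
there is a spinor bundle to argue with. -/

namespace QuadricSheaf
open CategoryTheory Opposite TopologicalSpace Limits Abelian AlgebraicGeometry

/-! ### Connecting maps and dimension shifting for Ext groups -/

section Ext
variable {C : Type*} [Category* C] [Abelian C] [HasExt.{u} C]

/-- The abstract Mayer–Vietoris argument: a class on Y that dies on A and on B dies on their
biproduct, so it comes from X through the connecting map, which kills everything extended from A or
B. -/
lemma exists_connecting_of_shortExact {X A B Y F : C} {f : X ⟶ A} {f' : X ⟶ B} {g : A ⟶ Y}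
    {g' : B ⟶ Y} {w : biprod.lift f (-f') ≫ biprod.desc g g' = 0}
    (hS : (ShortComplex.mk _ _ w).ShortExact) {p : ℕ} (c : Ext Y F (p + 1))
    (h₁ : (Ext.mk₀ g).precomp F (zero_add _) c = 0)
    (h₂ : (Ext.mk₀ g').precomp F (zero_add _) c = 0) :
    ∃ δ : Ext X F p →+ Ext Y F (p + 1),
      (∀ a : Ext A F p, δ ((Ext.mk₀ f).precomp F (zero_add _) a) = 0) ∧
      (∀ a : Ext B F p, δ ((Ext.mk₀ f').precomp F (zero_add _) a) = 0) ∧ ∃ e, δ e = c := by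
  refine ⟨hS.extClass.precomp F (by omega), fun a => ?_, fun a => ?_, ?_⟩
  · have : (Ext.mk₀ f).comp a (zero_add _) =
        (Ext.mk₀ (biprod.lift f (-f'))).comp ((Ext.mk₀ biprod.fst).comp a (zero_add _))
          (zero_add _) := by
      rw [← Ext.comp_assoc _ _ _ (add_zero 0) (zero_add p) (by omega), Ext.mk₀_comp_mk₀,
        biprod.lift_fst]
    change hS.extClass.comp ((Ext.mk₀ f).comp a (zero_add _)) (add_comm 1 p) = 0
    rw [this, ← Ext.comp_assoc _ _ _ (add_zero 1) (zero_add p) (by omega)]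
    erw [hS.extClass_comp]
    rw [Ext.zero_comp]
  · have : (Ext.mk₀ f').comp a (zero_add _) =
        (Ext.mk₀ (biprod.lift f (-f'))).comp ((Ext.mk₀ (-biprod.snd)).comp a (zero_add _))
          (zero_add _) := by
      rw [← Ext.comp_assoc _ _ _ (add_zero 0) (zero_add p) (by omega), Ext.mk₀_comp_mk₀,
        Preadditive.comp_neg, biprod.lift_snd, neg_neg]
    change hS.extClass.comp ((Ext.mk₀ f').comp a (zero_add _)) (add_comm 1 p) = 0
    rw [this, ← Ext.comp_assoc _ _ _ (add_zero 1) (zero_add p) (by omega)]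
    erw [hS.extClass_comp]
    rw [Ext.zero_comp]
  · refine Ext.contravariant_sequence_exact₃ hS _ c ?_ (by omega)
    apply Ext.biprod_ext
    · rw [← Ext.comp_assoc _ _ _ (add_zero 0) (zero_add _) (by omega), Ext.mk₀_comp_mk₀,
        Ext.comp_zero, biprod.inl_desc]
      exact h₁
    · rw [← Ext.comp_assoc _ _ _ (add_zero 0) (zero_add _) (by omega), Ext.mk₀_comp_mk₀,
        Ext.comp_zero, biprod.inr_desc]
      exact h₂

/-- Dimension shifting: I is injective containing F, G = I/F and e is the class of the extension.
Since Ext of positive degree into I vanishes, composition with e is onto. -/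
lemma exists_ext_lift [EnoughInjectives C] (F : C) :
    ∃ (I G : C) (g : I ⟶ G), Epi g ∧ ∃ e : Ext G F 1, (Ext.mk₀ g).comp e (zero_add 1) = 0 ∧
      ∀ (Z : C) (p : ℕ) (c : Ext Z F (p + 1)), ∃ c' : Ext Z G p, c'.comp e rfl = c := by
  let S : ShortComplex C := ShortComplex.mk (Injective.ι F) (cokernel.π (Injective.ι F)) (by simp)
  have hS : S.ShortExact :=
    { exact := ShortComplex.exact_of_g_is_cokernel _ (cokernelIsCokernel _) }
  exact ⟨_, _, S.g, hS.epi_g, hS.extClass, hS.comp_extClass, fun Z p c =>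
    Ext.covariant_sequence_exact₁ _ hS c (Ext.eq_zero_of_injective _) rfl⟩

/-- The connecting map kills a map to the quotient once its restriction lifts to I. -/
lemma ext_precomp_comp_eq_zero {F G I W Z : C} {g : I ⟶ G} {e : Ext G F 1}
    (he : (Ext.mk₀ g).comp e (zero_add 1) = 0) {f : Z ⟶ G} {k : W ⟶ Z} {s : W ⟶ I}
    (h : k ≫ f = s ≫ g) :
    (Ext.mk₀ k).precomp F (zero_add _) ((Ext.homEquiv₀.symm f).comp e rfl) = 0 := by
  change (Ext.mk₀ k).comp ((Ext.homEquiv₀.symm f).comp e (zero_add 1)) (zero_add 1) = 0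
  rw [Ext.homEquiv₀_symm_apply, ← Ext.comp_assoc _ _ _ (add_zero 0) (zero_add 1) (by omega),
    Ext.mk₀_comp_mk₀, h, ← Ext.mk₀_comp_mk₀,
    Ext.comp_assoc _ _ _ (add_zero 0) (zero_add 1) (by omega), he, Ext.comp_zero]

lemma ext_precomp_comp_eq_zero' {F G W Z : C} {p : ℕ} (e : Ext G F 1) (c : Ext Z G (p + 1))
    (k : W ⟶ Z) (h : (Ext.mk₀ k).precomp G (zero_add _) c = 0) :
    (Ext.mk₀ k).precomp F (zero_add _) (c.comp e rfl) = 0 := by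
  have hassoc := Ext.comp_assoc (Ext.mk₀ k) c e (zero_add (p + 1))
    (show p + 1 + 1 = p + 1 + 1 from rfl) (show 0 + (p + 1) + 1 = p + 1 + 1 by omega)
  change (Ext.mk₀ k).comp c (zero_add (p + 1)) = 0 at h
  rw [h, Ext.zero_comp] at hassoc
  exact hassoc.symm

end Ext

/-! ### Cohomology of open subsets as Ext from free abelian sheaves -/

section FreeSheaf
variable {X : TopCat.{u}}

/-- The free abelian sheaf on an open subset. -/
noncomputable abbrev freeSheaf (U : Opens X) :
    Sheaf (Opens.grothendieckTopology X) AddCommGrpCat.{u} :=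
  (presheafToSheaf _ _).obj (yoneda.obj U ⋙ AddCommGrpCat.free)

/-- The map of free abelian sheaves given by an inclusion of open subsets. -/
noncomputable abbrev freeSheafMap {U V : Opens X} (i : U ⟶ V) : freeSheaf U ⟶ freeSheaf V :=
  (presheafToSheaf _ _).map (Functor.whiskerRight (yoneda.map i) _)

/-- Morphisms from the free abelian sheaf on `U` are sections over `U`. -/
noncomputable def freeSheafHomEquiv (U : Opens X)
    (F : Sheaf (Opens.grothendieckTopology X) AddCommGrpCat.{u}) :
    (freeSheaf U ⟶ F) ≃ F.obj.obj (op U) :=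
  ((sheafificationAdjunction _ _).homEquiv _ _).trans
    (((AddCommGrpCat.adj.whiskerRight _).homEquiv (yoneda.obj U) F.obj).trans yonedaEquiv)

lemma freeSheafHomEquiv_naturality_right (U : Opens X)
    {F G : Sheaf (Opens.grothendieckTopology X) AddCommGrpCat.{u}} (f : freeSheaf U ⟶ F)
    (g : F ⟶ G) :
    freeSheafHomEquiv U G (f ≫ g) = g.hom.app _ (freeSheafHomEquiv U F f) := by
  simp only [freeSheafHomEquiv, Equiv.trans_apply]
  rw [Adjunction.homEquiv_naturality_right]
  erw [Adjunction.homEquiv_naturality_right]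
  rfl

lemma freeSheafHomEquiv_naturality_left {U V : Opens X} (i : U ⟶ V)
    {F : Sheaf (Opens.grothendieckTopology X) AddCommGrpCat.{u}} (f : freeSheaf V ⟶ F) :
    freeSheafHomEquiv U F (freeSheafMap i ≫ f) = F.obj.map i.op (freeSheafHomEquiv V F f) := by
  simp only [freeSheafHomEquiv, Equiv.trans_apply]
  rw [Adjunction.homEquiv_naturality_left]
  erw [Adjunction.homEquiv_naturality_left]
  exact (yonedaEquiv_naturality _ _).symm

lemma isZero_freeSheaf_bot : IsZero (freeSheaf (⊥ : Opens X)) := by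
  rw [IsZero.iff_id_eq_zero]
  apply (freeSheafHomEquiv _ _).injective
  have := AddCommGrpCat.subsingleton_of_isZero
    ((TopCat.Sheaf.isTerminalOfEmpty (F := (freeSheaf (⊥ : Opens X)))).isZero)
  exact Subsingleton.elim _ _

variable [HasExt.{u} (Sheaf (Opens.grothendieckTopology X) AddCommGrpCat.{u})]

/-- Restriction of cohomology classes to a smaller open subset. -/
noncomputable def extRestrict {U V : Opens X} (i : U ⟶ V)
    (F : Sheaf (Opens.grothendieckTopology X) AddCommGrpCat.{u}) (p : ℕ) :
    Ext (freeSheaf V) F p →+ Ext (freeSheaf U) F p :=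
  (Ext.mk₀ (freeSheafMap i)).precomp F (zero_add p)

lemma extRestrict_comp {U V W : Opens X} (i : U ⟶ V) (j : V ⟶ W)
    (F : Sheaf (Opens.grothendieckTopology X) AddCommGrpCat.{u}) (p : ℕ)
    (c : Ext (freeSheaf W) F p) :
    extRestrict i F p (extRestrict j F p c) = extRestrict (i ≫ j) F p c := by
  change (Ext.mk₀ (freeSheafMap i)).comp ((Ext.mk₀ (freeSheafMap j)).comp c (zero_add p))
    (zero_add p) = (Ext.mk₀ (freeSheafMap (i ≫ j))).comp c (zero_add p)
  have h : freeSheafMap i ≫ freeSheafMap j = freeSheafMap (i ≫ j) := by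
    simp only [freeSheafMap, ← Functor.map_comp, ← Functor.whiskerRight_comp]
  rw [← Ext.comp_assoc _ _ _ (add_zero 0) (zero_add p) (by omega), Ext.mk₀_comp_mk₀,
    h]

/-- Every cohomology class of positive degree vanishes locally. -/
lemma exists_extRestrict_eq_zero (p : ℕ)
    (F : Sheaf (Opens.grothendieckTopology X) AddCommGrpCat.{u}) (U : Opens X)
    (c : Ext (freeSheaf U) F (p + 1)) (x : X) (hx : x ∈ U) :
    ∃ (W : Opens X) (i : W ⟶ U), x ∈ W ∧ extRestrict i F (p + 1) c = 0 := by
  induction p generalizing F U with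
  | zero =>
    obtain ⟨I, G, g, hg, e, he, hc⟩ := exists_ext_lift F
    obtain ⟨c', hc'⟩ := hc _ _ c
    obtain ⟨f, rfl⟩ := Ext.homEquiv₀.symm.surjective c'
    have hl : TopCat.Presheaf.IsLocallySurjective g.hom :=
      (TopCat.Sheaf.isLocallySurjective_iff_epi g).2 hg
    rw [TopCat.Presheaf.isLocallySurjective_iff] at hl
    -- A class of degree one is the connecting image of a section of the quotient G, and such a
    -- section lifts to I near x.
    obtain ⟨W, hW, ⟨s, hs⟩, hxW⟩ := hl U (freeSheafHomEquiv U G f) x hx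
    refine ⟨W, homOfLE hW, hxW, ?_⟩
    have key : freeSheafMap (homOfLE hW) ≫ f = (freeSheafHomEquiv W I).symm s ≫ g := by
      apply (freeSheafHomEquiv W G).injective
      rw [freeSheafHomEquiv_naturality_left, freeSheafHomEquiv_naturality_right,
        Equiv.apply_symm_apply]
      exact hs.symm
    rw [← hc']
    exact ext_precomp_comp_eq_zero he key
  | succ p ih =>
    obtain ⟨I, G, g, hg, e, he, hc⟩ := exists_ext_lift F
    obtain ⟨c', hc'⟩ := hc _ _ c
    -- In higher degree the class is shifted to one of degree one less with coefficients in G, and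
    -- restriction commutes with the shift.
    obtain ⟨W, i, hxW, h⟩ := ih G U c' hx
    refine ⟨W, i, hxW, ?_⟩
    rw [← hc']
    exact ext_precomp_comp_eq_zero' e c' _ h

/-- The Mayer-Vietoris sequence for two open subsets. -/
lemma exists_connecting_of_extRestrict_eq_zero
    (F : Sheaf (Opens.grothendieckTopology X) AddCommGrpCat.{u}) (U V W : Opens X)
    (i : U ⟶ W) (j : V ⟶ W) (hW : W = U ⊔ V) (p : ℕ) (c : Ext (freeSheaf W) F (p + 1))
    (h₁ : extRestrict i F (p + 1) c = 0) (h₂ : extRestrict j F (p + 1) c = 0) :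
    ∃ δ : Ext (freeSheaf (U ⊓ V)) F p →+ Ext (freeSheaf W) F (p + 1),
      (∀ a : Ext (freeSheaf U) F p, δ (extRestrict (homOfLE inf_le_left) F p a) = 0) ∧
      (∀ a : Ext (freeSheaf V) F p, δ (extRestrict (homOfLE inf_le_right) F p a) = 0) ∧
      ∃ e, δ e = c := by
  subst hW
  exact exists_connecting_of_shortExact
    (Opens.mayerVietorisSquare U V).shortComplex_shortExact c h₁ h₂

end FreeSheaf
end QuadricSheaf

namespace QuadricSheaf
open CategoryTheory Opposite TopologicalSpace Limits Abelian AlgebraicGeometry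

/-! ### Comparison with global cohomology, and gluing over two open sets -/

section FreeSheaf
variable {X : TopCat.{u}}

lemma freeSheafHomEquiv_add (U : Opens X)
    {F : Sheaf (Opens.grothendieckTopology X) AddCommGrpCat.{u}} (f g : freeSheaf U ⟶ F) :
    freeSheafHomEquiv U F (f + g) = freeSheafHomEquiv U F f + freeSheafHomEquiv U F g := by
  have h (f : freeSheaf U ⟶ F) := freeSheafHomEquiv_naturality_right U (𝟙 _) f
  simp only [Category.id_comp] at h
  rw [h f, h g, h (f + g)]
  rfl

/-- Morphisms from the constant sheaf `ℤ` are global sections. -/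
noncomputable def constantSheafHomEquiv
    (F : Sheaf (Opens.grothendieckTopology X) AddCommGrpCat.{u}) :
    ((constantSheaf _ AddCommGrpCat.{u}).obj (AddCommGrpCat.of (ULift.{u} ℤ)) ⟶ F) ≃
      F.obj.obj (op ⊤) :=
  ((constantSheafAdj _ AddCommGrpCat isTerminalTop).homEquiv _ F).trans
    (AddCommGrpCat.uliftZMultiplesAddEquiv _).toEquiv

lemma constantSheafHomEquiv_naturality
    {F G : Sheaf (Opens.grothendieckTopology X) AddCommGrpCat.{u}}
    (f : (constantSheaf _ AddCommGrpCat.{u}).obj (AddCommGrpCat.of (ULift.{u} ℤ)) ⟶ F) (g : F ⟶ G) :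
    constantSheafHomEquiv G (f ≫ g) = g.hom.app _ (constantSheafHomEquiv F f) := by
  simp only [constantSheafHomEquiv, Equiv.trans_apply]
  rw [Adjunction.homEquiv_naturality_right]
  rfl

/-- The constant sheaf `ℤ` is the free abelian sheaf on the whole space. -/
noncomputable def constantSheafIso :
    (constantSheaf (Opens.grothendieckTopology X) AddCommGrpCat.{u}).obj
      (AddCommGrpCat.of (ULift.{u} ℤ)) ≅ freeSheaf (⊤ : Opens X) where
  hom := (constantSheafHomEquiv _).symm (freeSheafHomEquiv ⊤ _ (𝟙 _))
  inv := (freeSheafHomEquiv ⊤ _).symm (constantSheafHomEquiv _ (𝟙 _))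
  hom_inv_id := by
    apply (constantSheafHomEquiv _).injective
    rw [constantSheafHomEquiv_naturality, Equiv.apply_symm_apply,
      ← freeSheafHomEquiv_naturality_right, Category.id_comp, Equiv.apply_symm_apply]
  inv_hom_id := by
    apply (freeSheafHomEquiv _ _).injective
    rw [freeSheafHomEquiv_naturality_right, Equiv.apply_symm_apply,
      ← constantSheafHomEquiv_naturality, Category.id_comp, Equiv.apply_symm_apply]

variable [HasExt.{u} (Sheaf (Opens.grothendieckTopology X) AddCommGrpCat.{u})]

/-- `Sheaf.H` is Ext from the constant sheaf ℤ. That sheaf represents global sections, as does the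
free sheaf on the whole space, so the two are isomorphic. -/
lemma subsingleton_H_of_subsingleton_ext
    {F : Sheaf (Opens.grothendieckTopology X) AddCommGrpCat.{u}} {p : ℕ}
    (h : Subsingleton (Ext (freeSheaf (⊤ : Opens X)) F p)) : Subsingleton (Sheaf.H.{u} F p) := by
  refine subsingleton_of_forall_eq 0 fun c => ?_
  have h1 : c = (Ext.mk₀ (constantSheafIso (X := X)).hom).comp
      ((Ext.mk₀ (constantSheafIso (X := X)).inv).comp c (zero_add p)) (zero_add p) := by
    rw [← Ext.comp_assoc _ _ _ (add_zero 0) (zero_add p) (by omega), Ext.mk₀_comp_mk₀,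
      Iso.hom_inv_id, Ext.mk₀_id_comp]
  rw [h1]
  exact (congrArg (fun e => (Ext.mk₀ (constantSheafIso (X := X)).hom).comp e (zero_add p))
    (Subsingleton.elim _ 0)).trans (Ext.comp_zero _ _ _ _ _)

lemma extRestrict_id {U : Opens X} (i : U ⟶ U)
    (F : Sheaf (Opens.grothendieckTopology X) AddCommGrpCat.{u}) (p : ℕ)
    (c : Ext (freeSheaf U) F p) : extRestrict i F p c = c := by
  obtain rfl : i = 𝟙 U := Subsingleton.elim _ _
  change (Ext.mk₀ (freeSheafMap (𝟙 U))).comp c (zero_add p) = c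
  have h : freeSheafMap (𝟙 U) = 𝟙 _ :=
    (yoneda ⋙ (Functor.whiskeringRight _ _ _).obj AddCommGrpCat.free ⋙
      presheafToSheaf (Opens.grothendieckTopology X) AddCommGrpCat).map_id U
  rw [h, Ext.mk₀_id_comp]

lemma extRestrict_eq_zero_of_le {U V W : Opens X} (h : U ≤ V) {j : V ⟶ W} (k : U ⟶ W)
    {F : Sheaf (Opens.grothendieckTopology X) AddCommGrpCat.{u}} {p : ℕ}
    {c : Ext (freeSheaf W) F p} (hc : extRestrict j F p c = 0) : extRestrict k F p c = 0 := by
  have := extRestrict_comp (homOfLE h) j F p c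
  rw [hc, map_zero] at this
  exact this.symm

lemma eq_zero_of_extRestrict_of_le {U V : Opens X} (h : V ≤ U) {j : U ⟶ V}
    {F : Sheaf (Opens.grothendieckTopology X) AddCommGrpCat.{u}} {p : ℕ}
    {c : Ext (freeSheaf V) F p} (hc : extRestrict j F p c = 0) : c = 0 := by
  rw [← extRestrict_id (𝟙 V) F p c]
  exact extRestrict_eq_zero_of_le h _ hc

lemma subsingleton_ext_of_eq_bot {U : Opens X} (hU : U = ⊥)
    (F : Sheaf (Opens.grothendieckTopology X) AddCommGrpCat.{u}) (p : ℕ) :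
    Subsingleton (Ext (freeSheaf U) F p) := by
  subst hU
  refine subsingleton_of_forall_eq 0 fun c => ?_
  rw [← Ext.mk₀_id_comp c, (IsZero.iff_id_eq_zero _).1 isZero_freeSheaf_bot, Ext.mk₀_zero,
    Ext.zero_comp]

lemma extRestrict_homEquiv₀_symm {U V : Opens X} (i : U ⟶ V)
    (F : Sheaf (Opens.grothendieckTopology X) AddCommGrpCat.{u}) (f : freeSheaf V ⟶ F) :
    extRestrict i F 0 (Ext.homEquiv₀.symm f) = Ext.homEquiv₀.symm (freeSheafMap i ≫ f) := by
  rw [Ext.homEquiv₀_symm_apply, Ext.homEquiv₀_symm_apply]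
  exact Ext.mk₀_comp_mk₀ _ _

/-- If all the sections over `U ⊓ V` are sums of sections over `U` and over `V`, the restrictions
to `U` and `V` detect the first cohomology of `U ⊔ V`. -/
lemma eq_zero_of_extRestrict_eq_zero
    (F : Sheaf (Opens.grothendieckTopology X) AddCommGrpCat.{u}) {U V W : Opens X}
    (i : U ⟶ W) (j : V ⟶ W) (hW : W = U ⊔ V) (c : Ext (freeSheaf W) F 1)
    (h₁ : extRestrict i F 1 c = 0) (h₂ : extRestrict j F 1 c = 0)
    (H : ∀ s : F.obj.obj (op (U ⊓ V)), ∃ (a : F.obj.obj (op U)) (b : F.obj.obj (op V)),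
      s = F.obj.map (homOfLE inf_le_left).op a + F.obj.map (homOfLE inf_le_right).op b) :
    c = 0 := by
  obtain ⟨δ, ha, hb, e, rfl⟩ := exists_connecting_of_extRestrict_eq_zero F U V W i j hW 0 c h₁ h₂
  obtain ⟨f, rfl⟩ := Ext.homEquiv₀.symm.surjective e
  obtain ⟨a, b, hab⟩ := H (freeSheafHomEquiv _ _ f)
  have : f = freeSheafMap (homOfLE inf_le_left) ≫ (freeSheafHomEquiv _ _).symm a +
      freeSheafMap (homOfLE inf_le_right) ≫ (freeSheafHomEquiv _ _).symm b := by
    apply (freeSheafHomEquiv _ _).injective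
    rw [freeSheafHomEquiv_add, freeSheafHomEquiv_naturality_left,
      freeSheafHomEquiv_naturality_left, Equiv.apply_symm_apply, Equiv.apply_symm_apply, hab]
  rw [this, Ext.homEquiv₀_symm_apply, Ext.mk₀_add, ← Ext.homEquiv₀_symm_apply,
    ← Ext.homEquiv₀_symm_apply, ← extRestrict_homEquiv₀_symm, ← extRestrict_homEquiv₀_symm,
    map_add, ha, hb, add_zero]

lemma eq_zero_of_extRestrict_eq_zero_of_subsingleton
    (F : Sheaf (Opens.grothendieckTopology X) AddCommGrpCat.{u}) {U V W : Opens X}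
    (i : U ⟶ W) (j : V ⟶ W) (hW : W = U ⊔ V) (p : ℕ) (c : Ext (freeSheaf W) F (p + 1))
    (h₁ : extRestrict i F (p + 1) c = 0) (h₂ : extRestrict j F (p + 1) c = 0)
    (H : Subsingleton (Ext (freeSheaf (U ⊓ V)) F p)) : c = 0 := by
  obtain ⟨δ, ha, hb, e, rfl⟩ := exists_connecting_of_extRestrict_eq_zero F U V W i j hW p c h₁ h₂
  rw [Subsingleton.elim e 0, map_zero]

end FreeSheaf

/-! ### Sections over basic open subsets -/

section Sections
variable {X : Scheme.{u}} (M : X.Modules)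
open AlgebraicGeometry.Scheme.Modules

/-- Restriction of sections. -/
noncomputable def res {U V : X.Opens} (h : U ≤ V) :
    M.presheaf.obj (op V) →+ M.presheaf.obj (op U) :=
  (M.presheaf.map (homOfLE h).op).hom

/-- Restriction of functions. -/
noncomputable def resO {U V : X.Opens} (h : U ≤ V) :
    X.presheaf.obj (op V) →+* X.presheaf.obj (op U) :=
  (X.presheaf.map (homOfLE h).op).hom

@[simp] lemma res_res {U V W : X.Opens} (h : U ≤ V) (h' : V ≤ W) (s : M.presheaf.obj (op W)) :
    res M h (res M h' s) = res M (h.trans h') s := by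
  simp only [res]
  rw [← AddCommGrpCat.comp_apply, ← Functor.map_comp]
  rfl

@[simp] lemma res_self {U : X.Opens} (h : U ≤ U) (s : M.presheaf.obj (op U)) :
    res M h s = s := by
  simp only [res]
  rw [show (homOfLE h).op = 𝟙 _ from rfl, CategoryTheory.Functor.map_id]
  rfl

@[simp] lemma resO_resO {U V W : X.Opens} (h : U ≤ V) (h' : V ≤ W) (s : X.presheaf.obj (op W)) :
    resO h (resO h' s) = resO (h.trans h') s := by
  simp only [resO]
  rw [← CommRingCat.comp_apply, ← Functor.map_comp]
  rfl

lemma res_smul {U V : X.Opens} (h : U ≤ V) (r : X.presheaf.obj (op V))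
    (s : M.presheaf.obj (op V)) : res M h (r • s) = resO h r • res M h s :=
  Scheme.Modules.map_smul M _ r s

variable {M} in
lemma app_res {N : X.Modules} (f : M ⟶ N) {U V : X.Opens} (h : U ≤ V)
    (s : M.presheaf.obj (op V)) : f.app U (res M h s) = res N h (f.app V s) :=
  ConcreteCategory.congr_hom (f.mapPresheaf.naturality (homOfLE h).op) s

lemma section_ext {U : X.Opens} {s t : M.presheaf.obj (op U)}
    (h : ∀ x ∈ U, ∃ (V : X.Opens) (hV : V ≤ U), x ∈ V ∧ res M hV s = res M hV t) : s = t := by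
  choose V hV hx he using h
  refine TopCat.Sheaf.eq_of_locally_eq' ⟨M.presheaf, M.isSheaf⟩ (fun x : U => V x.1 x.2) U
    (fun x => homOfLE (hV x.1 x.2)) ?_ s t fun x => he x.1 x.2
  intro x hxU
  exact Opens.mem_iSup.2 ⟨⟨x, hxU⟩, hx x hxU⟩

lemma exists_glue {ι : Type u} {U : X.Opens} (V : ι → X.Opens) (hV : ∀ i, V i ≤ U)
    (hU : ∀ x ∈ U, ∃ i, x ∈ V i) (s : ∀ i, M.presheaf.obj (op (V i)))
    (h : ∀ i j, res M (inf_le_left : V i ⊓ V j ≤ V i) (s i) = res M inf_le_right (s j)) :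
    ∃ t : M.presheaf.obj (op U), ∀ i, res M (hV i) t = s i := by
  obtain ⟨t, ht, -⟩ := TopCat.Sheaf.existsUnique_gluing' ⟨M.presheaf, M.isSheaf⟩ V U
    (fun i => homOfLE (hV i)) (fun x hx => Opens.mem_iSup.2 (hU x hx)) s h
  exact ⟨t, ht⟩

/-- Sections of `M` on the open subsets `D(r)` of `V` are, up to powers of `r`, sections on `V`. -/
structure IsLocalizingOn (V : X.Opens) : Prop where
  exists_extension : ∀ (r : X.presheaf.obj (op V)) (s : M.presheaf.obj (op (X.basicOpen r))),
    ∃ (N : ℕ) (t : M.presheaf.obj (op V)),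
      res M (X.basicOpen_le r) t = resO (X.basicOpen_le r) r ^ N • s
  exists_pow_smul_eq_zero : ∀ (r : X.presheaf.obj (op V)) (t : M.presheaf.obj (op V)),
    res M (X.basicOpen_le r) t = 0 → ∃ N : ℕ, r ^ N • t = 0

variable {M} in
lemma IsLocalizingOn.exists_extension' {V W : X.Opens} (h : IsLocalizingOn M V)
    (r : X.presheaf.obj (op V)) (hW : W = X.basicOpen r) (hWV : W ≤ V)
    (s : M.presheaf.obj (op W)) :
    ∃ (N : ℕ) (t : M.presheaf.obj (op V)), res M hWV t = resO hWV r ^ N • s := by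
  subst hW
  exact h.exists_extension r s

lemma basicOpen_resO {U V : X.Opens} (h : U ≤ V) (r : X.presheaf.obj (op V)) :
    X.basicOpen (resO h r) = U ⊓ X.basicOpen r :=
  X.basicOpen_res r (homOfLE h).op

/-- Vanishing of the Čech H^1 of the cover by D(f) and D(g). -/
lemma exists_eq_add_of_isCoprime {V : X.Opens} (f g : X.presheaf.obj (op V)) (hfg : IsCoprime f g)
    (h₁ : IsLocalizingOn M (X.basicOpen f)) (h₂ : IsLocalizingOn M (X.basicOpen g))
    (s : M.presheaf.obj (op (X.basicOpen f ⊓ X.basicOpen g))) :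
    ∃ (a : M.presheaf.obj (op (X.basicOpen f))) (b : M.presheaf.obj (op (X.basicOpen g))),
      s = res M inf_le_left a + res M inf_le_right b := by
  obtain ⟨N₁, t₁, ht₁⟩ := h₁.exists_extension' (resO (X.basicOpen_le f) g)
    (basicOpen_resO _ _).symm inf_le_left s
  obtain ⟨N₂, t₂, ht₂⟩ := h₂.exists_extension' (resO (X.basicOpen_le g) f)
    (by rw [basicOpen_resO, inf_comm]) inf_le_right s
  -- The section times g^N₁ extends to D(f), and times f^N₂ it extends to D(g). The relation α f^N₂
  -- + β g^N₁ = 1 recombines the two extensions.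
  obtain ⟨α, β, hαβ⟩ := hfg.pow (m := N₂) (n := N₁)
  refine ⟨resO (X.basicOpen_le f) β • t₁, resO (X.basicOpen_le g) α • t₂, ?_⟩
  have := congrArg (resO (inf_le_left.trans (X.basicOpen_le f) :
    X.basicOpen f ⊓ X.basicOpen g ≤ V)) hαβ
  simp only [map_add, map_mul, map_pow, map_one] at this
  rw [res_smul, res_smul, ht₁, ht₂]
  simp only [resO_resO]
  rw [smul_smul, smul_smul, ← add_smul, add_comm, this, one_smul]

end Sections
end QuadricSheaf

namespace QuadricSheaf
open CategoryTheory Opposite TopologicalSpace Limits Abelian AlgebraicGeometry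

/-! ### Serre vanishing and cohomological dimension -/

section Vanishing
variable {X : Scheme.{u}} (M : X.Modules)

/-- The abelian sheaf underlying a sheaf of modules. -/
noncomputable abbrev abSheaf : Sheaf (Opens.grothendieckTopology X) AddCommGrpCat.{u} :=
  (SheafOfModules.toSheaf X.ringCatSheaf).obj M

/-- The functions `r` on `V` such that a cohomology class on `V` vanishes on `D(r)`. -/
noncomputable def vanishingIdeal {V : X.Opens} (hV : IsAffineOpen V) (p : ℕ)
    (c : Ext (freeSheaf V) (abSheaf M) (p + 1))
    (hloc : ∀ W : X.Opens, IsAffineOpen W → W ≤ V → IsLocalizingOn M W)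
    (hp : ∀ W : X.Opens, IsAffineOpen W → W ≤ V → p ≠ 0 →
      Subsingleton (Ext (freeSheaf W) (abSheaf M) p)) : Ideal (X.presheaf.obj (op V)) where
  carrier := {r | extRestrict (homOfLE (X.basicOpen_le r)) (abSheaf M) (p + 1) c = 0}
  zero_mem' := by
    have := subsingleton_ext_of_eq_bot (X.basicOpen_zero V) (abSheaf M) (p + 1)
    exact Subsingleton.elim _ _
  smul_mem' := by
    intro a r hr
    have h : X.basicOpen (a * r) ≤ X.basicOpen r := by
      rw [X.basicOpen_mul]
      exact inf_le_right
    change extRestrict (homOfLE (X.basicOpen_le (a * r))) _ _ c = 0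
    exact extRestrict_eq_zero_of_le h _ hr
  add_mem' := by
    intro f g hf hg
    change extRestrict (homOfLE (X.basicOpen_le (f + g))) _ _ c = 0
    have hW := hV.basicOpen (f + g)
    have hWV := X.basicOpen_le (f + g)
    set W := X.basicOpen (f + g)
    have hres (r : X.presheaf.obj (op V))
        (hr : extRestrict (homOfLE (X.basicOpen_le r)) (abSheaf M) (p + 1) c = 0) :
        extRestrict (homOfLE (X.basicOpen_le (resO hWV r))) (abSheaf M) (p + 1)
          (extRestrict (homOfLE hWV) (abSheaf M) (p + 1) c) = 0 := by
      have h : X.basicOpen (resO hWV r) ≤ X.basicOpen r := by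
        rw [basicOpen_resO]
        exact inf_le_right
      rw [extRestrict_comp (homOfLE (X.basicOpen_le (resO hWV r))) (homOfLE hWV) (abSheaf M)]
      exact extRestrict_eq_zero_of_le h _ hr
    -- On D(f + g) the sum f + g is a unit, so f and g generate the unit ideal there and their
    -- nonvanishing sets cover it.
    have hcover : W = X.basicOpen (resO hWV f) ⊔ X.basicOpen (resO hWV g) := by
      rw [basicOpen_resO, basicOpen_resO, ← inf_sup_left]
      exact (inf_eq_left.2 (X.basicOpen_add_le f g)).symm
    -- A class of degree one is killed by splitting sections over the intersection. In higher degree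
    -- the intersection is affine and has no cohomology one degree lower.
    rcases Nat.eq_zero_or_pos p with rfl | hp0
    · refine eq_zero_of_extRestrict_eq_zero _ _ _ hcover _ (hres f hf) (hres g hg) ?_
      have hu : IsUnit (resO hWV (f + g)) := RingedSpace.isUnit_res_basicOpen _ _
      rw [map_add] at hu
      have hcop : IsCoprime (resO hWV f) (resO hWV g) := by
        obtain ⟨u, hu⟩ := hu
        refine ⟨↑u⁻¹, ↑u⁻¹, ?_⟩
        rw [← mul_add, ← hu, Units.inv_mul]
      exact exists_eq_add_of_isCoprime M _ _ hcop
        (hloc _ (hW.basicOpen _) ((X.basicOpen_le _).trans hWV))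
        (hloc _ (hW.basicOpen _) ((X.basicOpen_le _).trans hWV))
    · refine eq_zero_of_extRestrict_eq_zero_of_subsingleton _ _ _ hcover p _ (hres f hf)
        (hres g hg) ?_
      refine hp _ ?_ (inf_le_left.trans ((X.basicOpen_le _).trans hWV)) hp0.ne'
      have := (hW.basicOpen (resO hWV f)).basicOpen
        (resO (X.basicOpen_le (resO hWV f)) (resO hWV g))
      rwa [basicOpen_resO] at this

/-- Serre's vanishing theorem on affine open subsets. -/
theorem subsingleton_ext_of_isAffineOpen {V : X.Opens} (hV : IsAffineOpen V)
    (hloc : ∀ W : X.Opens, IsAffineOpen W → W ≤ V → IsLocalizingOn M W) (p : ℕ) :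
    Subsingleton (Ext (freeSheaf V) (abSheaf M) (p + 1)) := by
  have key (p : ℕ) (V : X.Opens) (hV : IsAffineOpen V)
      (hloc : ∀ W : X.Opens, IsAffineOpen W → W ≤ V → IsLocalizingOn M W)
      (hp : ∀ W : X.Opens, IsAffineOpen W → W ≤ V → p ≠ 0 →
        Subsingleton (Ext (freeSheaf W) (abSheaf M) p)) :
      Subsingleton (Ext (freeSheaf V) (abSheaf M) (p + 1)) := by
    refine subsingleton_of_forall_eq 0 fun c => ?_
    let I := vanishingIdeal M hV p c hloc hp
    -- The class vanishes locally, so the basic open sets given by `I` cover V. Then 1 belongs to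
    -- `I`, and D(1) = V.
    have hI : Ideal.span (I : Set (X.presheaf.obj (op V))) = ⊤ := by
      rw [← hV.self_le_iSup_basicOpen_iff]
      intro x hx
      obtain ⟨W, i, hxW, hW⟩ := exists_extRestrict_eq_zero p (abSheaf M) V c x hx
      obtain ⟨r, hrW, hxr⟩ := hV.exists_basicOpen_le ⟨x, hxW⟩ hx
      refine Opens.mem_iSup.2 ⟨⟨r, ?_⟩, hxr⟩
      change extRestrict (homOfLE (X.basicOpen_le r)) (abSheaf M) (p + 1) c = 0
      exact extRestrict_eq_zero_of_le hrW _ hW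
    rw [Ideal.span_eq] at hI
    have h1 : (1 : X.presheaf.obj (op V)) ∈ I := hI ▸ Submodule.mem_top
    exact eq_zero_of_extRestrict_of_le (X.basicOpen_of_isUnit isUnit_one).ge h1
  induction p generalizing V with
  | zero => exact key 0 V hV hloc fun _ _ _ h => absurd rfl h
  | succ p ih =>
    exact key (p + 1) V hV hloc fun W hW hWV _ => ih hW fun W' h h' => hloc W' h (h'.trans hWV)

/-- Cohomological dimension of a union of affine open subsets. -/
theorem subsingleton_ext_iSup [X.IsSeparated] (r : ℕ) (U : Fin (r + 1) → X.Opens)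
    (hU : ∀ i, IsAffineOpen (U i))
    (hloc : ∀ i, ∀ W : X.Opens, IsAffineOpen W → W ≤ U i → IsLocalizingOn M W) (p : ℕ)
    (hp : r ≤ p) (V : X.Opens) (hV : V = ⨆ i, U i) :
    Subsingleton (Ext (freeSheaf V) (abSheaf M) (p + 1)) := by
  induction r generalizing p V with
  | zero =>
    obtain rfl : V = U 0 := by
      rw [hV]
      exact le_antisymm (iSup_le fun i => (congrArg U (Fin.ext (by omega) : i = 0)).le) (le_iSup U 0)
    exact subsingleton_ext_of_isAffineOpen M (hU 0) (hloc 0) p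
  | succ r ih =>
    obtain ⟨p, rfl⟩ : ∃ q, p = q + 1 := ⟨p - 1, by omega⟩
    have hV' : V = U 0 ⊔ ⨆ i : Fin (r + 1), U i.succ := by
      rw [hV]
      refine le_antisymm (iSup_le fun i => ?_) (sup_le (le_iSup U 0)
        (iSup_le fun i => le_iSup U i.succ))
      refine Fin.cases le_sup_left (fun i => ?_) i
      exact (le_iSup (fun i : Fin (r + 1) => U i.succ) i).trans le_sup_right
    have h0 := subsingleton_ext_of_isAffineOpen M (hU 0) (hloc 0) (p + 1)
    have h1 := ih (fun i => U i.succ) (fun i => hU _) (fun i => hloc _) (p + 1) (by omega) _ rfl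
    -- By separatedness the sets `U 0 ⊓ U i.succ` are affine. The intersection in the Mayer–Vietoris
    -- sequence is thus covered by one affine set fewer, which matches the drop of one in the
    -- degree.
    have h2 := ih (fun i => U 0 ⊓ U i.succ) (fun i => (hU 0).inf (hU _))
      (fun i W hW hWU => hloc 0 W hW (hWU.trans inf_le_left)) p (by omega)
      (U 0 ⊓ ⨆ i : Fin (r + 1), U i.succ) (inf_iSup_eq _ _)
    refine subsingleton_of_forall_eq 0 fun c => ?_
    exact eq_zero_of_extRestrict_eq_zero_of_subsingleton (abSheaf M)
      (homOfLE (hV' ▸ le_sup_left)) (homOfLE (hV' ▸ le_sup_right)) hV' (p + 1) c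
      (Subsingleton.elim _ _) (Subsingleton.elim _ _) h2

/-- On a separated scheme covered by `r + 1` affine open subsets, the cohomology of quasi-coherent
sheaves vanishes in degrees `> r`. -/
theorem subsingleton_H_of_cover [X.IsSeparated] (r : ℕ) (U : Fin (r + 1) → X.Opens)
    (hU : ∀ i, IsAffineOpen (U i))
    (hloc : ∀ i, ∀ W : X.Opens, IsAffineOpen W → W ≤ U i → IsLocalizingOn M W)
    (hcover : ⨆ i, U i = ⊤) : Subsingleton (H (r + 1) M) :=
  subsingleton_H_of_subsingleton_ext.{u} (F := abSheaf M)
    (subsingleton_ext_iSup M r U hU hloc r le_rfl ⊤ hcover.symm)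

end Vanishing
end QuadricSheaf

namespace QuadricSheaf
open CategoryTheory Opposite TopologicalSpace Limits Abelian AlgebraicGeometry

/-! ### Short exact sequences of sheaves of modules and their cohomology -/

section Exact
variable {X : Scheme.{u}} {M₁ M₂ M₃ : X.Modules}

/-- Surjectivity of a morphism of sheaves, in terms of local sections. -/
def IsLocSurj (g : M₁ ⟶ M₂) : Prop :=
  ∀ (V : X.Opens) (s : M₂.presheaf.obj (op V)), ∀ x ∈ V, ∃ (W : X.Opens) (hW : W ≤ V),
    x ∈ W ∧ ∃ t : M₁.presheaf.obj (op W), g.app W t = res M₂ hW s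

/-- Short exact sequences of sheaves of modules, in terms of sections. -/
structure IsSES (f : M₁ ⟶ M₂) (g : M₂ ⟶ M₃) : Prop where
  injective : ∀ V, Function.Injective (f.app V)
  zero : f ≫ g = 0
  exact : ∀ (V : X.Opens) (s : M₂.presheaf.obj (op V)), g.app V s = 0 → ∃ t, f.app V t = s
  surjective : IsLocSurj g

/-- The morphism of abelian sheaves underlying a morphism of sheaves of modules. -/
noncomputable abbrev abSheafMap (f : M₁ ⟶ M₂) : abSheaf M₁ ⟶ abSheaf M₂ :=
  (SheafOfModules.toSheaf X.ringCatSheaf).map f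

lemma IsLocSurj.epi {g : M₁ ⟶ M₂} (hg : IsLocSurj g) : Epi (abSheafMap g) := by
  refine (TopCat.Sheaf.isLocallySurjective_iff_epi (abSheafMap g)).1 ?_
  rw [TopCat.Presheaf.isLocallySurjective_iff]
  intro V s x hx
  obtain ⟨W, hW, hxW, t, ht⟩ := hg V s x hx
  exact ⟨W, hW, ⟨t, ht⟩, hxW⟩

/-- Exactness in the middle is checked on stalks: a germ killed by g is represented by a section
that g kills on a smaller open set. -/
lemma IsSES.shortExact {f : M₁ ⟶ M₂} {g : M₂ ⟶ M₃} (h : IsSES f g) :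
    (ShortComplex.mk (abSheafMap f) (abSheafMap g)
      ((Functor.map_comp _ _ _).symm.trans ((congrArg _ h.zero).trans
        (Functor.map_zero _ _ _)))).ShortExact := by
  have hepi := h.surjective.epi
  have hmono : Mono (abSheafMap f) := by
    refine (sheafToPresheaf _ _).mono_of_mono_map ?_
    rw [NatTrans.mono_iff_mono_app]
    intro V
    rw [AddCommGrpCat.mono_iff_injective]
    exact h.injective V.unop
  refine { exact := ?_, mono_f := hmono, epi_g := hepi }
  refine (TopCat.Sheaf.exact_iff_stalkFunctor_map_exact (C := AddCommGrpCat.{u})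
    (X := X.toTopCat) _).2 ?_
  intro x
  rw [ShortComplex.ab_exact_iff]
  intro s hs
  obtain ⟨V, hxV, s, rfl⟩ := TopCat.Presheaf.exists_germ_eq (abSheaf M₂).obj s
  have h0 := (TopCat.Presheaf.stalkFunctor_map_germ_apply V x hxV (abSheafMap g).hom s).symm.trans
    hs
  obtain ⟨W, hxW, i, _, hW⟩ := TopCat.Presheaf.germ_eq (abSheaf M₃).obj x hxV hxV
    ((abSheafMap g).hom.app (op V) s) 0 (h0.trans (map_zero _).symm)
  rw [map_zero] at hW
  obtain ⟨t, ht⟩ := h.exact W (res M₂ i.le s) ((app_res g i.le s).trans hW)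
  refine ⟨TopCat.Presheaf.germ (abSheaf M₁).obj W x hxW t, ?_⟩
  refine (TopCat.Presheaf.stalkFunctor_map_germ_apply W x hxW (abSheafMap f).hom t).trans ?_
  refine (congrArg (TopCat.Presheaf.germ (abSheaf M₂).obj W x hxW) ht).trans ?_
  exact TopCat.Presheaf.germ_res_apply (abSheaf M₂).obj i x hxW s

namespace IsSES
variable {f : M₁ ⟶ M₂} {g : M₂ ⟶ M₃} (h : IsSES f g)
include h

lemma subsingleton_H₃ {i : ℕ} (h₂ : Subsingleton (H i M₂)) (h₁ : Subsingleton (H (i + 1) M₁)) :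
    Subsingleton (H i M₃) := by
  refine subsingleton_of_forall_eq 0 fun c => ?_
  obtain ⟨b, rfl⟩ := Ext.covariant_sequence_exact₃ _ h.shortExact c rfl (h₁.elim _ _)
  rw [h₂.elim b 0, Ext.zero_comp]

lemma subsingleton_H₂ {i : ℕ} (h₁ : Subsingleton (H i M₁)) (h₃ : Subsingleton (H i M₃)) :
    Subsingleton (H i M₂) := by
  refine subsingleton_of_forall_eq 0 fun c => ?_
  obtain ⟨b, rfl⟩ := Ext.covariant_sequence_exact₂ _ h.shortExact c (h₃.elim _ _)
  rw [h₁.elim b 0, Ext.zero_comp]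

lemma surjective_app_top (h₁ : Subsingleton (H 1 M₁)) : Function.Surjective (g.app ⊤) := by
  intro s
  let k := (constantSheafHomEquiv (abSheaf M₃)).symm s
  obtain ⟨b, hb⟩ := Ext.covariant_sequence_exact₃ _ h.shortExact (Ext.mk₀ k) (zero_add 1)
    (h₁.elim _ _)
  obtain ⟨l, rfl⟩ := (Ext.mk₀_bijective _ _).2 b
  rw [Ext.mk₀_comp_mk₀] at hb
  have hl := (Ext.mk₀_bijective _ _).1 hb
  refine ⟨constantSheafHomEquiv (abSheaf M₂) l, ?_⟩
  have := constantSheafHomEquiv_naturality l (abSheafMap g)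
  refine this.symm.trans ((congrArg _ hl).trans ?_)
  exact Equiv.apply_symm_apply _ _

end IsSES

/-- The identity of the cohomology of N is a sum of maps factoring through zero groups. This serves
for finite sums, direct summands and isomorphisms alike. -/
lemma subsingleton_H_of_sum_eq_id {κ : Type*} [Fintype κ] {N : X.Modules} {M : κ → X.Modules}
    (p : ∀ i, N ⟶ M i) (q : ∀ i, M i ⟶ N) (hpq : ∑ i, p i ≫ q i = 𝟙 N) {j : ℕ}
    (h : ∀ i, Subsingleton (H j (M i))) : Subsingleton (H j N) := by
  refine subsingleton_of_forall_eq 0 fun c => ?_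
  have h1 : ∑ i, abSheafMap (p i) ≫ abSheafMap (q i) = 𝟙 (abSheaf N) := by
    refine Eq.trans ?_ ((congrArg (SheafOfModules.toSheaf X.ringCatSheaf).map hpq).trans
      (CategoryTheory.Functor.map_id _ N))
    exact (map_sum (Functor.mapAddHom (SheafOfModules.toSheaf X.ringCatSheaf))
      (fun i => p i ≫ q i) Finset.univ).symm
  have h2 : Sheaf.H.map (∑ i, abSheafMap (p i) ≫ abSheafMap (q i)) j c = c := by
    rw [h1, Sheaf.H.map_id_apply]
  have h3 (s : Finset κ) :
      Sheaf.H.map (∑ i ∈ s, abSheafMap (p i) ≫ abSheafMap (q i)) j c = 0 := by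
    classical
    induction s using Finset.induction_on with
    | empty =>
      rw [Finset.sum_empty, Sheaf.H.map_apply, Ext.mk₀_zero, Ext.comp_zero]
    | insert i s hi ih =>
      rw [Finset.sum_insert hi, Sheaf.H.map_add_apply, ih, Sheaf.H.map_comp_apply,
        (h i).elim (Sheaf.H.map (abSheafMap (p i)) j c) 0, map_zero, add_zero]
  exact h2.symm.trans (h3 _)

lemma subsingleton_H_of_iso {M N : X.Modules} (e : M ≅ N) {j : ℕ} (h : Subsingleton (H j M)) :
    Subsingleton (H j N) :=
  subsingleton_H_of_sum_eq_id (κ := Unit) (fun _ => e.inv) (fun _ => e.hom) (by simp) fun _ => h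

end Exact

/-! ### Sections of kernels and of finite direct sums -/

section Kernel
variable {X : Scheme.{u}} {M N : X.Modules} (f : M ⟶ N)

/-- The functor of sections over an open set. -/
noncomputable def sectionsFunctor (V : X.Opens) : X.Modules ⥤ AddCommGrpCat.{u} :=
  Scheme.Modules.toPresheaf X ⋙ (evaluation _ _).obj (op V)

instance (V : X.Opens) : PreservesFiniteLimits (sectionsFunctor V) := by
  have : PreservesFiniteLimits (Scheme.Modules.toPresheaf X) :=
    PreservesLimits.preservesFiniteLimits _
  have : PreservesFiniteLimits ((evaluation X.Opensᵒᵖ AddCommGrpCat.{u}).obj (op V)) :=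
    ⟨fun _ _ _ => evaluation_preservesLimitsOfShape (op V)⟩
  exact comp_preservesFiniteLimits (Scheme.Modules.toPresheaf X) ((evaluation _ _).obj (op V))

instance (V : X.Opens) : (sectionsFunctor V).Additive := ⟨by intros; rfl⟩

lemma kernel_ι_app_injective (V : X.Opens) : Function.Injective ((kernel.ι f).app V) := by
  have : Mono ((sectionsFunctor V).map (kernel.ι f)) := inferInstance
  rw [AddCommGrpCat.mono_iff_injective] at this
  exact this

lemma exists_kernel_ι_app_eq (V : X.Opens) (s : M.presheaf.obj (op V)) (hs : f.app V s = 0) :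
    ∃ t, (kernel.ι f).app V t = s := by
  let S := ShortComplex.mk (kernel.ι f) f (kernel.condition f)
  have hS : S.Exact := ShortComplex.exact_of_f_is_kernel _ (kernelIsKernel f)
  have := (((Functor.preservesFiniteLimits_tfae (sectionsFunctor V)).out 1 3 rfl rfl).mpr inferInstance S
    ⟨hS, inferInstanceAs (Mono (kernel.ι f))⟩).1
  exact (ShortComplex.ab_exact_iff _).1 this s hs

lemma comp_app_apply {M₁ M₂ M₃ : X.Modules} (f : M₁ ⟶ M₂) (g : M₂ ⟶ M₃) (V : X.Opens)
    (s : M₁.presheaf.obj (op V)) : (f ≫ g).app V s = g.app V (f.app V s) := rfl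

lemma sum_app_apply {κ : Type*} (I : Finset κ) (g : κ → (M ⟶ N)) (V : X.Opens)
    (s : M.presheaf.obj (op V)) : (∑ i ∈ I, g i).app V s = ∑ i ∈ I, (g i).app V s := by
  classical
  induction I using Finset.induction_on with
  | empty => simp only [Finset.sum_empty]; rfl
  | insert i I hi ih => rw [Finset.sum_insert hi, Finset.sum_insert hi, ← ih]; rfl

lemma isSES_kernel (hf : IsLocSurj f) : IsSES (kernel.ι f) f where
  injective := kernel_ι_app_injective f
  zero := kernel.condition f
  exact := exists_kernel_ι_app_eq f
  surjective := hf

lemma kernel_ι_app_mem (V : X.Opens) (t : (kernel f).presheaf.obj (op V)) :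
    f.app V ((kernel.ι f).app V t) = 0 := by
  rw [← comp_app_apply, kernel.condition]
  rfl

lemma app_smul' (V : X.Opens) (r : X.presheaf.obj (op V)) (s : M.presheaf.obj (op V)) :
    f.app V (r • s) = r • f.app V s := Scheme.Modules.Hom.app_smul f r s

/-- After extending a section of the kernel to a section of M, its image in N vanishes on D(r). A
further power of r kills that image on V and brings the extension back into the kernel. -/
lemma IsLocalizingOn.kernel {V : X.Opens} (hM : IsLocalizingOn M V) (hN : IsLocalizingOn N V) :
    IsLocalizingOn (Limits.kernel f) V where
  exists_extension r s := by
    obtain ⟨n, t, ht⟩ := hM.exists_extension r ((kernel.ι f).app _ s)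
    obtain ⟨n', hn'⟩ := hN.exists_pow_smul_eq_zero r (f.app V t) (by
      rw [← app_res, ht, app_smul', kernel_ι_app_mem, smul_zero])
    obtain ⟨t', ht'⟩ := exists_kernel_ι_app_eq f V (r ^ n' • t) (by rw [app_smul', hn'])
    refine ⟨n' + n, t', kernel_ι_app_injective f _ ?_⟩
    rw [app_res, ht', res_smul, ht, app_smul', smul_smul, pow_add, map_pow]
  exists_pow_smul_eq_zero r t ht := by
    obtain ⟨n, hn⟩ := hM.exists_pow_smul_eq_zero r ((kernel.ι f).app _ t) (by
      rw [← app_res, ht, map_zero])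
    exact ⟨n, kernel_ι_app_injective f _ (by rw [app_smul', hn, map_zero])⟩

end Kernel

section Biproduct
attribute [local instance] Abelian.hasFiniteBiproducts
variable {X : Scheme.{u}} {κ : Type} [Fintype κ] (M : κ → X.Modules)

lemma biproduct_section_eq_sum (V : X.Opens) (s : (⨁ M).presheaf.obj (op V)) :
    s = ∑ i, (biproduct.ι M i).app V ((biproduct.π M i).app V s) := by
  have h := congrArg (fun g : (⨁ M) ⟶ ⨁ M => g.app V s) (biproduct.total (f := M))
  simp only [sum_app_apply] at h
  exact h.symm

variable {M} in
lemma biproduct_section_ext {V : X.Opens} {s t : (⨁ M).presheaf.obj (op V)}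
    (h : ∀ i, (biproduct.π M i).app V s = (biproduct.π M i).app V t) : s = t := by
  rw [biproduct_section_eq_sum M V s, biproduct_section_eq_sum M V t]
  simp only [h]

lemma exists_biproduct_section (V : X.Opens) (s : ∀ i, (M i).presheaf.obj (op V)) :
    ∃ t : (⨁ M).presheaf.obj (op V), ∀ i, (biproduct.π M i).app V t = s i := by
  classical
  refine ⟨∑ i, (biproduct.ι M i).app V (s i), fun j => ?_⟩
  rw [map_sum, Finset.sum_eq_single j]
  · rw [← comp_app_apply, biproduct.ι_π_self]
    rfl
  · intro i _ hij
    rw [← comp_app_apply, biproduct.ι_π_ne _ hij]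
    rfl
  · simp

variable {M} in
lemma IsLocalizingOn.biproduct {V : X.Opens} (h : ∀ i, IsLocalizingOn (M i) V) :
    IsLocalizingOn (⨁ M) V where
  exists_extension r s := by
    choose n t ht using fun i => (h i).exists_extension r ((biproduct.π M i).app _ s)
    obtain ⟨t', ht'⟩ := exists_biproduct_section M V
      fun i => r ^ (Finset.univ.sup n - n i) • t i
    refine ⟨Finset.univ.sup n, t', biproduct_section_ext fun i => ?_⟩
    rw [app_res, ht', res_smul, ht, app_smul', smul_smul, map_pow, ← pow_add,
      Nat.sub_add_cancel (Finset.le_sup (Finset.mem_univ i))]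
  exists_pow_smul_eq_zero r t ht := by
    choose n hn using fun i => (h i).exists_pow_smul_eq_zero r ((biproduct.π M i).app _ t) (by
      rw [← app_res, ht, map_zero])
    refine ⟨Finset.univ.sup n, biproduct_section_ext fun i => ?_⟩
    rw [app_smul', map_zero, ← Nat.sub_add_cancel (Finset.le_sup (f := n) (Finset.mem_univ i)),
      pow_add, mul_smul, hn, smul_zero]

lemma subsingleton_H_biproduct {j : ℕ} (h : ∀ i, Subsingleton (H j (M i))) :
    Subsingleton (H j (⨁ M)) :=
  subsingleton_H_of_sum_eq_id (biproduct.π M) (biproduct.ι M) biproduct.total h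

end Biproduct
end QuadricSheaf

namespace QuadricSheaf
open CategoryTheory Opposite TopologicalSpace Limits Abelian AlgebraicGeometry

/-! ### Castelnuovo–Mumford regularity for graded families -/

section GradedFamily
attribute [local instance] Abelian.hasFiniteBiproducts
variable {X : Scheme.{u}} {ι : Type}

lemma biproduct_desc_app_apply {κ : Type} [Fintype κ] {M : κ → X.Modules} {N : X.Modules}
    (f : ∀ i, M i ⟶ N) (V : X.Opens) (s : (⨁ M).presheaf.obj (op V)) :
    (biproduct.desc f).app V s = ∑ i, (f i).app V ((biproduct.π M i).app V s) := by
  conv_lhs => rw [biproduct_section_eq_sum M V s, map_sum]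
  refine Finset.sum_congr rfl fun i _ => ?_
  rw [← comp_app_apply, biproduct.ι_desc]

/-- A family of sheaves of modules indexed by `ℤ` with commuting maps of degree one, the `i`-th
of which is bijective over `U i`, such that sections over affine subsets of `U i` behave like
those of a quasi-coherent sheaf. -/
structure GradedFamily (U : ι → X.Opens) where
  /-- the sheaves of the family -/
  obj : ℤ → X.Modules
  /-- the maps of degree one -/
  mul : ι → ∀ d, obj d ⟶ obj (d + 1)
  mul_comm : ∀ i j d, mul i d ≫ mul j (d + 1) = mul j d ≫ mul i (d + 1)
  bijective : ∀ i d V, V ≤ U i → Function.Bijective ((mul i d).app V)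
  isLocalizingOn : ∀ i d W, IsAffineOpen W → W ≤ U i → IsLocalizingOn (obj d) W

namespace GradedFamily
variable {U : ι → X.Opens}

/-- Maps of degree zero which commute with multiplication. -/
def Commutes₀ {A B : GradedFamily U} (s : ∀ d, A.obj d ⟶ B.obj d) : Prop :=
  ∀ i d, A.mul i d ≫ s (d + 1) = s d ≫ B.mul i d

/-- Maps of degree one which commute with multiplication. -/
def Commutes₁ {A B : GradedFamily U} (δ : ∀ d, A.obj d ⟶ B.obj (d + 1)) : Prop :=
  ∀ i d, A.mul i d ≫ δ (d + 1) = δ d ≫ B.mul i (d + 1)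

/-- Direct sums of copies of a graded family. -/
noncomputable abbrev pow (A : GradedFamily U) (κ : Type) [Fintype κ] : GradedFamily U where
  obj d := ⨁ fun _ : κ => A.obj d
  mul i d := biproduct.map fun _ => A.mul i d
  mul_comm i j d := by
    refine biproduct.hom_ext _ _ fun l => ?_
    simp [A.mul_comm i j]
  bijective i d V hV := by
    have h (l : κ) (s) : (biproduct.π (fun _ : κ => A.obj (d + 1)) l).app V
        ((biproduct.map fun _ => A.mul i d).app V s) =
        (A.mul i d).app V ((biproduct.π (fun _ : κ => A.obj d) l).app V s) := by
      rw [← comp_app_apply, ← comp_app_apply, biproduct.map_π]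
    refine ⟨fun s t hst => biproduct_section_ext fun l => (A.bijective i d V hV).1 ?_, fun s => ?_⟩
    · rw [← h, ← h, hst]
    · choose t ht using fun l => (A.bijective i d V hV).2
        ((biproduct.π (fun _ : κ => A.obj (d + 1)) l).app V s)
      obtain ⟨t', ht'⟩ := exists_biproduct_section (fun _ : κ => A.obj d) V t
      exact ⟨t', biproduct_section_ext fun l => by rw [h, ht', ht]⟩
  isLocalizingOn i d W hW h := IsLocalizingOn.biproduct fun _ => A.isLocalizingOn i d W hW h

section Kernel
variable {A B : GradedFamily U} (δ : ∀ d, A.obj d ⟶ B.obj (d + 1)) (hδ : Commutes₁ δ)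

/-- The kernel of a map of degree one between graded families. -/
noncomputable abbrev ker : GradedFamily U where
  obj d := kernel (δ d)
  mul i d := kernel.map _ _ (A.mul i d) (B.mul i (d + 1)) (hδ i d).symm
  mul_comm i j d := by
    refine (cancel_mono (kernel.ι _)).1 ?_
    simp [A.mul_comm i j]
  bijective i d V hV := by
    have h (s) : (kernel.ι (δ (d + 1))).app V
        ((kernel.map _ _ (A.mul i d) (B.mul i (d + 1)) (hδ i d).symm).app V s) =
        (A.mul i d).app V ((kernel.ι (δ d)).app V s) := by
      rw [← comp_app_apply, ← comp_app_apply, kernel.lift_ι]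
    refine ⟨fun s t hst => kernel_ι_app_injective _ V ((A.bijective i d V hV).1 ?_), fun s => ?_⟩
    · rw [← h, ← h, hst]
    · obtain ⟨t, ht⟩ := (A.bijective i d V hV).2 ((kernel.ι (δ (d + 1))).app V s)
      have h0 : (δ d).app V t = 0 := by
        refine (B.bijective i (d + 1) V hV).1 ?_
        rw [map_zero, ← comp_app_apply, ← hδ, comp_app_apply, ht, kernel_ι_app_mem]
      obtain ⟨t, rfl⟩ := exists_kernel_ι_app_eq _ V t h0
      exact ⟨t, kernel_ι_app_injective _ V ((h t).trans ht)⟩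
  isLocalizingOn i d W hW h := (A.isLocalizingOn i d W hW h).kernel _ (B.isLocalizingOn i _ W hW h)

@[simp]
lemma ker_mul_ι (i : ι) (d : ℤ) : (ker δ hδ).mul i d ≫ kernel.ι (δ (d + 1)) =
    kernel.ι (δ d) ≫ A.mul i d :=
  kernel.lift_ι _ _ _

end Kernel

/-- A map of degree one between graded families lifting the multiplication maps of the target. -/
structure LinearCover (Z B : GradedFamily U) where
  /-- the map of degree one -/
  δ : ∀ d, B.obj d ⟶ Z.obj (d + 1)
  comm : Commutes₁ δ
  /-- the lifts of the multiplication maps -/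
  s : ι → ∀ d, Z.obj d ⟶ B.obj d
  s_comm : ∀ i, Commutes₀ (s i)
  s_δ : ∀ i d, s i d ≫ δ d = Z.mul i d

namespace LinearCover
/-- The direct sum of copies of a graded family covers it. -/
noncomputable def self [Fintype ι] (A : GradedFamily U) : LinearCover A (A.pow ι) where
  δ d := biproduct.desc fun i => A.mul i d
  comm i d := by
    refine biproduct.hom_ext' _ _ fun j => ?_
    simp [A.mul_comm i j]
  s i d := biproduct.ι (fun _ : ι => A.obj d) i
  s_comm i j d := by simp
  s_δ i d := by simp

variable {Z B : GradedFamily U} (C : LinearCover Z B)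

/-- Over `U i` the multiplication `Z.mul i` is bijective and factors through `C.δ`. -/
lemma isLocSurj (hU : ⨆ i, U i = ⊤) (d : ℤ) : IsLocSurj (C.δ d) := by
  intro V s x hx
  obtain ⟨i, hi⟩ := Opens.mem_iSup.1 (show x ∈ ⨆ i, U i from hU ▸ trivial)
  obtain ⟨t, ht⟩ := (Z.bijective i d (V ⊓ U i) inf_le_right).2 (res _ inf_le_left s)
  exact ⟨V ⊓ U i, inf_le_left, ⟨hx, hi⟩, (C.s i d).app _ t, by
    rw [← comp_app_apply, C.s_δ, ht]⟩

/-- The first syzygies of a cover. -/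
noncomputable abbrev syz : GradedFamily U := ker C.δ C.comm

/-- The cover of the first syzygies. -/
noncomputable def next [Fintype ι] : LinearCover C.syz (B.pow ι) where
  -- On the i-th summand b goes to x_i b - s_i(δ b), a syzygy because δ s_i = x_i. If b is already a
  -- syzygy the correction vanishes, so multiplication by x_i on syzygies lifts through the i-th
  -- inclusion, and the construction can be iterated.
  δ d := kernel.lift (C.δ (d + 1)) (biproduct.desc fun i => B.mul i d - C.δ d ≫ C.s i (d + 1)) (by
    refine biproduct.hom_ext' _ _ fun i => ?_
    simp [C.s_δ, C.comm i d])
  comm i d := by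
    refine (cancel_mono (kernel.ι _)).1 (biproduct.hom_ext' _ _ fun j => ?_)
    have h1 := C.comm i d
    have h2 := C.s_comm j i (d + 1)
    have h3 := B.mul_comm i j d
    simp only [syz, Category.assoc, kernel.lift_ι, biproduct.ι_map_assoc,
      biproduct.ι_desc, biproduct.ι_desc_assoc, kernel.lift_ι_assoc, Preadditive.comp_sub,
      Preadditive.sub_comp]
    rw [h3, ← h2, reassoc_of% h1]
  s i d := kernel.ι (C.δ d) ≫ biproduct.ι (fun _ : ι => B.obj d) i
  s_comm i j d := by
    rw [← Category.assoc, ker_mul_ι]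
    simp
  s_δ i d := by
    refine (cancel_mono (kernel.ι _)).1 ?_
    simp [Preadditive.comp_sub]

end LinearCover

variable {n : ℕ} [Fintype ι]

/-- Descending induction on j from the degree n + 1, where all cohomology vanishes. In 0 → syz(d) →
B(d) → Z(d+1) → 0 the group H^j(Z(d+1)) lies between H^j(B(d)) and H^{j+1}(syz(d)). The syzygies are
covered by copies of B, so the hypothesis on B is inherited. -/
lemma LinearCover.subsingleton_H (hU : ⨆ i, U i = ⊤)
    (hvan : ∀ (A : GradedFamily U) d, Subsingleton (H (n + 1) (A.obj d))) (m : ℤ) (k : ℕ) :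
    ∀ (j : ℕ) (_ : j + k = n + 1) {Z B : GradedFamily U} (_ : LinearCover Z B)
      (_ : ∀ i : ℕ, j ≤ i → i ≤ n → ∀ d : ℤ, d + i = m → Subsingleton (H i (B.obj d)))
      (d : ℤ), d + j = m + 1 → Subsingleton (H j (Z.obj d)) := by
  induction k with
  | zero =>
    rintro j rfl Z B C - d -
    exact hvan Z d
  | succ k ih =>
    intro j hj Z B C hB d hd
    obtain ⟨d, rfl⟩ : ∃ d', d = d' + 1 := ⟨d - 1, by ring⟩
    refine (isSES_kernel _ (C.isLocSurj hU d)).subsingleton_H₃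
      (hB j le_rfl (by omega) d (by omega)) ?_
    exact ih (j + 1) (by omega) C.next
      (fun i hi hin e he => subsingleton_H_biproduct _ fun _ => hB i (by omega) hin e he) d
      (by push_cast; omega)

variable (A : GradedFamily U) {m : ℤ}

/-- Castelnuovo–Mumford regularity is monotone. -/
lemma subsingleton_H_succ (hU : ⨆ i, U i = ⊤)
    (hvan : ∀ (A : GradedFamily U) d, Subsingleton (H (n + 1) (A.obj d)))
    (hA : ∀ i : ℕ, 1 ≤ i → i ≤ n → ∀ d : ℤ, d + i = m → Subsingleton (H i (A.obj d)))
    {i : ℕ} (hi : 1 ≤ i) (hin : i ≤ n) {d : ℤ} (hd : d + i = m + 1) :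
    Subsingleton (H i (A.obj d)) :=
  LinearCover.subsingleton_H hU hvan m (n + 1 - i) i (by omega) (LinearCover.self A)
    (fun j hj hjn e he => subsingleton_H_biproduct _ fun _ => hA j (by omega) hjn e he) d hd

/-- Castelnuovo–Mumford regularity implies generation by sections of lower degree. -/
lemma exists_eq_sum_mul (hU : ⨆ i, U i = ⊤)
    (hvan : ∀ (A : GradedFamily U) d, Subsingleton (H (n + 1) (A.obj d)))
    (hA : ∀ i : ℕ, 1 ≤ i → i ≤ n → ∀ d : ℤ, d + i = m → Subsingleton (H i (A.obj d)))
    (t : H0 (A.obj (m + 1))) :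
    ∃ g : ι → H0 (A.obj m), t = ∑ i, (A.mul i m).app ⊤ (g i) := by
  -- This is the vanishing of H^1, in degree m, of the kernel of the multiplication map from copies
  -- of A(m) to A(m+1). It makes that map surjective on global sections.
  have h := LinearCover.subsingleton_H hU hvan m n 1 (by omega) (LinearCover.self A).next
    (fun j hj hjn e he => subsingleton_H_biproduct _ fun _ => subsingleton_H_biproduct _ fun _ =>
      hA j (by omega) hjn e he) m rfl
  obtain ⟨g, rfl⟩ := (isSES_kernel _ ((LinearCover.self A).isLocSurj hU m)).surjective_app_top h t
  refine ⟨fun i => (biproduct.π (fun _ : ι => A.obj m) i).app ⊤ g, ?_⟩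
  exact biproduct_desc_app_apply (fun i => A.mul i m) ⊤ g

end GradedFamily

/-- Cohomology of a graded family vanishes in the degree given by the number of open sets. -/
lemma GradedFamily.subsingleton_H_of_affine [X.IsSeparated] {r : ℕ} {U : Fin (r + 1) → X.Opens}
    (hU : ∀ i, IsAffineOpen (U i)) (hcover : ⨆ i, U i = ⊤) (A : GradedFamily U) (d : ℤ) :
    Subsingleton (H (r + 1) (A.obj d)) :=
  subsingleton_H_of_cover _ r U hU (fun i W hW h => A.isLocalizingOn i d W hW h) hcover

end GradedFamily
end QuadricSheaf

namespace QuadricSheaf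
open CategoryTheory Opposite TopologicalSpace Limits Abelian AlgebraicGeometry MonoidalCategory
open scoped TensorProduct

/-! ### Tensor products of presheaves of modules and locally bijective maps -/

section Algebra
variable {R M N : Type*} [CommRing R] [AddCommGroup M] [Module R M] [AddCommGroup N] [Module R N]

/-- The equational criterion for the vanishing of an element of a tensor product. -/
lemma exists_eq_sum_of_sum_tmul_eq_zero (c : M →₀ N)
    (h : (c.sum fun m n => m ⊗ₜ[R] n) = 0) :
    ∃ (l : ℕ) (k : Fin l → M →₀ R) (y : Fin l → N),
      (∀ j, Finsupp.linearCombination R id (k j) = 0) ∧ ∀ m, c m = ∑ j, k j m • y j := by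
  classical
  let G : (M →₀ R) →ₗ[R] M := Finsupp.linearCombination R id
  have hG : Function.Surjective G := fun m => ⟨Finsupp.single m 1, by simp [G]⟩
  let e : (M →₀ R) ⊗[R] N := c.sum fun m n => Finsupp.single m 1 ⊗ₜ[R] n
  -- The element is lifted along the free module on the set M. By right exactness its lift comes
  -- from the module of relations tensored with N, and comparing coefficients gives the claim.
  have he : G.rTensor N e = 0 := by
    rw [← h]
    simp [e, Finsupp.sum, G]
  have hex : Function.Exact (LinearMap.ker G).subtype G := by
    rw [LinearMap.exact_iff, Submodule.range_subtype]
  have hex' := rTensor_exact (R := R) (M := LinearMap.ker G) (N := M →₀ R) (P := M)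
    (f := (LinearMap.ker G).subtype) (g := G) N hex hG
  obtain ⟨e', he'⟩ := (hex' e).1 he
  obtain ⟨l, k, y, rfl⟩ := TensorProduct.exists_sum_tmul_eq e'
  refine ⟨l, fun j => k j, y, fun j => (k j).2, fun m => ?_⟩
  have h1 : TensorProduct.finsuppScalarLeft R N M e m = c m := by
    simp only [e, Finsupp.sum, map_sum, Finsupp.coe_finsetSum, Finset.sum_apply,
      TensorProduct.finsuppScalarLeft_apply_tmul_apply, Finsupp.single_apply, ite_smul, one_smul,
      zero_smul]
    rw [Finset.sum_ite_eq' c.support m]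
    simp +contextual
  rw [← h1, ← he']
  simp [TensorProduct.finsuppScalarLeft_apply_tmul_apply]

end Algebra

variable {X : Scheme.{u}}

/-- Presheaves of modules on a scheme. -/
abbrev PMod (X : Scheme.{u}) := PresheafOfModules.{u} (X.presheaf ⋙ forget₂ CommRingCat RingCat)

/-- The presheaf of modules underlying a sheaf of modules. -/
abbrev toPMod (M : X.Modules) : PMod X := M.val

/-- The sheafification functor. -/
noncomputable def sheafifyMod (X : Scheme.{u}) : PMod X ⥤ X.Modules :=
  (PresheafOfModules.sheafification (𝟙 X.ringCatSheaf.obj) :)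

instance : (sheafifyMod X).IsLeftAdjoint :=
  (PresheafOfModules.sheafificationAdjunction (𝟙 X.ringCatSheaf.obj)).isLeftAdjoint

instance : (sheafifyMod X).Additive :=
  have := preservesBinaryBiproducts_of_preservesBinaryCoproducts (sheafifyMod X)
  Functor.additive_of_preservesBinaryBiproducts _

section Sections
variable {P Q : PMod X}

/-- The sections of a presheaf of modules. -/
abbrev sec (P : PMod X) (U : X.Opens) : Type u := P.obj (op U)

/-- Restriction of sections of a presheaf of modules. -/
noncomputable def pres (P : PMod X) {U V : X.Opens} (h : U ≤ V) : sec P V →+ sec P U :=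
  (P.presheaf.map (homOfLE h).op).hom

@[simp] lemma pres_pres {U V W : X.Opens} (h : U ≤ V) (h' : V ≤ W) (s : sec P W) :
    pres P h (pres P h' s) = pres P (h.trans h') s := by
  have := P.presheaf.map_comp (homOfLE h').op (homOfLE h).op
  exact (ConcreteCategory.congr_hom this s).symm

lemma pres_smul {U V : X.Opens} (h : U ≤ V) (r : X.presheaf.obj (op V)) (s : sec P V) :
    pres P h (r • s) = resO h r • pres P h s := P.map_smul (homOfLE h).op r s

/-- The pure tensors in a tensor product of presheaves of modules. -/
noncomputable abbrev tmul {U : X.Opens} (p : sec P U) (q : sec Q U) : sec (P ⊗ Q) U :=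
  p ⊗ₜ[X.presheaf.obj (op U)] q

lemma pres_tmul {U V : X.Opens} (h : U ≤ V) (p : sec P V) (q : sec Q V) :
    pres (P ⊗ Q) h (tmul p q) = tmul (pres P h p) (pres Q h q) := rfl

/-- The maps on sections given by a morphism of presheaves of modules. -/
noncomputable def sapp (f : P ⟶ Q) (U : X.Opens) : sec P U →ₗ[X.presheaf.obj (op U)] sec Q U :=
  (f.app (op U)).hom

lemma sapp_pres (f : P ⟶ Q) {U V : X.Opens} (h : U ≤ V) (p : sec P V) :
    sapp f U (pres P h p) = pres Q h (sapp f V p) :=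
  PresheafOfModules.naturality_apply f (homOfLE h).op p

lemma sapp_whiskerLeft_tmul (Z : PMod X) (f : P ⟶ Q) (U : X.Opens) (z : sec Z U) (p : sec P U) :
    sapp (Z ◁ f) U (tmul z p) = tmul z (sapp f U p) := rfl

lemma sapp_comp {P' : PMod X} (f : P ⟶ Q) (g : Q ⟶ P') (U : X.Opens) (t : sec P U) :
    sapp (f ≫ g) U t = sapp g U (sapp f U t) := rfl

lemma hom_ext_sapp {f g : P ⟶ Q} (h : ∀ U s, sapp f U s = sapp g U s) : f = g := by
  ext U s
  exact h U.unop s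

instance (Z : PMod X) : (tensorLeft Z).Additive where
  map_add {_ _ f g} := hom_ext_sapp fun U t =>
    LinearMap.congr_fun (LinearMap.lTensor_add (sec Z U) (sapp f U) (sapp g U)) t

end Sections

/-- A morphism of presheaves of modules is locally surjective over `U₀`. -/
def IsLocSurjOn {P Q : PMod X} (f : P ⟶ Q) (U₀ : X.Opens) : Prop :=
  ∀ V ≤ U₀, ∀ t : sec Q V, ∀ x ∈ V,
    ∃ (W : X.Opens) (h : W ≤ V), x ∈ W ∧ ∃ s, sapp f W s = pres Q h t

/-- A morphism of presheaves of modules is locally bijective over `U₀`. -/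
structure IsLocBij {P Q : PMod X} (f : P ⟶ Q) (U₀ : X.Opens) : Prop where
  inj : ∀ V ≤ U₀, ∀ s : sec P V, sapp f V s = 0 → ∀ x ∈ V,
    ∃ (W : X.Opens) (h : W ≤ V), x ∈ W ∧ pres P h s = 0
  surj : IsLocSurjOn f U₀

/-- Finitely many local conditions that are stable under restriction hold together near a point. -/
lemma exists_common_nhd {κ : Type*} (I : Finset κ) {V : X.Opens} {x : X} (hx : x ∈ V)
    (p : κ → ∀ W : X.Opens, W ≤ V → Prop)
    (hp : ∀ i W W' (h : W ≤ V) (h' : W' ≤ W), p i W h → p i W' (h'.trans h))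
    (H : ∀ i ∈ I, ∃ (W : X.Opens) (h : W ≤ V), x ∈ W ∧ p i W h) :
    ∃ (W : X.Opens) (h : W ≤ V), x ∈ W ∧ ∀ i ∈ I, p i W h := by
  classical
  induction I using Finset.induction_on with
  | empty => exact ⟨V, le_rfl, hx, by simp⟩
  | insert i I hi ih =>
    obtain ⟨W, h, hxW, hW⟩ := ih fun j hj => H j (Finset.mem_insert_of_mem hj)
    obtain ⟨W', h', hxW', hW'⟩ := H i (Finset.mem_insert_self _ _)
    refine ⟨W ⊓ W', inf_le_left.trans h, ⟨hxW, hxW'⟩, fun j hj => ?_⟩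
    rcases Finset.mem_insert.1 hj with rfl | hj
    · exact hp _ _ _ h' inf_le_right hW'
    · exact hp _ _ _ h inf_le_left (hW j hj)

lemma IsLocSurjOn.whiskerLeft {P Q : PMod X} {f : P ⟶ Q} {U₀ : X.Opens} (hf : IsLocSurjOn f U₀)
    (Z : PMod X) : IsLocSurjOn (Z ◁ f) U₀ := by
  intro V hV t x hx
  refine TensorProduct.induction_on (R := X.presheaf.obj (op V)) t ?_ ?_ ?_
  · exact ⟨V, le_rfl, hx, 0, (map_zero _).trans (map_zero _).symm⟩
  · intro z q
    obtain ⟨W, h, hxW, s, hs⟩ := hf V hV q x hx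
    refine ⟨W, h, hxW, tmul (pres Z h z) s, ?_⟩
    refine (sapp_whiskerLeft_tmul _ _ _ _ _).trans ?_
    rw [hs]
    rfl
  · rintro a b ⟨W, h, hxW, s, hs⟩ ⟨W', h', hxW', s', hs'⟩
    refine ⟨W ⊓ W', inf_le_left.trans h, ⟨hxW, hxW'⟩,
      pres (Z ⊗ P) inf_le_left s + pres (Z ⊗ P) inf_le_right s', ?_⟩
    rw [map_add, sapp_pres, sapp_pres, hs, hs']
    refine (congrArg₂ _ (pres_pres _ _ _) (pres_pres _ _ _)).trans ?_
    exact (map_add (pres (Z ⊗ Q) _) a b).symm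

namespace IsLocBij
variable {P Q : PMod X} {f : P ⟶ Q} {U₀ : X.Opens}

/-- Injectivity is argued on elements, without stalks: a vanishing tensor over Q is explained by
finitely many relations in Z and elements of Q. Locally these elements lift to P, so the same
relations explain the vanishing there. -/
lemma whiskerLeft (hf : IsLocBij f U₀) (Z : PMod X) : IsLocBij (Z ◁ f) U₀ where
  inj V hV t ht x hx := by
    classical
    obtain ⟨c, rfl⟩ := TensorProduct.exists_finsupp_left (R := X.presheaf.obj (op V)) t
    replace ht : (sapp f V).lTensor (sec Z V) _ = 0 := ht
    rw [Finsupp.sum, map_sum] at ht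
    simp only [LinearMap.lTensor_tmul] at ht
    obtain ⟨l, k, y, hk, hy⟩ := exists_eq_sum_of_sum_tmul_eq_zero
      (c.mapRange (sapp f V) (map_zero _)) (by
        rw [Finsupp.sum_mapRange_index (by simp)]
        exact ht)
    obtain ⟨W, hW, hxW, H⟩ := exists_common_nhd Finset.univ hx
      (fun (j : Fin l) W h => ∃ s, sapp f W s = pres Q h (y j))
      (fun j W W' h h' ⟨s, hs⟩ => ⟨pres P h' s, by rw [sapp_pres, hs, pres_pres]⟩)
      (fun j _ => hf.surj V hV (y j) x hx)
    choose y' hy' using fun j => H j (Finset.mem_univ j)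
    -- The set contains every element of Z occurring in the tensor or in a relation, so that all the
    -- finite sums below run over one index set.
    let I : Finset (sec Z V) := c.support ∪ Finset.univ.biUnion fun j => (k j).support
    obtain ⟨W', hW', hxW', H'⟩ := exists_common_nhd I hxW
      (fun z W' h => pres P h (pres P hW (c z)) = ∑ j, resO (h.trans hW) (k j z) • pres P h (y' j))
      (fun z W W' h h' hz => by
        have := congrArg (pres P h') hz
        simpa only [pres_pres, map_sum, pres_smul, resO_resO] using this)
      (fun z _ => by
        obtain ⟨W', h, hxW', h0⟩ := hf.inj W (hW.trans hV)
          (pres P hW (c z) - ∑ j, resO hW (k j z) • y' j) (by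
            have hz := hy z
            rw [Finsupp.mapRange_apply] at hz
            simp only [map_sub, map_sum, map_smul, sapp_pres, hz, hy', pres_smul, sub_self]) x hxW
        refine ⟨W', h, hxW', ?_⟩
        rw [map_sub, sub_eq_zero] at h0
        simpa only [map_sum, pres_smul, resO_resO] using h0)
    refine ⟨W', hW'.trans hW, hxW', ?_⟩
    have hcI : (c.sum fun m n => tmul m n : sec (Z ⊗ P) V) = ∑ z ∈ I, tmul z (c z) :=
      Finsupp.sum_of_support_subset _ Finset.subset_union_left _ fun z _ =>
        TensorProduct.tmul_zero _ _
    refine (congrArg _ hcI).trans ?_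
    rw [map_sum]
    calc ∑ z ∈ I, pres (Z ⊗ P) (hW'.trans hW) (tmul z (c z))
        = ∑ z ∈ I, ∑ j, tmul (resO (hW'.trans hW) (k j z) • pres Z (hW'.trans hW) z)
            (pres P hW' (y' j)) := by
          refine Finset.sum_congr rfl fun z hz => ?_
          have := H' z hz
          rw [pres_pres] at this
          rw [pres_tmul, this]
          refine (TensorProduct.tmul_sum _ _ _).trans (Finset.sum_congr rfl fun j _ => ?_)
          exact (TensorProduct.tmul_smul _ _ _).trans (TensorProduct.smul_tmul' _ _ _)
      _ = ∑ j, tmul (pres Z (hW'.trans hW) (∑ z ∈ I, k j z • z)) (pres P hW' (y' j)) := by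
          rw [Finset.sum_comm]
          refine Finset.sum_congr rfl fun j _ => ?_
          rw [map_sum]
          simp only [pres_smul]
          exact (TensorProduct.sum_tmul _ _ _).symm
      _ = 0 := by
          refine Finset.sum_eq_zero fun j _ => ?_
          have : ∑ z ∈ I, k j z • z = 0 := by
            rw [← hk j, Finsupp.linearCombination_apply]
            refine (Finsupp.sum_of_support_subset (k j) (s := I) ?_ (fun z r => r • z)
              fun z _ => zero_smul _ z).symm
            exact (Finset.subset_biUnion_of_mem (fun j => (k j).support) (Finset.mem_univ j)).trans
              Finset.subset_union_right
          rw [this, map_zero]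
          exact TensorProduct.zero_tmul _ _
  surj := hf.surj.whiskerLeft Z

lemma comp {P' : PMod X} {g : Q ⟶ P'} (hf : IsLocBij f U₀) (hg : IsLocBij g U₀) :
    IsLocBij (f ≫ g) U₀ where
  inj V hV s hs x hx := by
    obtain ⟨W, h, hxW, hW⟩ := hg.inj V hV _ hs x hx
    obtain ⟨W', h', hxW', hW'⟩ := hf.inj W (h.trans hV) (pres P h s)
      ((sapp_pres f h s).trans hW) x hxW
    exact ⟨W', h'.trans h, hxW', by rwa [pres_pres] at hW'⟩
  surj V hV t x hx := by
    obtain ⟨W, h, hxW, s, hs⟩ := hg.surj V hV t x hx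
    obtain ⟨W', h', hxW', s', hs'⟩ := hf.surj W (h.trans hV) s x hxW
    exact ⟨W', h'.trans h, hxW', s', by rw [sapp_comp, hs', sapp_pres, hs, pres_pres]⟩

lemma of_isIso [IsIso f] : IsLocBij f U₀ where
  inj V _ s hs x hx := ⟨V, le_rfl, hx, by
    have : sapp (f ≫ inv f) V s = 0 := by rw [sapp_comp, hs, map_zero]
    rw [IsIso.hom_inv_id] at this
    rw [show s = 0 from this, map_zero]⟩
  surj V _ t x hx := ⟨V, le_rfl, hx, sapp (inv f) V (pres Q le_rfl t), by
    rw [← sapp_comp, IsIso.inv_hom_id]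
    rfl⟩

lemma whiskerRight (hf : IsLocBij f U₀) (Z : PMod X) : IsLocBij (f ▷ Z) U₀ := by
  have : f ▷ Z = (β_ P Z).hom ≫ Z ◁ f ≫ (β_ Z Q).hom := by
    rw [← BraidedCategory.braiding_naturality_left_assoc, SymmetricCategory.symmetry,
      Category.comp_id]
  rw [this]
  exact of_isIso.comp ((hf.whiskerLeft Z).comp of_isIso)

end IsLocBij

section Sheafify

/-- The canonical map from a presheaf of modules to its sheafification. -/
noncomputable def toSh (P : PMod X) : P ⟶ toPMod ((sheafifyMod X).obj P) :=
  (PresheafOfModules.sheafificationAdjunction (𝟙 X.ringCatSheaf.obj)).unit.app P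

lemma toSh_naturality {P Q : PMod X} (f : P ⟶ Q) :
    toSh P ≫ ((sheafifyMod X).map f).val = f ≫ toSh Q :=
  ((PresheafOfModules.sheafificationAdjunction (𝟙 X.ringCatSheaf.obj)).unit.naturality f).symm

lemma isLocBij_toSh (P : PMod X) (U₀ : X.Opens) : IsLocBij (toSh P) U₀ where
  inj V _ s hs x hx := by
    obtain ⟨W, i, hW, hxW⟩ := Presheaf.equalizerSieve_mem (Opens.grothendieckTopology X)
      (CategoryTheory.toSheafify (Opens.grothendieckTopology X) P.presheaf) (X := op V) s 0
      ((show _ = _ from hs).trans (map_zero _).symm) x hx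
    exact ⟨W, i.le, hxW, (show pres P i.le s = pres P i.le 0 from hW).trans (map_zero _)⟩
  surj V _ t x hx := by
    obtain ⟨W, i, ⟨s, hs⟩, hxW⟩ := Presheaf.imageSieve_mem (Opens.grothendieckTopology X)
      (CategoryTheory.toSheafify (Opens.grothendieckTopology X) P.presheaf) (U := op V) t x hx
    exact ⟨W, i.le, hxW, s, hs⟩

/-- The sections of the sheafification given by sections of a presheaf of modules. -/
noncomputable def toShSec (P : PMod X) (U : X.Opens) :
    sec P U →+ ((sheafifyMod X).obj P).presheaf.obj (op U) :=
  (sapp (toSh P) U).toAddMonoidHom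

lemma map_toShSec {P Q : PMod X} (f : P ⟶ Q) {U : X.Opens} (s : sec P U) :
    ((sheafifyMod X).map f).app U (toShSec P U s) = toShSec Q U (sapp f U s) :=
  congrArg (fun g => sapp g U s) (toSh_naturality f)

lemma res_toShSec (P : PMod X) {U V : X.Opens} (h : U ≤ V) (s : sec P V) :
    res _ h (toShSec P V s) = toShSec P U (pres P h s) :=
  (sapp_pres (toSh P) h s).symm

lemma exists_pres_eq_zero {P : PMod X} {V : X.Opens} {s : sec P V} (hs : toShSec P V s = 0)
    {x : X} (hx : x ∈ V) : ∃ (W : X.Opens) (h : W ≤ V), x ∈ W ∧ pres P h s = 0 :=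
  (isLocBij_toSh P ⊤).inj V le_top s hs x hx

lemma exists_toShSec_eq {P : PMod X} {V : X.Opens}
    (t : ((sheafifyMod X).obj P).presheaf.obj (op V)) {x : X} (hx : x ∈ V) :
    ∃ (W : X.Opens) (h : W ≤ V), x ∈ W ∧ ∃ s, toShSec P W s = res _ h t :=
  (isLocBij_toSh P ⊤).surj V le_top t x hx

/-- After sheafification local preimages are unique on every open subset of `U₀`, so they agree on
overlaps and glue. -/
lemma IsLocBij.bijective_app {P Q : PMod X} {f : P ⟶ Q} {U₀ : X.Opens} (hf : IsLocBij f U₀)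
    {V : X.Opens} (hV : V ≤ U₀) : Function.Bijective (((sheafifyMod X).map f).app V) := by
  have hinj (W : X.Opens) (hW : W ≤ U₀) : Function.Injective (((sheafifyMod X).map f).app W) := by
    rw [injective_iff_map_eq_zero]
    intro t ht
    refine section_ext _ fun x hx => ?_
    obtain ⟨W₁, h₁, hx₁, s, hs⟩ := exists_toShSec_eq t hx
    obtain ⟨W₂, h₂, hx₂, h0⟩ := exists_pres_eq_zero (P := Q) (s := sapp f W₁ s) (by
      rw [← map_toShSec, hs, app_res, ht, map_zero]) hx₁
    obtain ⟨W₃, h₃, hx₃, h0'⟩ := hf.inj W₂ ((h₂.trans h₁).trans hW) (pres P h₂ s)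
      (by rw [sapp_pres, h0]) x hx₂
    refine ⟨W₃, (h₃.trans h₂).trans h₁, hx₃, ?_⟩
    rw [← res_res _ (h₃.trans h₂) h₁, ← hs, res_toShSec, ← pres_pres h₃ h₂, h0', map_zero, map_zero]
  refine ⟨hinj V hV, fun t => ?_⟩
  have H (x : V) : ∃ (W : X.Opens) (h : W ≤ V), x.1 ∈ W ∧ ∃ s, ((sheafifyMod X).map f).app W s =
      res _ h t := by
    obtain ⟨W₁, h₁, hx₁, s, hs⟩ := exists_toShSec_eq t x.2
    obtain ⟨W₂, h₂, hx₂, s', hs'⟩ := hf.surj W₁ (h₁.trans hV) s x.1 hx₁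
    refine ⟨W₂, h₂.trans h₁, hx₂, toShSec P W₂ s', ?_⟩
    rw [map_toShSec, hs', ← res_toShSec, hs, res_res]
  choose W h hxW s hs using H
  obtain ⟨t', ht'⟩ := exists_glue _ W h (fun x hx => ⟨⟨x, hx⟩, hxW _⟩) s fun i j => by
    apply hinj _ (inf_le_left.trans ((h i).trans hV))
    rw [app_res, app_res, hs, hs, res_res, res_res]
  refine ⟨t', section_ext _ fun x hx => ⟨W ⟨x, hx⟩, h _, hxW _, ?_⟩⟩
  rw [← app_res, ht', hs]

lemma isIso_of_bijective {M N : X.Modules} (f : M ⟶ N) (h : ∀ V, Function.Bijective (f.app V)) :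
    IsIso f := by
  rw [Scheme.Modules.Hom.isIso_iff_isIso_app]
  intro V
  exact (ConcreteCategory.isIso_iff_bijective _).2 (h V)

lemma IsLocBij.isIso {P Q : PMod X} {f : P ⟶ Q} (hf : IsLocBij f ⊤) :
    IsIso ((sheafifyMod X).map f) :=
  isIso_of_bijective _ fun _ => hf.bijective_app le_top

end Sheafify
end QuadricSheaf

namespace QuadricSheaf
open CategoryTheory Opposite TopologicalSpace Limits Abelian AlgebraicGeometry MonoidalCategory
open scoped TensorProduct

/-! ### Tensor products of sheaves of modules -/

section SheafTensor
variable {X : Scheme.{u}}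

lemma exact_map_cokernel {𝒜 : Type*} [Category* 𝒜] [Abelian 𝒜] {R : Type*} [Ring R]
    (E : 𝒜 ⥤ ModuleCat R) [E.Additive] [PreservesFiniteColimits E] {P Q : 𝒜} (f : P ⟶ Q)
    (s : E.obj Q) (hs : E.map (cokernel.π f) s = 0) : ∃ t, E.map f t = s := by
  let S := ShortComplex.mk f (cokernel.π f) (cokernel.condition f)
  have hS : S.Exact := ShortComplex.exact_of_g_is_cokernel _ (cokernelIsCokernel f)
  have := (((Functor.preservesFiniteColimits_tfae E).out 1 3 rfl rfl).mpr inferInstance S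
    ⟨hS, inferInstanceAs (Epi (cokernel.π f))⟩).1
  exact (ShortComplex.moduleCat_exact_iff _).1 this s hs

lemma exists_sapp_eq_of_cokernel {P Q : PMod X} (f : P ⟶ Q) {V : X.Opens} (s : sec Q V)
    (hs : sapp (cokernel.π f) V s = 0) : ∃ t, sapp f V t = s := by
  let E : PMod X ⥤ _ := PresheafOfModules.evaluation (X.presheaf ⋙ forget₂ CommRingCat RingCat) (op V)
  have : PreservesFiniteColimits E := PreservesColimits.preservesFiniteColimits _
  exact exact_map_cokernel E f s hs

/-- The map from N to the sheafification of the presheaf cokernel is zero, because it vanishes after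
composition with the epimorphism f. Hence each section of N dies locally in the presheaf cokernel,
which means that it is locally in the image. -/
lemma isLocSurj_of_epi {M N : X.Modules} (f : M ⟶ N) [Epi f] : IsLocSurj f := by
  let C := cokernel (C := PMod X) f.val
  let g : N ⟶ (sheafifyMod X).obj C := ⟨cokernel.π (C := PMod X) f.val ≫ toSh C⟩
  have hg : f ≫ g = 0 := by
    refine SheafOfModules.Hom.ext ?_
    refine (Category.assoc _ _ _).symm.trans ((congrArg (· ≫ toSh C)
      (cokernel.condition (C := PMod X) f.val)).trans zero_comp)
  have hg0 : g = 0 := (cancel_epi f).1 (hg.trans comp_zero.symm)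
  intro V s x hx
  have h0 : toShSec C V (sapp (cokernel.π (C := PMod X) f.val) V s) = 0 :=
    congrArg (fun h : N ⟶ _ => h.app V s) hg0
  obtain ⟨W, h, hxW, hW⟩ := exists_pres_eq_zero h0 hx
  exact ⟨W, h, hxW, exists_sapp_eq_of_cokernel (P := toPMod M) (Q := toPMod N) f.val _
    ((sapp_pres (P := toPMod N) (Q := C) _ h s).trans hW)⟩

lemma IsLocSurj.isLocSurjOn {M N : X.Modules} {f : M ⟶ N} (hf : IsLocSurj f) :
    IsLocSurjOn (P := toPMod M) (Q := toPMod N) f.val ⊤ := fun V _ s x hx => hf V s x hx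

lemma IsLocSurjOn.isLocSurj {P Q : PMod X} {f : P ⟶ Q} (hf : IsLocSurjOn f ⊤) :
    IsLocSurj ((sheafifyMod X).map f) := by
  intro V t x hx
  obtain ⟨W₁, h₁, hx₁, s, hs⟩ := exists_toShSec_eq t hx
  obtain ⟨W₂, h₂, hx₂, s', hs'⟩ := hf W₁ le_top s x hx₁
  exact ⟨W₂, h₂.trans h₁, hx₂, toShSec P W₂ s', by
    rw [map_toShSec, hs', ← res_toShSec, hs, res_res]⟩

lemma IsLocSurjOn.whiskerRight {P Q : PMod X} {f : P ⟶ Q} {U₀ : X.Opens} (hf : IsLocSurjOn f U₀)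
    (Z : PMod X) : IsLocSurjOn (f ▷ Z) U₀ := by
  intro V hV t x hx
  obtain ⟨W, h, hxW, s, hs⟩ := hf.whiskerLeft Z V hV (sapp (β_ Q Z).hom V t) x hx
  refine ⟨W, h, hxW, sapp (β_ Z P).hom W s, ?_⟩
  have h1 : (β_ Z P).hom ≫ f ▷ Z = Z ◁ f ≫ (β_ Z Q).hom :=
    (BraidedCategory.braiding_naturality_right _ _).symm
  rw [← sapp_comp, h1, sapp_comp, hs, sapp_pres, ← sapp_comp, SymmetricCategory.symmetry]
  rfl

/-- The forgetful functor from sheaves of modules to presheaves of modules. -/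
noncomputable def forgetMod (X : Scheme.{u}) : X.Modules ⥤ PMod X where
  obj M := toPMod M
  map f := f.val

instance : (forgetMod X).Additive where

instance (Z : PMod X) : (tensorRight Z).Additive where
  map_add {_ _ f g} := hom_ext_sapp fun U t =>
    LinearMap.congr_fun (LinearMap.rTensor_add (sec Z U) (sapp f U) (sapp g U)) t

/-- The functor `F ⊗ -` on sheaves of modules. -/
noncomputable def tensorLeftMod (F : X.Modules) : X.Modules ⥤ X.Modules :=
  forgetMod X ⋙ tensorLeft (toPMod F) ⋙ sheafifyMod X

/-- The functor `- ⊗ G` on sheaves of modules. -/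
noncomputable def tensorRightMod (G : X.Modules) : X.Modules ⥤ X.Modules :=
  forgetMod X ⋙ tensorRight (toPMod G) ⋙ sheafifyMod X

instance (F : X.Modules) : (tensorLeftMod F).Additive :=
  inferInstanceAs (_ ⋙ _ ⋙ _).Additive

instance (F : X.Modules) : (tensorRightMod F).Additive :=
  inferInstanceAs (_ ⋙ _ ⋙ _).Additive

lemma IsLocSurj.tensorLeftMod_map {M N : X.Modules} {f : M ⟶ N} (hf : IsLocSurj f)
    (F : X.Modules) : IsLocSurj ((tensorLeftMod F).map f) :=
  (hf.isLocSurjOn.whiskerLeft (toPMod F)).isLocSurj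

lemma IsLocSurj.tensorRightMod_map {M N : X.Modules} {f : M ⟶ N} (hf : IsLocSurj f)
    (F : X.Modules) : IsLocSurj ((tensorRightMod F).map f) :=
  (hf.isLocSurjOn.whiskerRight (toPMod F)).isLocSurj

lemma bijective_tensorMap {M N : X.Modules} {f : M ⟶ N} {U₀ : X.Opens}
    (hf : IsLocBij (P := toPMod M) (Q := toPMod N) f.val U₀) (F : X.Modules) {V : X.Opens}
    (hV : V ≤ U₀) : Function.Bijective ((tensorMap F f).app V) :=
  (hf.whiskerLeft (toPMod F)).bijective_app hV

lemma tensorMap_comp (F : X.Modules) {M N K : X.Modules} (f : M ⟶ N) (g : N ⟶ K) :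
    tensorMap F (f ≫ g) = tensorMap F f ≫ tensorMap F g :=
  (tensorLeftMod F).map_comp f g

lemma tensorMap_add (F : X.Modules) {M N : X.Modules} (f g : M ⟶ N) :
    tensorMap F (f + g) = tensorMap F f + tensorMap F g :=
  (tensorLeftMod F).map_add

lemma tensorMap_zero (F M N : X.Modules) : tensorMap F (0 : M ⟶ N) = 0 :=
  (tensorLeftMod F).map_zero M N

section SheafifyTensor
variable (P Q : PMod X)

/-- The tensor product of the units of sheafification. -/
noncomputable def sheafifyTensor : (sheafifyMod X).obj (P ⊗ Q) ⟶
    tensor ((sheafifyMod X).obj P) ((sheafifyMod X).obj Q) :=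
  (sheafifyMod X).map (toSh P ⊗ₘ toSh Q)

/-- Both units of sheafification are locally bijective, and tensoring preserves this. Iterated
tensor products of sheaves can therefore be computed with presheaves and sheafified once at the end.
-/
instance : IsIso (sheafifyTensor P Q) := by
  have h : IsLocBij (toSh P ⊗ₘ toSh Q) ⊤ := by
    rw [MonoidalCategory.tensorHom_def]
    exact ((isLocBij_toSh P ⊤).whiskerRight Q).comp ((isLocBij_toSh Q ⊤).whiskerLeft _)
  exact h.isIso

variable {Q} in
lemma sheafifyTensor_naturality {Q' : PMod X} (f : Q ⟶ Q') :
    sheafifyTensor P Q ≫ tensorMap _ ((sheafifyMod X).map f) =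
      (sheafifyMod X).map (P ◁ f) ≫ sheafifyTensor P Q' := by
  refine ((sheafifyMod X).map_comp _ _).symm.trans (Eq.trans ?_ ((sheafifyMod X).map_comp _ _))
  congr 1
  have h1 := MonoidalCategory.tensorHom_comp_tensorHom (toSh P) (toSh Q)
    (𝟙 (toPMod ((sheafifyMod X).obj P))) ((sheafifyMod X).map f).val
  have h2 := MonoidalCategory.tensorHom_comp_tensorHom (𝟙 P) f (toSh P) (toSh Q')
  refine (congrArg ((toSh P ⊗ₘ toSh Q) ≫ ·) (MonoidalCategory.id_tensorHom _ _).symm).trans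
    (h1.trans (Eq.trans ?_ (h2.symm.trans (congrArg (· ≫ (toSh P ⊗ₘ toSh Q'))
      (MonoidalCategory.id_tensorHom _ _)))))
  rw [toSh_naturality, Category.comp_id, Category.id_comp]

end SheafifyTensor

/-- The isomorphism between a sheaf of modules and its sheafification. -/
noncomputable def sheafifyModIso (M : X.Modules) : (sheafifyMod X).obj (toPMod M) ≅ M :=
  (asIso (PresheafOfModules.sheafificationAdjunction (𝟙 X.ringCatSheaf.obj)).counit).app M

lemma IsLocalizingOn.of_bijective {M N : X.Modules} (f : M ⟶ N) {W : X.Opens}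
    (hf : ∀ V ≤ W, Function.Bijective (f.app V)) (hN : IsLocalizingOn N W) :
    IsLocalizingOn M W where
  exists_extension r s := by
    obtain ⟨n, t, ht⟩ := hN.exists_extension r (f.app _ s)
    obtain ⟨t, rfl⟩ := (hf W le_rfl).2 t
    refine ⟨n, t, (hf _ (X.basicOpen_le r)).1 ?_⟩
    rw [app_res, ht, app_smul']
  exists_pow_smul_eq_zero r t ht := by
    obtain ⟨n, hn⟩ := hN.exists_pow_smul_eq_zero r (f.app _ t) (by rw [← app_res, ht, map_zero])
    exact ⟨n, (hf W le_rfl).1 (by rw [app_smul', hn, map_zero])⟩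

lemma IsLocalizingOn.of_bijective' {M N : X.Modules} (f : M ⟶ N) {W : X.Opens}
    (hf : ∀ V ≤ W, Function.Bijective (f.app V)) (hM : IsLocalizingOn M W) :
    IsLocalizingOn N W where
  exists_extension r s := by
    obtain ⟨s, rfl⟩ := (hf _ (X.basicOpen_le r)).2 s
    obtain ⟨n, t, ht⟩ := hM.exists_extension r s
    exact ⟨n, f.app W t, by rw [← app_res, ht, app_smul']⟩
  exists_pow_smul_eq_zero r t ht := by
    obtain ⟨t, rfl⟩ := (hf W le_rfl).2 t
    obtain ⟨n, hn⟩ := hM.exists_pow_smul_eq_zero r t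
      ((hf _ (X.basicOpen_le r)).1 (by rw [app_res, ht, map_zero]))
    exact ⟨n, by rw [← app_smul', hn, map_zero]⟩

lemma bijective_app_of_isIso {M N : X.Modules} (f : M ⟶ N) [IsIso f] (V : X.Opens) :
    Function.Bijective (f.app V) :=
  (ConcreteCategory.isIso_iff_bijective _).1 (Scheme.Modules.Hom.isIso_iff_isIso_app.1 ‹_› V)

end SheafTensor
end QuadricSheaf

namespace QuadricSheaf
open CategoryTheory Opposite TopologicalSpace Limits Abelian AlgebraicGeometry

/-! ### Quasi-coherent sheaves on affine open sets -/

section Quasicoherent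
variable {X : Scheme.{u}}

/-- The identification of W with a spectrum transports the action of functions on W to the action by
restricted functions; this compares the scalar multiplications on the two sides. -/
lemma appIso_fromSpec_inv_apply {W : X.Opens} (hW : IsAffineOpen W)
    (U : (Spec Γ(X, W)).Opens) (h : hW.fromSpec ''ᵁ U ≤ W) (r : Γ(X, W)) :
    (hW.fromSpec.appIso U).inv ((Spec Γ(X, W)).presheaf.map U.leTop.op
      ((Scheme.ΓSpecIso Γ(X, W)).inv r)) = resO h r := by
  have h1 : X.presheaf.map (homOfLE h).op ≫ (hW.fromSpec.appIso U).hom =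
      (Scheme.ΓSpecIso Γ(X, W)).inv ≫ (Spec Γ(X, W)).presheaf.map U.leTop.op := by
    rw [Scheme.Hom.appIso_hom, Scheme.Hom.naturality_assoc, hW.fromSpec_app_self, Category.assoc,
      ← Functor.map_comp, ← Functor.map_comp]
    rfl
  have h2 : X.presheaf.map (homOfLE h).op = (Scheme.ΓSpecIso Γ(X, W)).inv ≫
      (Spec Γ(X, W)).presheaf.map U.leTop.op ≫ (hW.fromSpec.appIso U).inv := by
    rw [← Category.assoc, ← h1, Category.assoc, Iso.hom_inv_id, Category.comp_id]
  exact (ConcreteCategory.congr_hom h2 r).symm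

/-- Quasi-coherent sheaves are localizing on affine open sets. -/
lemma isLocalizingOn_of_isQuasicoherent (M : X.Modules) [M.IsQuasicoherent]
    {W : X.Opens} (hW : IsAffineOpen W) : IsLocalizingOn M W := by
  let M' := M.restrict hW.fromSpec
  have : M'.IsQuasicoherent := Scheme.Modules.isQuasicoherent_restrictFunctor _ M
  have hloc := (isIso_fromTildeΓ_iff_isLocalizing M').1
    (Scheme.Modules.isIso_fromTildeΓ_of_isQuasicoherent M')
  have htop : hW.fromSpec ''ᵁ ⊤ = W := by simp
  have hD (r : Γ(X, W)) : hW.fromSpec ''ᵁ (PrimeSpectrum.basicOpen r) = X.basicOpen r :=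
    hW.fromSpec_image_basicOpen r
  have hsmul (U : (Spec Γ(X, W)).Opens) (h : hW.fromSpec ''ᵁ U ≤ W) (r : Γ(X, W))
      (x : M.presheaf.obj (op (hW.fromSpec ''ᵁ U))) :
      (show M.presheaf.obj (op (hW.fromSpec ''ᵁ U)) from r • (show Γ(M', U) from x)) =
        resO h r • x :=
    congrArg (fun a : Γ(X, hW.fromSpec ''ᵁ U) => a • x) (appIso_fromSpec_inv_apply hW U h r)
  constructor
  · intro r s
    obtain ⟨⟨t, _, N, rfl⟩, ht⟩ := (hloc r).surj (res M (hD r).le s)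
    obtain ⟨t, ht'⟩ : ∃ t : M.presheaf.obj (op (hW.fromSpec ''ᵁ ⊤)),
        resO ((hD r).le.trans (X.basicOpen_le r)) (r ^ N) • res M (hD r).le s =
          res M (Scheme.Hom.image_mono _ le_top) t := ⟨t, (hsmul _ _ _ _).symm.trans ht⟩
    refine ⟨N, res M htop.ge t, ?_⟩
    have h1 := congrArg (res M (hD r).ge) ht'
    rw [res_smul, res_res, res_res, res_self, resO_resO, map_pow] at h1
    rw [res_res, ← h1]
  · intro r t ht
    obtain ⟨⟨_, N, rfl⟩, hc⟩ := (hloc r).exists_of_eq (x₁ := res M htop.le t) (x₂ := 0) (by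
      refine Eq.trans ?_ (map_zero _).symm
      have := congrArg (res M (hD r).le) ht
      rw [res_res, map_zero] at this
      exact (res_res M (Scheme.Hom.image_mono _ le_top) htop.le t).trans this)
    have hc' : resO htop.le (r ^ N) • res M htop.le t = 0 :=
      (hsmul _ _ _ _).symm.trans (hc.trans (smul_zero _))
    refine ⟨N, ?_⟩
    have h1 := congrArg (res M htop.ge) hc'
    rwa [← res_smul, res_res, res_self, map_zero] at h1

end Quasicoherent
end QuadricSheaf

namespace QuadricSheaf
open CategoryTheory Opposite TopologicalSpace Limits Abelian AlgebraicGeometry MonoidalCategory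
open scoped TensorProduct

/-! ### The twisting sheaves: values, units and multiplication -/

noncomputable section TwistAlgebra
variable {A : Type u} [CommRing A] {σ : Type*} [SetLike σ A] [AddSubgroupClass σ A]
variable {𝒜 : ℕ → σ} [GradedRing 𝒜]

/-- The map from `A` to its localization at `x`. -/
def ev (x : ProjectiveSpectrum.top 𝒜) : A →+* LocAt 𝒜 x :=
  algebraMap A (Localization.AtPrime (idealAt 𝒜 x))

lemma frac_one {x : ProjectiveSpectrum.top 𝒜} (a : A) (h : (1 : A) ∉ idealAt 𝒜 x) :
    frac a 1 h = ev x a :=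
  Localization.mk_one_eq_algebraMap a

lemma isUnit_ev {x : ProjectiveSpectrum.top 𝒜} {b : A} (hb : b ∉ idealAt 𝒜 x) :
    IsUnit (ev x b) :=
  IsLocalization.map_units (Localization.AtPrime (idealAt 𝒜 x))
    (⟨b, hb⟩ : (idealAt 𝒜 x).primeCompl)

lemma frac_mul_ev {x : ProjectiveSpectrum.top 𝒜} (a : A) {b : A} (hb : b ∉ idealAt 𝒜 x) :
    frac a b hb * ev x b = ev x a := by
  have h := IsLocalization.mk'_spec (Localization.AtPrime (idealAt 𝒜 x)) a
    (⟨b, hb⟩ : (idealAt 𝒜 x).primeCompl)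
  rw [← Localization.mk_eq_mk'] at h
  exact h

lemma eq_frac_iff {x : ProjectiveSpectrum.top 𝒜} {y : LocAt 𝒜 x} {a b : A}
    (hb : b ∉ idealAt 𝒜 x) : y = frac a b hb ↔ y * ev x b = ev x a := by
  constructor
  · rintro rfl
    exact frac_mul_ev a hb
  · intro h
    exact (isUnit_ev hb).mul_right_cancel (h.trans (frac_mul_ev a hb).symm)

/-- A homogeneous element is a unit at the points where it does not vanish. -/
def unitAt {x : ProjectiveSpectrum.top 𝒜} {a : A} (ha : a ∉ idealAt 𝒜 x) : (LocAt 𝒜 x)ˣ :=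
  (isUnit_ev ha).unit

lemma coe_unitAt {x : ProjectiveSpectrum.top 𝒜} {a : A} (ha : a ∉ idealAt 𝒜 x) :
    (unitAt ha : LocAt 𝒜 x) = ev x a := rfl

lemma zpow_unitAt_eq_frac {x : ProjectiveSpectrum.top 𝒜} {a : A} (ha : a ∉ idealAt 𝒜 x) (d : ℤ)
    (h : a ^ (-d).toNat ∉ idealAt 𝒜 x) :
    ((unitAt ha ^ d : (LocAt 𝒜 x)ˣ) : LocAt 𝒜 x) = frac (a ^ d.toNat) (a ^ (-d).toNat) h := by
  rw [eq_frac_iff, map_pow, map_pow, ← coe_unitAt ha, ← Units.val_pow_eq_pow_val,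
    ← Units.val_pow_eq_pow_val, ← Units.val_mul, ← zpow_natCast, ← zpow_natCast, ← zpow_add]
  congr 2
  omega

lemma notMem_idealAt {a : A} {U : Opens (ProjectiveSpectrum.top 𝒜)}
    (hU : U ≤ ProjectiveSpectrum.basicOpen 𝒜 a) (x : U) : a ∉ idealAt 𝒜 x.1 := hU x.2

/-- The integral powers of an element of degree one, on an open set where it does not vanish. -/
def zpowSection {a : A} (ha : a ∈ 𝒜 1) (d : ℤ) (U : Opens (ProjectiveSpectrum.top 𝒜))
    (hU : U ≤ ProjectiveSpectrum.basicOpen 𝒜 a) : twistSections 𝒜 d U :=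
  ⟨fun x => ((unitAt (notMem_idealAt hU x) ^ d : (LocAt 𝒜 x.1)ˣ) : LocAt 𝒜 x.1), fun x =>
    ⟨U, x.2, 𝟙 _, d.toNat, (-d).toNat, a ^ d.toNat, a ^ (-d).toNat,
      by simpa using SetLike.pow_mem_graded d.toNat ha,
      by simpa using SetLike.pow_mem_graded (-d).toNat ha, by omega, fun y =>
      ⟨fun h => notMem_idealAt hU y (Ideal.IsPrime.mem_of_pow_mem inferInstance _ h),
        zpow_unitAt_eq_frac _ _ _⟩⟩⟩

/-- The inverse of a homogeneous element, on an open set where it does not vanish. -/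
def invSection {e : ℕ} {a : A} (ha : a ∈ 𝒜 e) (U : Opens (ProjectiveSpectrum.top 𝒜))
    (hU : U ≤ ProjectiveSpectrum.basicOpen 𝒜 a) : twistSections 𝒜 (-e) U :=
  ⟨fun x => ((unitAt (notMem_idealAt hU x))⁻¹ : (LocAt 𝒜 x.1)ˣ), fun x =>
    ⟨U, x.2, 𝟙 _, 0, e, 1, a, SetLike.GradedOne.one_mem, ha, by simp, fun y =>
      ⟨notMem_idealAt hU y, (eq_frac_iff _).2
        ((Units.inv_mul (unitAt (notMem_idealAt hU y))).trans (map_one (ev y.1)).symm)⟩⟩⟩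

lemma exists_value_eq {U : Opens (ProjectiveSpectrum.top 𝒜)} (s : twistSections 𝒜 0 U) :
    ∃ r : (ProjectiveSpectrum.Proj.structureSheaf 𝒜).1.obj (op U), ∀ x, value 𝒜 x r = s.1 x := by
  have h (x : U) : ∃ y : HomogeneousLocalization.AtPrime 𝒜 (idealAt 𝒜 x.1),
      (y.val : LocAt 𝒜 x.1) = s.1 x := by
    obtain ⟨V, hV, iV, i, j, a, b, ha, hb, hij, w⟩ := s.2 x
    obtain rfl : i = j := by omega
    obtain ⟨hb', e⟩ := w ⟨x.1, hV⟩
    exact ⟨HomogeneousLocalization.mk ⟨i, ⟨a, ha⟩, ⟨b, hb⟩, hb'⟩,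
      (HomogeneousLocalization.val_mk _).trans e.symm⟩
  choose f hf using h
  refine ⟨⟨f, fun x => ?_⟩, fun x => hf x⟩
  obtain ⟨V, hV, iV, i, j, a, b, ha, hb, hij, w⟩ := s.2 x
  obtain rfl : i = j := by omega
  refine ⟨V, hV, iV, i, ⟨a, ha⟩, ⟨b, hb⟩, fun y => (w y).1, fun y => ?_⟩
  refine HomogeneousLocalization.val_injective _ ?_
  refine (hf _).trans ((w y).2.trans ?_)
  exact (HomogeneousLocalization.val_mk (𝒜 := 𝒜) (x := (idealAt 𝒜 y.1).primeCompl)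
    ⟨i, ⟨a, ha⟩, ⟨b, hb⟩, (w y).1⟩).symm

lemma value_injective {U : Opens (ProjectiveSpectrum.top 𝒜)}
    {r : (ProjectiveSpectrum.Proj.structureSheaf 𝒜).1.obj (op U)} (h : ∀ x, value 𝒜 x r = 0) :
    r = 0 :=
  Subtype.ext (funext fun x => HomogeneousLocalization.val_injective _
    ((h x).trans HomogeneousLocalization.val_zero.symm))

end TwistAlgebra

noncomputable section TwistSheaf
variable {A : Type u} [CommRing A] {σ : Type*} [SetLike σ A] [AddSubgroupClass σ A]
variable {𝒜 : ℕ → σ} [GradedRing 𝒜]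

variable (𝒜) in
/-- The open set where an element of `A` does not vanish. -/
abbrev nonvanishing (a : A) : (Proj 𝒜).Opens := ProjectiveSpectrum.basicOpen 𝒜 a

/-- The localization of `A` at a point of `Proj 𝒜`. -/
def LocP (x : Proj 𝒜) : Type u := LocAt 𝒜 (show ProjectiveSpectrum.top 𝒜 from x)

instance (x : Proj 𝒜) : CommRing (LocP x) :=
  inferInstanceAs (CommRing (LocAt 𝒜 (show ProjectiveSpectrum.top 𝒜 from x)))

/-- The map from `A` to its localization at `x`. -/
def evP (x : Proj 𝒜) : A →+* LocP x := ev (𝒜 := 𝒜) x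

/-- The value of a function at a point. -/
def valueP {U : (Proj 𝒜).Opens} (x : U) : (Proj 𝒜).presheaf.obj (op U) →+* LocP x.1 :=
  value 𝒜 (U := U) x

/-- The values of the sections of `𝒪(d)`. -/
def val {d : ℤ} {U : (Proj 𝒜).Opens} (s : sec (toPMod (twist 𝒜 d)) U) (x : U) : LocP x.1 :=
  (show twistSections 𝒜 d U from s).1 x

lemma val_ext {d : ℤ} {U : (Proj 𝒜).Opens} {s t : sec (toPMod (twist 𝒜 d)) U}
    (h : ∀ x, val s x = val t x) : s = t := Subtype.ext (funext h)

lemma val_add {d : ℤ} {U : (Proj 𝒜).Opens} (s t : sec (toPMod (twist 𝒜 d)) U) (x : U) :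
    val (s + t) x = val s x + val t x := rfl

lemma val_smul {d : ℤ} {U : (Proj 𝒜).Opens} (r : (Proj 𝒜).presheaf.obj (op U))
    (s : sec (toPMod (twist 𝒜 d)) U) (x : U) :
    val (r • s) x = valueP x r * val s x := rfl

lemma exists_valueP_eq {U : (Proj 𝒜).Opens} (s : sec (toPMod (twist 𝒜 0)) U) :
    ∃ r : (Proj 𝒜).presheaf.obj (op U), ∀ x, valueP x r = val s x :=
  exists_value_eq (show twistSections 𝒜 0 U from s)

lemma exists_zpow_sections {a : A} (ha : a ∈ 𝒜 1) (d : ℤ) {U : (Proj 𝒜).Opens}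
    (hU : U ≤ nonvanishing 𝒜 a) : ∃ (u : sec (toPMod (twist 𝒜 d)) U)
      (u' : sec (toPMod (twist 𝒜 (-d))) U), ∀ x, val u x * val u' x = 1 :=
  ⟨zpowSection ha d U hU, zpowSection ha (-d) U hU, fun x => by
    refine (Units.val_mul (unitAt (notMem_idealAt hU x) ^ d) _).symm.trans ?_
    rw [← zpow_add, add_neg_cancel, zpow_zero, Units.val_one]
    rfl⟩

lemma exists_inv_section {e : ℕ} {a : A} (ha : a ∈ 𝒜 e) {U : (Proj 𝒜).Opens}
    (hU : U ≤ nonvanishing 𝒜 a) :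
    ∃ u : sec (toPMod (twist 𝒜 (-e))) U, ∀ x, evP x.1 a * val u x = 1 :=
  ⟨invSection ha U hU, fun x => Units.mul_inv (unitAt (notMem_idealAt hU x))⟩

/-- The product of sections of `𝒪(d)` and `𝒪(e)`. -/
def mulSec {d e f : ℤ} (h : d + e = f) {U : (Proj 𝒜).Opens} (s : sec (toPMod (twist 𝒜 d)) U)
    (t : sec (toPMod (twist 𝒜 e)) U) : sec (toPMod (twist 𝒜 f)) U :=
  show twistSections 𝒜 f U from ⟨fun x => val s x * val t x, by
    rw [← h]
    exact mul_mem_twistSections 𝒜 (show twistSections 𝒜 d U from s).2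
      (show twistSections 𝒜 e U from t).2⟩

lemma val_mulSec {d e f : ℤ} (h : d + e = f) {U : (Proj 𝒜).Opens}
    (s : sec (toPMod (twist 𝒜 d)) U) (t : sec (toPMod (twist 𝒜 e)) U) (x : U) :
    val (mulSec h s t) x = val s x * val t x := rfl

/-- The multiplication map `𝒪(d) ⊗ 𝒪(e) ⟶ 𝒪(f)` for `d + e = f`. -/
def mulTensor {d e f : ℤ} (h : d + e = f) :
    toPMod (twist 𝒜 d) ⊗ toPMod (twist 𝒜 e) ⟶ toPMod (twist 𝒜 f) where
  app U := ModuleCat.MonoidalCategory.tensorLift (mulSec (U := U.unop) h)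
    (fun _ _ _ => val_ext fun _ => add_mul _ _ _)
    (fun _ _ _ => val_ext fun _ => mul_assoc _ _ _)
    (fun _ _ _ => val_ext fun _ => mul_add _ _ _)
    (fun _ _ _ => val_ext fun _ => mul_left_comm _ _ _)
  naturality _ := ModuleCat.MonoidalCategory.tensor_ext fun _ _ => rfl

lemma tensor_hom_ext {P Q Z : PMod (Proj 𝒜)} {f g : P ⊗ Q ⟶ Z}
    (h : ∀ U (p : sec P U) (q : sec Q U), sapp f U (tmul p q) = sapp g U (tmul p q)) : f = g := by
  refine hom_ext_sapp fun U s => ?_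
  refine LinearMap.congr_fun (f := sapp f U) (g := sapp g U) ?_ s
  exact TensorProduct.ext' (R := (Proj 𝒜).presheaf.obj (op U)) (h U)

lemma isLocBij_of_bijective {P Q : PMod (Proj 𝒜)} {f : P ⟶ Q} {U₀ : (Proj 𝒜).Opens}
    (h : ∀ V ≤ U₀, Function.Bijective (sapp f V)) : IsLocBij f U₀ where
  inj V hV s hs x hx := ⟨V, le_rfl, hx, by
    rw [(h V hV).1 (hs.trans (map_zero _).symm), map_zero]⟩
  surj V hV t x hx := ⟨V, le_rfl, hx, (h V hV).2 _⟩

lemma IsLocBij.of_cover {P Q : PMod (Proj 𝒜)} {f : P ⟶ Q}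
    (h : ∀ x : Proj 𝒜, ∃ U₀ : (Proj 𝒜).Opens, x ∈ U₀ ∧ IsLocBij f U₀) : IsLocBij f ⊤ where
  inj V _ s hs x hx := by
    obtain ⟨U₀, hx₀, h⟩ := h x
    obtain ⟨W, hW, hxW, h0⟩ := h.inj (V ⊓ U₀) inf_le_right (pres P inf_le_left s)
      (by rw [sapp_pres, hs, map_zero]) x ⟨hx, hx₀⟩
    exact ⟨W, hW.trans inf_le_left, hxW, by rwa [pres_pres] at h0⟩
  surj V _ t x hx := by
    obtain ⟨U₀, hx₀, h⟩ := h x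
    obtain ⟨W, hW, hxW, s, hs⟩ := h.surj (V ⊓ U₀) inf_le_right (pres Q inf_le_left t) x ⟨hx, hx₀⟩
    exact ⟨W, hW.trans inf_le_left, hxW, s, by rw [hs, pres_pres]⟩

/-- Where a form a of degree one does not vanish, u = a^d freely generates 𝒪(d), so every tensor has
the form u ⊗ c with c recovered by dividing the product by u. -/
lemma bijective_mulTensor {d e f : ℤ} (h : d + e = f) {a : A} (ha : a ∈ 𝒜 1)
    {V : (Proj 𝒜).Opens} (hV : V ≤ nonvanishing 𝒜 a) :
    Function.Bijective (sapp (mulTensor (𝒜 := 𝒜) h) V) := by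
  obtain ⟨u, u', hu⟩ := exists_zpow_sections ha d hV
  have key (t : sec (toPMod (twist 𝒜 d) ⊗ toPMod (twist 𝒜 e)) V) :
      t = tmul u (mulSec (show -d + f = e by omega) u' (sapp (mulTensor h) V t)) := by
    refine TensorProduct.induction_on (R := (Proj 𝒜).presheaf.obj (op V)) t ?_ ?_ ?_
    · refine (TensorProduct.tmul_zero _ u).symm.trans (congrArg (tmul u) (val_ext fun x => ?_))
      refine ((mul_zero _).symm.trans (congrArg (val u' x * ·) ?_))
      exact (congrArg (val · x) (map_zero (sapp (mulTensor h) V))).symm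
    · intro b c
      obtain ⟨r, hr⟩ := exists_valueP_eq (mulSec (add_neg_cancel d) b u')
      have hb : b = r • u := val_ext fun x => by
        refine Eq.trans ?_ (val_smul r u x).symm
        rw [hr, val_mulSec, mul_assoc, mul_comm (val u' x), hu, mul_one]
      have hc : mulSec (show -d + f = e by omega) u' (mulSec h b c) = r • c := val_ext fun x => by
        refine Eq.trans ?_ (val_smul r c x).symm
        rw [hr, val_mulSec, val_mulSec, val_mulSec, ← mul_assoc, mul_comm (val u' x)]
      have h1 : (tmul b c : sec (toPMod (twist 𝒜 d) ⊗ toPMod (twist 𝒜 e)) V) =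
          tmul u (r • c) := by
        conv_lhs => rw [hb]
        exact TensorProduct.smul_tmul r u c
      exact h1.trans (congrArg (tmul u) hc.symm)
    · intro a b ha hb
      refine (congrArg₂ (· + ·) ha hb).trans
        ((TensorProduct.tmul_add _ _ _).symm.trans (congrArg (tmul u) (val_ext fun x => ?_)))
      refine (mul_add _ _ _).symm.trans (congrArg (val u' x * ·) ?_)
      exact congrArg (val · x) (map_add (sapp (mulTensor h) V) a b).symm
  constructor
  · rw [injective_iff_map_eq_zero]
    intro t ht
    rw [key t, ht]
    refine (congrArg (tmul u) (val_ext fun x => ?_)).trans (TensorProduct.tmul_zero _ u)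
    exact mul_zero _
  · intro s
    refine ⟨tmul u (mulSec (show -d + f = e by omega) u' s), val_ext fun x => ?_⟩
    refine (mul_assoc _ _ _).symm.trans ?_
    rw [hu, one_mul]

lemma isLocBij_mulTensor {d e f : ℤ} (h : d + e = f)
    (hA : ∀ x : Proj 𝒜, ∃ a ∈ 𝒜 1, x ∈ nonvanishing 𝒜 a) :
    IsLocBij (mulTensor (𝒜 := 𝒜) h) ⊤ :=
  IsLocBij.of_cover fun x => by
    obtain ⟨a, ha, hx⟩ := hA x
    exact ⟨_, hx, isLocBij_of_bijective fun V hV => bijective_mulTensor h ha hV⟩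

/-- The map from the structure sheaf to `𝒪(0)`. -/
def unitToTwist : 𝟙_ (PMod (Proj 𝒜)) ⟶ toPMod (twist 𝒜 0) :=
  PresheafOfModules.homMk
    { app := fun U => AddCommGrpCat.ofHom
        { toFun := fun r : (Proj 𝒜).presheaf.obj (op U.unop) => (show twistSections 𝒜 0 U.unop from
            ⟨fun x => value 𝒜 x r, value_mem_twistSections 𝒜 r⟩)
          map_zero' := Subtype.ext (funext fun x => map_zero (value 𝒜 x))
          map_add' := fun r s => Subtype.ext (funext fun x => map_add (value 𝒜 x) r s) }
      naturality := fun _ _ _ => rfl }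
    (fun U r s => Subtype.ext (funext fun x => map_mul (value 𝒜 (U := U.unop) x) r s))

lemma isLocBij_unitToTwist : IsLocBij (unitToTwist (𝒜 := 𝒜)) ⊤ :=
  isLocBij_of_bijective fun V _ => by
    constructor
    · rw [injective_iff_map_eq_zero]
      intro r hr
      exact value_injective fun x => congrFun (congrArg Subtype.val hr) x
    · intro s
      obtain ⟨r, hr⟩ := exists_valueP_eq s
      exact ⟨r, val_ext hr⟩

/-- Multiplication by a homogeneous element. -/
def mulHom {e : ℕ} {a : A} (ha : a ∈ 𝒜 e) {d d' : ℤ} (h : e + d = d') :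
    twist 𝒜 d ⟶ twist 𝒜 d' :=
  mulGlobal 𝒜 (globalOfHomogeneous 𝒜 a ha) h

/-- Multiplication by a homogeneous element, as a morphism of presheaves. -/
abbrev mulHomP {e : ℕ} {a : A} (ha : a ∈ 𝒜 e) {d d' : ℤ} (h : e + d = d') :
    toPMod (twist 𝒜 d) ⟶ toPMod (twist 𝒜 d') :=
  (mulHom ha h).val

lemma val_mulHom {e : ℕ} {a : A} (ha : a ∈ 𝒜 e) {d d' : ℤ} (h : e + d = d')
    {U : (Proj 𝒜).Opens} (s : sec (toPMod (twist 𝒜 d)) U) (x : U) :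
    val (sapp (mulHomP ha h) U s) x = evP x.1 a * val s x := by
  refine Eq.trans ?_ (congrArg (· * val s x)
    (show _ = evP x.1 a from frac_one (𝒜 := 𝒜) (x := x.1) a
      (Ideal.IsPrime.one_notMem (ProjectiveSpectrum.isPrime (𝒜 := 𝒜) x.1))))
  rfl

lemma twist_hom_ext {M : (Proj 𝒜).Modules} {d : ℤ} {f g : M ⟶ twist 𝒜 d}
    (h : ∀ U (s : sec (toPMod M) U) x, val (sapp (P := toPMod M) f.val U s) x =
      val (sapp (P := toPMod M) g.val U s) x) : f = g :=
  SheafOfModules.Hom.ext (hom_ext_sapp (P := toPMod M) (Q := toPMod (twist 𝒜 d)) fun U s =>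
    val_ext (h U s))

lemma mulHom_add {e : ℕ} {a a' : A} (ha : a ∈ 𝒜 e) (ha' : a' ∈ 𝒜 e) {d d' : ℤ} (h : e + d = d') :
    mulHom (add_mem ha ha') h = mulHom ha h + mulHom ha' h :=
  twist_hom_ext fun U s x => by
    rw [val_mulHom, map_add, add_mul, ← val_mulHom ha h, ← val_mulHom ha' h]
    rfl

lemma mulHom_zero {e : ℕ} {a : A} (ha : a ∈ 𝒜 e) (ha' : a = 0) {d d' : ℤ} (h : e + d = d') :
    mulHom ha h = 0 :=
  twist_hom_ext fun U s x => by
    rw [val_mulHom, ha', map_zero, zero_mul]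
    rfl

lemma isLocBij_mulHom {e : ℕ} {a : A} (ha : a ∈ 𝒜 e) {d d' : ℤ} (h : e + d = d') :
    IsLocBij (mulHomP ha h) (nonvanishing 𝒜 a) :=
  isLocBij_of_bijective fun V hV => by
    obtain ⟨u, hu⟩ := exists_inv_section ha hV
    constructor
    · rw [injective_iff_map_eq_zero]
      intro s hs
      refine val_ext fun x => ?_
      have := congrArg (fun t => val u x * val t x) hs
      simp only [val_mulHom] at this
      rw [← mul_assoc, mul_comm (val u x), hu, one_mul] at this
      exact this.trans (mul_zero _)
    · intro t
      refine ⟨mulSec (by omega) u t, val_ext fun x => ?_⟩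
      rw [val_mulHom, val_mulSec, ← mul_assoc, hu, one_mul]

lemma mulTensor_mulHom_left {e : ℕ} {a : A} (ha : a ∈ 𝒜 e) {d d' f g g' : ℤ} (h : e + d = d')
    (h₁ : d + f = g) (h₂ : d' + f = g') (h₃ : e + g = g') :
    mulHomP ha h ▷ toPMod (twist 𝒜 f) ≫ mulTensor h₂ = mulTensor h₁ ≫ mulHomP ha h₃ :=
  tensor_hom_ext fun U p q => val_ext fun x => by
    refine Eq.trans ?_ (val_mulHom ha h₃ (mulSec h₁ p q) x).symm
    refine (congrArg (· * val q x) (val_mulHom ha h p x)).trans ?_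
    exact mul_assoc _ _ _

lemma mulTensor_mulHom_right {e : ℕ} {a : A} (ha : a ∈ 𝒜 e) {d d' f g g' : ℤ} (h : e + d = d')
    (h₁ : f + d = g) (h₂ : f + d' = g') (h₃ : e + g = g') :
    toPMod (twist 𝒜 f) ◁ mulHomP ha h ≫ mulTensor h₂ = mulTensor h₁ ≫ mulHomP ha h₃ :=
  tensor_hom_ext fun U p q => val_ext fun x => by
    refine Eq.trans ?_ (val_mulHom ha h₃ (mulSec h₁ p q) x).symm
    refine (congrArg (val p x * ·) (val_mulHom ha h q x)).trans ?_
    exact mul_left_comm _ _ _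

end TwistSheaf
end QuadricSheaf

namespace QuadricSheaf
open CategoryTheory Opposite TopologicalSpace Limits Abelian AlgebraicGeometry MonoidalCategory
open scoped TensorProduct

/-! ### Twists of a sheaf, matrices of linear forms and their syzygies -/

noncomputable section TwistedSheaf
attribute [local instance] Abelian.hasFiniteBiproducts
variable {A : Type u} [CommRing A] {σ : Type*} [SetLike σ A] [AddSubgroupClass σ A]
variable {𝒜 : ℕ → σ} [GradedRing 𝒜]

lemma val_sum {d : ℤ} {U : (Proj 𝒜).Opens} {κ : Type*} (I : Finset κ)
    (s : κ → sec (toPMod (twist 𝒜 d)) U) (x : U) :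
    val (∑ i ∈ I, s i) x = ∑ i ∈ I, val (s i) x := by
  classical
  induction I using Finset.induction_on with
  | empty => simp only [Finset.sum_empty]; rfl
  | insert i I hi ih => rw [Finset.sum_insert hi, Finset.sum_insert hi, val_add, ih]

lemma mulHom_eq_sum {κ : Type*} (I : Finset κ) {e e' f : ℕ} {a b : κ → A} {c : A}
    (ha : ∀ i, a i ∈ 𝒜 e) (hb : ∀ i, b i ∈ 𝒜 e') (hc : c ∈ 𝒜 f) (hcc : c = ∑ i ∈ I, b i * a i)
    {d d' d'' : ℤ} (h : e + d = d') (h' : e' + d' = d'') (h'' : f + d = d'') :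
    mulHom hc h'' = ∑ i ∈ I, mulHom (ha i) h ≫ mulHom (hb i) h' :=
  twist_hom_ext fun U s x => by
    have h1 : sapp (P := toPMod (twist 𝒜 d)) (Q := toPMod (twist 𝒜 d''))
        (∑ i ∈ I, mulHom (ha i) h ≫ mulHom (hb i) h').val U s =
        ∑ i ∈ I, sapp (mulHomP (hb i) h') U (sapp (mulHomP (ha i) h) U s) :=
      sum_app_apply I (fun i => mulHom (ha i) h ≫ mulHom (hb i) h') U s
    rw [h1, val_sum, val_mulHom, hcc, map_sum, Finset.sum_mul]
    refine Finset.sum_congr rfl fun i _ => ?_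
    rw [val_mulHom, val_mulHom, map_mul, mul_assoc]

variable (F : (Proj 𝒜).Modules)

/-- The sheaf `F(d)`. -/
abbrev tw (d : ℤ) : (Proj 𝒜).Modules := tensor F (twist 𝒜 d)

/-- Multiplication by a homogeneous element on the twists of `F`. -/
def act {e : ℕ} {a : A} (ha : a ∈ 𝒜 e) {d d' : ℤ} (h : e + d = d') : tw F d ⟶ tw F d' :=
  tensorMap F (mulHom ha h)

lemma act_eq_sum {κ : Type*} (I : Finset κ) {e e' f : ℕ} {a b : κ → A} {c : A}
    (ha : ∀ i, a i ∈ 𝒜 e) (hb : ∀ i, b i ∈ 𝒜 e') (hc : c ∈ 𝒜 f) (hcc : c = ∑ i ∈ I, b i * a i)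
    {d d' d'' : ℤ} (h : e + d = d') (h' : e' + d' = d'') (h'' : f + d = d'') :
    act F hc h'' = ∑ i ∈ I, act F (ha i) h ≫ act F (hb i) h' := by
  rw [act, mulHom_eq_sum I ha hb hc hcc h h' h'']
  refine ((tensorLeftMod F).map_sum _ _).trans (Finset.sum_congr rfl fun i _ => ?_)
  exact tensorMap_comp _ _ _

lemma act_zero {e : ℕ} {a : A} (ha : a ∈ 𝒜 e) (ha' : a = 0) {d d' : ℤ} (h : e + d = d') :
    act F ha h = 0 := by
  rw [act, mulHom_zero ha ha', tensorMap_zero]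

lemma act_add {e : ℕ} {a b c : A} (ha : a ∈ 𝒜 e) (hb : b ∈ 𝒜 e) (hc : c ∈ 𝒜 e) (hcc : c = a + b)
    {d d' : ℤ} (h : e + d = d') : act F hc h = act F ha h + act F hb h := by
  subst hcc
  rw [act, mulHom_add ha hb, tensorMap_add]
  rfl

lemma act_comp {e e' f : ℕ} {a b c : A} (ha : a ∈ 𝒜 e) (hb : b ∈ 𝒜 e') (hc : c ∈ 𝒜 f)
    (hcc : c = b * a) {d d' d'' : ℤ} (h : e + d = d') (h' : e' + d' = d'') (h'' : f + d = d'') :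
    act F ha h ≫ act F hb h' = act F hc h'' := by
  rw [act_eq_sum F Finset.univ (fun _ : Unit => ha) (fun _ => hb) hc (by simpa) h h' h'']
  simp

lemma act_comm {e e' : ℕ} {a b : A} (ha : a ∈ 𝒜 e) (hb : b ∈ 𝒜 e')
    {d d' d'' d₃ : ℤ} (h : e + d = d') (h' : e' + d' = d'') (h₁ : e' + d = d₃)
    (h₂ : e + d₃ = d'') :
    act F ha h ≫ act F hb h' = act F hb h₁ ≫ act F ha h₂ := by
  have hc : b * a ∈ 𝒜 (e' + e) := SetLike.mul_mem_graded hb ha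
  rw [act_comp F ha hb hc rfl h h' (by push_cast; omega),
    act_comp F hb ha hc (mul_comm _ _) h₁ h₂ (by push_cast; omega)]

lemma bijective_act {e : ℕ} {a : A} (ha : a ∈ 𝒜 e) {d d' : ℤ} (h : e + d = d')
    {V : (Proj 𝒜).Opens} (hV : V ≤ nonvanishing 𝒜 a) :
    Function.Bijective ((act F ha h).app V) :=
  bijective_tensorMap (isLocBij_mulHom ha h) F hV

/-- The isomorphism between the sheafification of `F` and `F(0)`. -/
def toTwZero : (sheafifyMod (Proj 𝒜)).obj (toPMod F) ⟶ tw F 0 :=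
  (sheafifyMod (Proj 𝒜)).map ((ρ_ (toPMod F)).inv ≫ toPMod F ◁ unitToTwist)

instance : IsIso (toTwZero F) :=
  (IsLocBij.of_isIso.comp (isLocBij_unitToTwist.whiskerLeft (toPMod F))).isIso

/-- Multiplication by a identifies consecutive twists over W, which reduces every twist to F(0),
isomorphic to F itself. -/
lemma isLocalizingOn_tw [F.IsQuasicoherent] {a : A} (ha : a ∈ 𝒜 1) {W : (Proj 𝒜).Opens}
    (hW : IsAffineOpen W) (hWa : W ≤ nonvanishing 𝒜 a) (d : ℤ) : IsLocalizingOn (tw F d) W := by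
  induction d using Int.induction_on with
  | zero =>
    refine IsLocalizingOn.of_bijective' ((sheafifyModIso F).inv ≫ toTwZero F)
      (fun V _ => bijective_app_of_isIso _ V) (isLocalizingOn_of_isQuasicoherent F hW)
  | succ i ih =>
    exact ih.of_bijective' (act F ha (by push_cast; ring))
      fun V hV => bijective_act F ha _ (hV.trans hWa)
  | pred i ih =>
    exact ih.of_bijective (act F ha (by push_cast; ring))
      fun V hV => bijective_act F ha _ (hV.trans hWa)

/-- The twists of a quasi-coherent sheaf. -/
def twFamily [F.IsQuasicoherent] {ι : Type} {l : ι → A} (hl : ∀ i, l i ∈ 𝒜 1) :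
    GradedFamily fun i => nonvanishing 𝒜 (l i) where
  obj d := tw F d
  mul i d := act F (hl i) (by push_cast; ring)
  mul_comm i j d := act_comm F _ _ _ _ _ _
  bijective i d V hV := bijective_act F _ _ hV
  isLocalizingOn i d W hW h := isLocalizingOn_tw F (hl i) hW h d

lemma modulesHom_ext {X : Scheme.{u}} {M N : X.Modules} {f g : M ⟶ N}
    (h : ∀ V s, f.app V s = g.app V s) : f = g :=
  Scheme.Modules.hom_ext _ _ fun V => ConcreteCategory.hom_ext _ _ (h V)

section Matrix
variable {κ : Type} [Fintype κ] {e e' f : ℕ} {P Q R : Matrix κ κ A}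

/-- The action of a matrix of homogeneous elements on vectors of sections of the twists of `F`. -/
def matAct (hP : ∀ i j, P i j ∈ 𝒜 e) {d d' : ℤ} (h : e + d = d') {V : (Proj 𝒜).Opens}
    (u : κ → (tw F d).presheaf.obj (op V)) (i : κ) : (tw F d').presheaf.obj (op V) :=
  ∑ j, (act F (hP i j) h).app V (u j)

lemma matAct_matAct (hP : ∀ i j, P i j ∈ 𝒜 e') (hQ : ∀ i j, Q i j ∈ 𝒜 e)
    (hR : ∀ i j, R i j ∈ 𝒜 f) (hPQ : R = P * Q) {d d' d'' : ℤ} (h : e + d = d')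
    (h' : e' + d' = d'') (h'' : f + d = d'') {V : (Proj 𝒜).Opens}
    (u : κ → (tw F d).presheaf.obj (op V)) :
    matAct F hP h' (matAct F hQ h u) = matAct F hR h'' u := by
  funext i
  simp only [matAct, map_sum]
  rw [Finset.sum_comm]
  refine Finset.sum_congr rfl fun k _ => ?_
  rw [act_eq_sum F Finset.univ (fun j => hQ j k) (fun j => hP i j) (hR i k)
    (by rw [hPQ, Matrix.mul_apply]) h h' h'', sum_app_apply]
  rfl

lemma matAct_zero_matrix (hP : ∀ i j, P i j ∈ 𝒜 e) (hP0 : P = 0) {d d' : ℤ} (h : e + d = d')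
    {V : (Proj 𝒜).Opens} (u : κ → (tw F d).presheaf.obj (op V)) : matAct F hP h u = 0 := by
  funext i
  refine Finset.sum_eq_zero fun j _ => ?_
  rw [act_zero F (hP i j) (by rw [hP0]; rfl)]
  rfl

/-- This is the form in which the homotopy identity of an `ExactPair` acts on vectors of sections.
-/
lemma matAct_add_matAct [DecidableEq κ] (hP : ∀ i j, P i j ∈ 𝒜 e) (hQ : ∀ i j, Q i j ∈ 𝒜 e) {a : A}
    (ha : a ∈ 𝒜 e) (hPQ : P + Q = a • 1) {d d' : ℤ} (h : e + d = d') {V : (Proj 𝒜).Opens}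
    (u : κ → (tw F d).presheaf.obj (op V)) (i : κ) :
    matAct F hP h u i + matAct F hQ h u i = (act F ha h).app V (u i) := by
  have key (j : κ) (c : A) (hc : c ∈ 𝒜 e) (hcc : c = P i j + Q i j) :
      (act F (hP i j) h).app V (u j) + (act F (hQ i j) h).app V (u j) =
        (act F hc h).app V (u j) := by
    rw [act_add F (hP i j) (hQ i j) hc hcc]
    rfl
  rw [matAct, matAct, ← Finset.sum_add_distrib, Finset.sum_eq_single i]
  · exact key i a ha (by rw [← Matrix.add_apply, hPQ]; simp)
  · intro j _ hj
    rw [key j 0 (zero_mem _) (by rw [← Matrix.add_apply, hPQ]; simp [Matrix.one_apply_ne hj.symm]),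
      act_zero F (zero_mem _) rfl]
    rfl
  · simp

lemma act_matAct (hP : ∀ i j, P i j ∈ 𝒜 e) {a : A} (ha : a ∈ 𝒜 e') {d d' d'' d₃ : ℤ}
    (h : e + d = d') (h' : e' + d' = d'') (h₁ : e' + d = d₃) (h₂ : e + d₃ = d'')
    {V : (Proj 𝒜).Opens} (u : κ → (tw F d).presheaf.obj (op V)) (i : κ) :
    (act F ha h').app V (matAct F hP h u i) =
      matAct F hP h₂ (fun j => (act F ha h₁).app V (u j)) i := by
  simp only [matAct, map_sum]
  refine Finset.sum_congr rfl fun j _ => ?_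
  rw [← comp_app_apply, act_comm F (hP i j) ha h h' h₁ h₂, comp_app_apply]

/-- The components of a section of a direct sum of copies of `F(d)`. -/
abbrev comps {d : ℤ} {V : (Proj 𝒜).Opens} (s : (⨁ fun _ : κ => tw F d).presheaf.obj (op V))
    (i : κ) : (tw F d).presheaf.obj (op V) :=
  (biproduct.π (fun _ : κ => tw F d) i).app V s

/-- The map of direct sums of twists of `F` given by a matrix of homogeneous elements. -/
def matHom (hP : ∀ i j, P i j ∈ 𝒜 e) {d d' : ℤ} (h : e + d = d') :
    (⨁ fun _ : κ => tw F d) ⟶ ⨁ fun _ : κ => tw F d' :=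
  biproduct.lift fun i => biproduct.desc fun j => act F (hP i j) h

lemma comps_matHom (hP : ∀ i j, P i j ∈ 𝒜 e) {d d' : ℤ} (h : e + d = d') {V : (Proj 𝒜).Opens}
    (s : (⨁ fun _ : κ => tw F d).presheaf.obj (op V)) :
    comps F ((matHom F hP h).app V s) = matAct F hP h (comps F s) := by
  funext i
  rw [comps, ← comp_app_apply, matHom, biproduct.lift_π]
  exact biproduct_desc_app_apply _ V s

lemma matHom_comp (hP : ∀ i j, P i j ∈ 𝒜 e') (hQ : ∀ i j, Q i j ∈ 𝒜 e) (hPQ : P * Q = 0)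
    {d d' d'' : ℤ} (h : e + d = d') (h' : e' + d' = d'') :
    matHom F hQ h ≫ matHom F hP h' = 0 := by
  have hR : ∀ i j, (0 : Matrix κ κ A) i j ∈ 𝒜 (e' + e) := fun i j => zero_mem _
  refine modulesHom_ext fun V s => biproduct_section_ext fun i => ?_
  rw [comp_app_apply]
  refine (congrFun ((comps_matHom F hP h' _).trans ((congrArg (matAct F hP h')
    (comps_matHom F hQ h s)).trans ((matAct_matAct F hP hQ hR hPQ.symm h h'
      (by push_cast; omega) _).trans (matAct_zero_matrix F hR rfl _ _)))) i).trans ?_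
  exact (map_zero _).symm

lemma matHom_naturality (hP : ∀ i j, P i j ∈ 𝒜 e) {a : A} (ha : a ∈ 𝒜 e') {d d' d'' d₃ : ℤ}
    (h : e + d = d') (h' : e' + d' = d'') (h₁ : e' + d = d₃) (h₂ : e + d₃ = d'') :
    (biproduct.map fun _ : κ => act F ha h₁) ≫ matHom F hP h₂ =
      matHom F hP h ≫ biproduct.map fun _ : κ => act F ha h' := by
  refine biproduct.hom_ext _ _ fun p => biproduct.hom_ext' _ _ fun q => ?_
  simp only [matHom, Category.assoc, biproduct.lift_π, biproduct.map_π, biproduct.lift_π_assoc,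
    biproduct.ι_map_assoc, biproduct.ι_desc, biproduct.ι_desc_assoc]
  exact act_comm F _ _ _ _ _ _

end Matrix

/-- Matrices of elements of degree one with products zero, satisfying a condition which implies
that they give exact sequences of sheaves. -/
structure ExactPair (𝒜 : ℕ → σ) [GradedRing 𝒜] (κ : Type) [Fintype κ] [DecidableEq κ] where
  /-- the first matrix -/
  φ : Matrix κ κ A
  /-- the second matrix -/
  ψ : Matrix κ κ A
  mem_φ : ∀ i j, φ i j ∈ 𝒜 1
  mem_ψ : ∀ i j, ψ i j ∈ 𝒜 1
  φ_mul_ψ : φ * ψ = 0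
  ψ_mul_φ : ψ * φ = 0
  exists_homotopy : ∀ x : Proj 𝒜, ∃ a ∈ 𝒜 1, x ∈ nonvanishing 𝒜 a ∧ ∃ φ' ψ' : Matrix κ κ A,
    (∀ i j, φ' i j ∈ 𝒜 0) ∧ (∀ i j, ψ' i j ∈ 𝒜 0) ∧
      φ * ψ' + φ' * ψ = a • 1 ∧ ψ * φ' + ψ' * φ = a • 1

namespace ExactPair
variable {κ : Type} [Fintype κ] [DecidableEq κ] (S : ExactPair 𝒜 κ)

/-- Exchange the two matrices. -/
def swap : ExactPair 𝒜 κ where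
  φ := S.ψ
  ψ := S.φ
  mem_φ := S.mem_ψ
  mem_ψ := S.mem_φ
  φ_mul_ψ := S.ψ_mul_φ
  ψ_mul_φ := S.φ_mul_ψ
  exists_homotopy x := by
    obtain ⟨a, ha, hx, φ', ψ', h1, h2, h3, h4⟩ := S.exists_homotopy x
    exact ⟨a, ha, hx, ψ', φ', h2, h1, h4, h3⟩

/-- The first matrix as a map of degree one on the vectors with entries in the twists of `F`. -/
abbrev mulφ (d : ℤ) : (⨁ fun _ : κ => tw F d) ⟶ ⨁ fun _ : κ => tw F (d + 1) :=
  matHom F S.mem_φ (show ((1 : ℕ) : ℤ) + d = d + 1 by push_cast; ring)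

/-- The kernel of the first matrix. -/
abbrev syz (d : ℤ) : (Proj 𝒜).Modules := kernel (S.mulφ F d)

lemma swap_mulφ_comp (d : ℤ) : S.swap.mulφ F d ≫ S.mulφ F (d + 1) = 0 :=
  matHom_comp F S.mem_φ S.mem_ψ S.φ_mul_ψ _ _

/-- The second matrix as a map to the kernel of the first matrix. -/
def toSyz (d : ℤ) : (⨁ fun _ : κ => tw F d) ⟶ S.syz F (d + 1) :=
  kernel.lift _ (S.swap.mulφ F d) (S.swap_mulφ_comp F d)

lemma toSyz_ι (d : ℤ) :
    S.toSyz F d ≫ kernel.ι (S.mulφ F (d + 1)) = S.swap.mulφ F d :=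
  kernel.lift_ι _ _ _

/-- The homotopy solves the equation near x: if `φ s = 0` and u = s/a, then `φ u = 0`, and `ψ φ' +
ψ' φ = a` gives `ψ (φ' u) = a u = s`. Nothing is asked of F, since the homotopy survives tensoring.
-/
lemma isLocSurj_toSyz (d : ℤ) : IsLocSurj (S.toSyz F d) := by
  intro V s x hx
  obtain ⟨a, ha, hxa, φ', ψ', hφ', hψ', -, hS⟩ := S.exists_homotopy x
  let W := V ⊓ nonvanishing 𝒜 a
  have h1 (e : ℤ) : ((1 : ℕ) : ℤ) + e = e + 1 := by push_cast; ring
  let s' := (kernel.ι (S.mulφ F (d + 1))).app W (res _ inf_le_left s)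
  choose u hu using fun i : κ => (bijective_act F ha (h1 d) (V := W) inf_le_right).2 (comps F s' i)
  have hs' : matAct F S.mem_φ (h1 (d + 1)) (comps F s') = 0 := by
    rw [← comps_matHom, kernel_ι_app_mem]
    funext i
    exact map_zero _
  have hφu : matAct F S.mem_φ (h1 d) u = 0 := by
    funext i
    -- Multiplication by a is injective over W and commutes with `φ`, and a u = s' is killed by `φ`.
    refine (bijective_act F ha (h1 (d + 1)) (V := W) inf_le_right).1 ?_
    rw [act_matAct F S.mem_φ ha (h1 d) (h1 (d + 1)) (h1 d) (h1 (d + 1)), funext hu, hs']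
    exact (map_zero _).symm
  obtain ⟨t, ht⟩ := exists_biproduct_section (fun _ : κ => tw F d) W
    (matAct F hφ' (show ((0 : ℕ) : ℤ) + d = d by simp) u)
  refine ⟨W, inf_le_left, ⟨hx, hxa⟩, t, kernel_ι_app_injective _ _ (biproduct_section_ext
    fun i => ?_)⟩
  have hmem (P Q : Matrix κ κ A) (i j : ℕ) (hP : ∀ a b, P a b ∈ 𝒜 i) (hQ : ∀ a b, Q a b ∈ 𝒜 j)
      (a b) : (P * Q) a b ∈ 𝒜 (i + j) := by
    rw [Matrix.mul_apply]
    exact sum_mem fun c _ => SetLike.mul_mem_graded (hP a c) (hQ c b)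
  have h2 := matAct_add_matAct F (hmem _ _ 1 0 S.mem_ψ hφ') (hmem _ _ 0 1 hψ' S.mem_φ) ha hS
    (h1 d) u i
  rw [← matAct_matAct F S.mem_ψ hφ' (hmem _ _ 1 0 S.mem_ψ hφ') rfl (by simp) (h1 d) (h1 d) u,
    ← matAct_matAct F hψ' S.mem_φ (hmem _ _ 0 1 hψ' S.mem_φ) rfl (h1 d) (by simp) (h1 d) u,
    hφu, hu] at h2
  have h3 : matAct F hψ' (show ((0 : ℕ) : ℤ) + (d + 1) = d + 1 by simp)
      (0 : κ → (tw F (d + 1)).presheaf.obj (op W)) i = 0 :=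
    Finset.sum_eq_zero fun j _ => map_zero _
  rw [h3, add_zero] at h2
  refine Eq.trans ?_ h2
  refine (congrArg (fun f => comps F (f.app W t) i) (S.toSyz_ι F d)).trans ?_
  refine (congrFun (comps_matHom F S.mem_ψ (h1 d) t) i).trans ?_
  exact congrFun (congrArg (matAct F S.mem_ψ (h1 d)) (funext ht)) i

lemma isSES_syz (d : ℤ) : IsSES (kernel.ι (S.swap.mulφ F d)) (S.toSyz F d) where
  injective := kernel_ι_app_injective _
  zero := (cancel_mono (kernel.ι _)).1 (by
    rw [Category.assoc, toSyz_ι, kernel.condition, zero_comp])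
  exact V s hs := exists_kernel_ι_app_eq _ V s (by
    have := congrArg ((kernel.ι (S.mulφ F (d + 1))).app V) hs
    rw [← comp_app_apply, toSyz_ι, map_zero] at this
    exact this)
  surjective := S.isLocSurj_toSyz F d

variable [F.IsQuasicoherent] {ι : Type} {l : ι → A} (hl : ∀ i, l i ∈ 𝒜 1)

/-- The graded family of the kernels of the first matrix. -/
abbrev syzFamily : GradedFamily fun i => nonvanishing 𝒜 (l i) :=
  ((twFamily F hl).pow κ).ker (B := (twFamily F hl).pow κ) (S.mulφ F) fun i _ =>
    matHom_naturality F S.mem_φ (hl i) _ _ _ _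

end ExactPair
end TwistedSheaf
end QuadricSheaf

namespace QuadricSheaf
open CategoryTheory Opposite TopologicalSpace Limits Abelian AlgebraicGeometry MonoidalCategory
open scoped TensorProduct

/-! ### Regularity of a sheaf and of its matrix syzygies -/

noncomputable section Regularity
attribute [local instance] Abelian.hasFiniteBiproducts
variable {A : Type u} [CommRing A] {σ : Type*} [SetLike σ A] [AddSubgroupClass σ A]
variable {𝒜 : ℕ → σ} [GradedRing 𝒜] (F : (Proj 𝒜).Modules)

namespace ExactPair
variable {κ : Type} [Fintype κ] [DecidableEq κ] (S : ExactPair 𝒜 κ) {n : ℕ} {m : ℤ}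

/-- Vanishing of the intermediate cohomology of the twists of `F` and of the top cohomology of the
kernels of both matrices. -/
structure IsRegular (n : ℕ) (m : ℤ) : Prop where
  tw : ∀ i : ℕ, 1 ≤ i → i < n → ∀ d : ℤ, d + i = m → Subsingleton (H i (tw F d))
  syz : ∀ d : ℤ, d + n = m + 1 → Subsingleton (H n (S.syz F d))
  syz_swap : ∀ d : ℤ, d + n = m + 1 → Subsingleton (H n (S.swap.syz F d))

lemma toSyz_mul_ι [F.IsQuasicoherent] {ι : Type} {l : ι → A} (hl : ∀ i, l i ∈ 𝒜 1) (i : ι)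
    (d : ℤ) : S.toSyz F d ≫ (S.syzFamily F hl).mul i (d + 1) ≫ kernel.ι (S.mulφ F (d + 1 + 1)) =
      (biproduct.map fun _ : κ => act F (hl i) (show ((1 : ℕ) : ℤ) + d = d + 1 by
        push_cast; ring)) ≫ S.swap.mulφ F (d + 1) := by
  refine (congrArg (S.toSyz F d ≫ ·) (GradedFamily.ker_mul_ι (A := (twFamily F hl).pow κ)
    (B := (twFamily F hl).pow κ) (S.mulφ F) _ i (d + 1))).trans ?_
  refine (Category.assoc _ _ _).symm.trans ((congrArg (· ≫ _) (S.toSyz_ι F d)).trans ?_)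
  exact (matHom_naturality F S.mem_ψ (hl i) _ _ _ _).symm

namespace IsRegular
variable {F S}

lemma swap (h : S.IsRegular F n m) : S.swap.IsRegular F n m := ⟨h.tw, h.syz_swap, h.syz⟩

/-- Descending induction from i = n, where the vanishing is assumed. In the sequence for `syz (d +
1)` the middle term has no H^i and the left term is the syzygy of the swapped pair in degree d, so
each step exchanges `φ` and `ψ`. -/
lemma subsingleton_H_syz (k : ℕ) : ∀ {S : ExactPair 𝒜 κ} (_ : S.IsRegular F n m) (i : ℕ), 1 ≤ i →
    i + k = n → ∀ d : ℤ, d + i = m + 1 → Subsingleton (H i (S.syz F d)) := by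
  induction k with
  | zero =>
    rintro S h i hi rfl d hd
    exact h.syz d hd
  | succ k ih =>
    intro S h i hi hik d hd
    obtain ⟨d, rfl⟩ : ∃ d', d = d' + 1 := ⟨d - 1, by ring⟩
    exact (S.isSES_syz F d).subsingleton_H₃
      (subsingleton_H_biproduct _ fun _ => h.tw i hi (by omega) d (by omega))
      (ih h.swap (i + 1) (by omega) (by omega) d (by push_cast; omega))

lemma subsingleton_H_syz' (h : S.IsRegular F n m) (i : ℕ) (hi : 1 ≤ i) (hin : i ≤ n) (d : ℤ)
    (hd : d + i = m + 1) : Subsingleton (H i (S.syz F d)) :=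
  subsingleton_H_syz (n - i) h i hi (by omega) d hd

variable [F.IsQuasicoherent] {ι : Type} [Fintype ι] {l : ι → A} (hl : ∀ i, l i ∈ 𝒜 1)
  (hU : ⨆ i, nonvanishing 𝒜 (l i) = ⊤)
  (hvan : ∀ (B : GradedFamily fun i => nonvanishing 𝒜 (l i)) d, Subsingleton (H (n + 1) (B.obj d)))
include hl hU hvan

/-- The syzygies are (m+1)-regular in the classical sense, so classical monotonicity applies to
them. -/
lemma subsingleton_H_syz_succ (h : S.IsRegular F n m) (i : ℕ) (hi : 1 ≤ i) (hin : i ≤ n) (d : ℤ)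
    (hd : d + i = m + 1 + 1) : Subsingleton (H i (S.syz F d)) :=
  (S.syzFamily F hl).subsingleton_H_succ hU hvan h.subsingleton_H_syz' hi hin hd

lemma succ [Nonempty κ] (h : S.IsRegular F n m) (hn : 1 ≤ n) : S.IsRegular F n (m + 1) where
  tw i hi hin d hd := by
    -- The left term uses regularity at m + 1 and the right term, one twist higher, the gain to m +
    -- 2. A single copy of F(d) is then a direct summand of the middle term.
    have h1 := (S.isSES_syz F d).subsingleton_H₂ (h.swap.subsingleton_H_syz' i hi hin.le d hd)
      (h.subsingleton_H_syz_succ hl hU hvan i hi hin.le (d + 1) (by omega))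
    obtain ⟨p⟩ := ‹Nonempty κ›
    exact subsingleton_H_of_sum_eq_id (κ := Unit) (N := QuadricSheaf.tw F d)
      (fun _ => biproduct.ι (fun _ : κ => QuadricSheaf.tw F d) p) (fun _ => biproduct.π _ p)
      (by simp) fun _ => h1
  syz d hd := by
    exact h.subsingleton_H_syz_succ hl hU hvan n hn le_rfl d hd
  syz_swap d hd := by
    exact h.swap.subsingleton_H_syz_succ hl hU hvan n hn le_rfl d hd

/-- Coefficients are linear forms of two kinds: those defining the affine cover and the entries of
the p-th row of `φ`. The latter absorb the error made in lifting from the syzygies. -/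
lemma exists_eq_sum (h : S.IsRegular F n m) (hn : 1 ≤ n) (p : κ)
    (t : (QuadricSheaf.tw F (m + 1)).presheaf.obj (op ⊤)) :
    ∃ (g : ι → (QuadricSheaf.tw F m).presheaf.obj (op ⊤))
      (v : κ → (QuadricSheaf.tw F m).presheaf.obj (op ⊤)),
      t = ∑ i, (act F (hl i) (show ((1 : ℕ) : ℤ) + m = m + 1 by push_cast; ring)).app ⊤ (g i) +
        ∑ q, (act F (S.mem_φ p q) (show ((1 : ℕ) : ℤ) + m = m + 1 by push_cast; ring)).app ⊤
          (v q) := by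
  have h1 (e : ℤ) : ((1 : ℕ) : ℤ) + e = e + 1 := by push_cast; ring
  obtain ⟨τ, hτ⟩ := exists_biproduct_section (fun _ : κ => QuadricSheaf.tw F (m + 1)) ⊤
    (fun q => if q = p then t else 0)
  -- With t in coordinate p, the section `ψ τ` of `syz (m + 2)` is a combination of linear forms
  -- times sections of `syz (m + 1)`.
  obtain ⟨g, hg⟩ := (S.syzFamily F hl).exists_eq_sum_mul hU hvan h.subsingleton_H_syz'
    ((S.toSyz F (m + 1)).app ⊤ τ)
  choose w hw using fun i => (S.isSES_syz F m).surjective_app_top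
    (h.swap.subsingleton_H_syz' 1 le_rfl hn m (by push_cast; ring)) (g i)
  let L (i : ι) : (⨁ fun _ : κ => QuadricSheaf.tw F m) ⟶ ⨁ fun _ : κ => QuadricSheaf.tw F (m + 1) :=
    biproduct.map fun _ : κ => act F (hl i) (h1 m)
  have hL (i : ι) : (kernel.ι (S.mulφ F (m + 1 + 1))).app ⊤
      (((S.syzFamily F hl).mul i (m + 1)).app ⊤ (g i)) =
      (S.swap.mulφ F (m + 1)).app ⊤ ((L i).app ⊤ (w i)) := by
    rw [← hw]
    exact congrArg (fun f => Scheme.Modules.Hom.app f ⊤ (w i)) (S.toSyz_mul_ι F hl i m)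
  -- The sections g_i are `ψ w_i`, so `ψ` kills `τ - ∑ x_i w_i`. Vanishing of H^1 of `syz F m` then
  -- makes the difference equal to `φ v` for a global v; coordinate p is the required identity.
  have h0 : (S.swap.mulφ F (m + 1)).app ⊤ (τ - ∑ i, (L i).app ⊤ (w i)) = 0 := by
    rw [map_sub, map_sum, sub_eq_zero]
    refine (congrArg (fun f => f.app ⊤ τ) (S.toSyz_ι F (m + 1)).symm).trans ?_
    refine (congrArg ((kernel.ι (S.mulφ F (m + 1 + 1))).app ⊤) hg).trans ?_
    refine (map_sum ((kernel.ι (S.mulφ F (m + 1 + 1))).app ⊤).hom _ _).trans ?_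
    exact Finset.sum_congr rfl fun i _ => hL i
  obtain ⟨w', hw'⟩ := exists_kernel_ι_app_eq _ ⊤ _ h0
  obtain ⟨v, rfl⟩ := (S.swap.isSES_syz F m).surjective_app_top
    (h.subsingleton_H_syz' 1 le_rfl hn m (by push_cast; ring)) w'
  have hv : (S.mulφ F m).app ⊤ v = τ - ∑ i, (L i).app ⊤ (w i) :=
    (congrArg (fun f => f.app ⊤ v) (S.swap.toSyz_ι F m).symm).trans hw'
  refine ⟨fun i => comps F (w i) p, comps F v, ?_⟩
  have h2 := congrArg (fun s => comps F s p) hv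
  have h3 (i : ι) : comps F ((L i).app ⊤ (w i)) p = (act F (hl i) (h1 m)).app ⊤
      (comps F (w i) p) :=
    congrArg (fun f => Scheme.Modules.Hom.app f ⊤ (w i))
      (biproduct.map_π (fun _ : κ => act F (hl i) (h1 m)) p)
  have h4 : comps F τ p = t := (hτ p).trans (if_pos rfl)
  have h5 : comps F ((S.mulφ F m).app ⊤ v) p = matAct F S.mem_φ (h1 m) (comps F v) p :=
    congrFun (comps_matHom F S.mem_φ (h1 m) v) p
  simp only [map_sub, map_sum, h3, h4, h5] at h2
  exact (sub_eq_iff_eq_add'.1 h2.symm).trans rfl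

end IsRegular
end ExactPair
end Regularity
end QuadricSheaf

namespace QuadricSheaf
open CategoryTheory Opposite TopologicalSpace Limits Abelian AlgebraicGeometry MonoidalCategory
open scoped TensorProduct

section LocSurj
variable {X : Scheme.{u}} {M N K : X.Modules}

lemma IsLocSurj.of_comp {f : M ⟶ N} {g : N ⟶ K} (h : IsLocSurj (f ≫ g)) : IsLocSurj g := by
  intro V s x hx
  obtain ⟨W, hW, hxW, t, ht⟩ := h V s x hx
  exact ⟨W, hW, hxW, f.app W t, ht⟩

lemma isIso_of_isLocSurj {f : M ⟶ N} (hf : ∀ V, Function.Injective (f.app V)) (h : IsLocSurj f) :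
    IsIso f := by
  refine isIso_of_bijective f fun V => ⟨hf V, fun s => ?_⟩
  choose W hW hxW t ht using fun x : V => h V s x x.2
  obtain ⟨t', ht'⟩ := exists_glue (M := M) W hW (fun x hx => ⟨⟨x, hx⟩, hxW ⟨x, hx⟩⟩) t fun x y =>
    hf _ (by rw [app_res, app_res, ht, ht, res_res, res_res])
  refine ⟨t', section_ext _ fun x hx => ⟨W ⟨x, hx⟩, hW _, hxW _, ?_⟩⟩
  rw [← app_res, ht', ht]

end LocSurj

/-! ### Tensor products with spinor bundles as matrix syzygies -/

noncomputable section Spinor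
attribute [local instance] Abelian.hasFiniteBiproducts
variable {A : Type u} [CommRing A] {σ : Type*} [SetLike σ A] [AddSubgroupClass σ A]
variable {𝒜 : ℕ → σ} [GradedRing 𝒜] (F : (Proj 𝒜).Modules)

section Twist
variable (m c : ℤ)

/-- The functor `G ↦ F(m) ⊗ G(c)`. -/
abbrev twTensor : (Proj 𝒜).Modules ⥤ (Proj 𝒜).Modules :=
  tensorRightMod (twist 𝒜 c) ⋙ tensorLeftMod (tw F m)

variable {m c} {d g e : ℤ} (h : d + c = g) (h' : m + g = e)

/-- The multiplication map of presheaves `(F ⊗ 𝒪(m)) ⊗ (𝒪(d) ⊗ 𝒪(c)) ⟶ F ⊗ 𝒪(e)`. -/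
def mulTwist : (toPMod F ⊗ toPMod (twist 𝒜 m)) ⊗ (toPMod (twist 𝒜 d) ⊗ toPMod (twist 𝒜 c)) ⟶
    toPMod F ⊗ toPMod (twist 𝒜 e) :=
  _ ◁ mulTensor h ≫ (α_ _ _ _).hom ≫ toPMod F ◁ mulTensor h'

lemma mulTwist_naturality {i : ℕ} {a : A} (ha : a ∈ 𝒜 i) {d₂ g₂ e₂ : ℤ} (h₂ : d₂ + c = g₂)
    (h₂' : m + g₂ = e₂) (hd : i + d = d₂) (he : i + e = e₂) :
    (toPMod F ⊗ toPMod (twist 𝒜 m)) ◁ (mulHomP ha hd ▷ toPMod (twist 𝒜 c)) ≫ mulTwist F h₂ h₂' =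
      mulTwist F h h' ≫ toPMod F ◁ mulHomP ha he := by
  have hg : i + g = g₂ := by omega
  have h1 := mulTensor_mulHom_left ha hd h h₂ hg
  have h3 := mulTensor_mulHom_right ha hg h' h₂' he
  have h2 := associator_naturality_right (toPMod F) (toPMod (twist 𝒜 m)) (mulHomP ha hg)
  rw [mulTwist, mulTwist, ← whiskerLeft_comp_assoc, h1, whiskerLeft_comp, Category.assoc,
    reassoc_of% h2, ← whiskerLeft_comp, h3]
  simp only [whiskerLeft_comp, Category.assoc]

variable (hA : ∀ x : Proj 𝒜, ∃ a ∈ 𝒜 1, x ∈ nonvanishing 𝒜 a)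
include hA

lemma isLocBij_mulTwist : IsLocBij (mulTwist F h h') ⊤ :=
  ((isLocBij_mulTensor h hA).whiskerLeft _).comp
    (IsLocBij.of_isIso.comp ((isLocBij_mulTensor h' hA).whiskerLeft _))

/-- The isomorphism `F(m) ⊗ 𝒪(d)(c) ≅ F(m + d + c)`. -/
def twTensorIso : (twTensor F m c).obj (twist 𝒜 d) ≅ tw F e :=
  (asIso (sheafifyTensor (toPMod F ⊗ toPMod (twist 𝒜 m))
    (toPMod (twist 𝒜 d) ⊗ toPMod (twist 𝒜 c)))).symm ≪≫
    @asIso _ _ _ _ ((sheafifyMod (Proj 𝒜)).map (mulTwist F h h')) (isLocBij_mulTwist F h h' hA).isIso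

/-- The isomorphisms respect multiplication by forms, so a matrix between sums of line bundles
induces the same matrix between sums of twists of F. -/
lemma twTensorIso_naturality {i : ℕ} {a : A} (ha : a ∈ 𝒜 i) {d₂ g₂ e₂ : ℤ} (h₂ : d₂ + c = g₂)
    (h₂' : m + g₂ = e₂) (hd : i + d = d₂) (he : i + e = e₂) :
    (twTensor F m c).map (mulHom ha hd) ≫ (twTensorIso F h₂ h₂' hA).hom =
      (twTensorIso F h h' hA).hom ≫ act F ha he := by
  have h1 := sheafifyTensor_naturality (toPMod F ⊗ toPMod (twist 𝒜 m))
    (mulHomP ha hd ▷ toPMod (twist 𝒜 c))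
  have h2 := congrArg (sheafifyMod (Proj 𝒜)).map (mulTwist_naturality F h h' ha h₂ h₂' hd he)
  rw [Functor.map_comp, Functor.map_comp] at h2
  refine (cancel_epi (sheafifyTensor (toPMod F ⊗ toPMod (twist 𝒜 m))
    (toPMod (twist 𝒜 d) ⊗ toPMod (twist 𝒜 c)))).1 ?_
  have h3 (d g e) (h : d + c = g) (h' : m + g = e) :
      sheafifyTensor (toPMod F ⊗ toPMod (twist 𝒜 m)) (toPMod (twist 𝒜 d) ⊗ toPMod (twist 𝒜 c)) ≫
        (twTensorIso F h h' hA).hom = (sheafifyMod (Proj 𝒜)).map (mulTwist F h h') :=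
    IsIso.hom_inv_id_assoc _ _
  refine (Category.assoc _ _ _).symm.trans ((congrArg (· ≫ _) h1).trans ?_)
  refine (Category.assoc _ _ _).trans ((congrArg (_ ≫ ·) (h3 _ _ _ h₂ h₂')).trans ?_)
  refine h2.trans ?_
  refine Eq.trans ?_ (Category.assoc _ _ _)
  exact congrArg (· ≫ act F ha he) (h3 _ _ _ h h').symm

end Twist
section Cokernel
variable {κ : Type} [Fintype κ]

/-- The map `𝒪(d)ᴺ ⟶ 𝒪(d + 1)ᴺ` given by a matrix of elements of degree one. -/
def twistMatrix {P : Matrix κ κ A} (hP : ∀ i j, P i j ∈ 𝒜 1) {d d' : ℤ}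
    (h : ((1 : ℕ) : ℤ) + d = d') : (⨁ fun _ : κ => twist 𝒜 d) ⟶ ⨁ fun _ : κ => twist 𝒜 d' :=
  biproduct.matrix (f := fun _ : κ => twist 𝒜 d) (g := fun _ : κ => twist 𝒜 d')
    fun j i => mulHom (hP i j) h

lemma ι_twistMatrix_π {P : Matrix κ κ A} (hP : ∀ i j, P i j ∈ 𝒜 1) {d d' : ℤ}
    (h : ((1 : ℕ) : ℤ) + d = d') (i j : κ) :
    biproduct.ι _ j ≫ twistMatrix hP h ≫ biproduct.π _ i = mulHom (hP i j) h := by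
  simp [twistMatrix]

lemma twistMatrix_comp {P Q : Matrix κ κ A} (hP : ∀ i j, P i j ∈ 𝒜 1) (hQ : ∀ i j, Q i j ∈ 𝒜 1)
    (hQP : Q * P = 0) {d d' d'' : ℤ} (h : ((1 : ℕ) : ℤ) + d = d') (h' : ((1 : ℕ) : ℤ) + d' = d'') :
    twistMatrix hP h ≫ twistMatrix hQ h' = 0 := by
  refine biproduct.hom_ext _ _ fun i => biproduct.hom_ext' _ _ fun j => ?_
  have h0 : ((2 : ℕ) : ℤ) + d = d'' := by push_cast at *; omega
  have h1 := mulHom_eq_sum Finset.univ (fun p => hP p j) (fun p => hQ i p) (zero_mem (𝒜 2))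
    (by rw [← Matrix.mul_apply, hQP]; rfl) h h' h0
  rw [mulHom_zero _ rfl] at h1
  simp only [zero_comp, comp_zero, Category.assoc, twistMatrix, biproduct.matrix_π,
    biproduct.ι_matrix_assoc, biproduct.lift_desc]
  exact h1.symm

namespace ExactPair
variable [DecidableEq κ] (S : ExactPair 𝒜 κ)

/-- The cokernel of the first matrix. -/
def coker : (Proj 𝒜).Modules :=
  cokernel (twistMatrix S.mem_φ (show ((1 : ℕ) : ℤ) + (-1) = 0 by norm_num))

/-- The projection to the cokernel of the first matrix. -/
def cokerπ : (⨁ fun _ : κ => twist 𝒜 0) ⟶ S.coker := cokernel.π _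

instance : Epi S.cokerπ := inferInstanceAs (Epi (cokernel.π _))

/-- The map from the cokernel of the first matrix given by the second matrix. -/
def cokerDesc : S.coker ⟶ ⨁ fun _ : κ => twist 𝒜 1 :=
  cokernel.desc _ (twistMatrix S.mem_ψ (show ((1 : ℕ) : ℤ) + 0 = 1 by norm_num))
    (twistMatrix_comp _ _ S.ψ_mul_φ _ _)

lemma cokerπ_desc : S.cokerπ ≫ S.cokerDesc =
    twistMatrix S.mem_ψ (show ((1 : ℕ) : ℤ) + 0 = 1 by norm_num) := cokernel.π_desc _ _ _

lemma twistMatrix_cokerπ :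
    twistMatrix S.mem_φ (show ((1 : ℕ) : ℤ) + (-1) = 0 by norm_num) ≫ S.cokerπ = 0 :=
  cokernel.condition _

variable (hA : ∀ x : Proj 𝒜, ∃ a ∈ 𝒜 1, x ∈ nonvanishing 𝒜 a) {m c e : ℤ} (he : m + (-1 + c) = e)
include hA he

/-- The map from `F(e + 1)ᴺ` to the twisted tensor product of `F` with the cokernel. -/
def toTensorCoker : (⨁ fun _ : κ => tw F (e + 1)) ⟶ (twTensor F m c).obj S.coker :=
  biproduct.desc fun j =>
    (twTensorIso F (c := c) (d := 0) rfl (show m + (0 + c) = e + 1 by omega) hA).inv ≫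
      (twTensor F m c).map (biproduct.ι (fun _ : κ => twist 𝒜 0) j ≫ S.cokerπ)

/-- The map from the twisted tensor product of `F` with the cokernel to `F(e + 2)ᴺ`. -/
def ofTensorCoker : (twTensor F m c).obj S.coker ⟶ ⨁ fun _ : κ => tw F (e + 1 + 1) :=
  biproduct.lift fun i =>
    (twTensor F m c).map (S.cokerDesc ≫ biproduct.π (fun _ : κ => twist 𝒜 1) i) ≫
      (twTensorIso F (c := c) (d := 1) rfl (show m + (1 + c) = e + 1 + 1 by omega) hA).hom

lemma toTensorCoker_ofTensorCoker :
    S.toTensorCoker F hA he ≫ S.ofTensorCoker F hA he = S.swap.mulφ F (e + 1) := by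
  refine biproduct.hom_ext _ _ fun i => biproduct.hom_ext' _ _ fun j => ?_
  have h1 : (biproduct.ι (fun _ : κ => twist 𝒜 0) j ≫ S.cokerπ) ≫
      S.cokerDesc ≫ biproduct.π (fun _ : κ => twist 𝒜 1) i = mulHom (S.mem_ψ i j)
        (show ((1 : ℕ) : ℤ) + 0 = 1 by norm_num) := by
    rw [Category.assoc, ← Category.assoc S.cokerπ, cokerπ_desc]
    exact ι_twistMatrix_π _ _ _ _
  have h2 := twTensorIso_naturality F (c := c) (d := 0) rfl (show m + (0 + c) = e + 1 by omega) hA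
    (S.mem_ψ i j) (d₂ := 1) rfl (show m + (1 + c) = e + 1 + 1 by omega)
    (show ((1 : ℕ) : ℤ) + 0 = 1 by norm_num)
    (show ((1 : ℕ) : ℤ) + (e + 1) = e + 1 + 1 by push_cast; ring)
  simp only [toTensorCoker, ofTensorCoker, matHom, Category.assoc, biproduct.lift_π,
    biproduct.ι_desc_assoc, biproduct.ι_desc]
  rw [Iso.inv_comp_eq, ← Functor.map_comp_assoc, h1, h2]
  rfl

lemma mulφ_toTensorCoker : S.mulφ F e ≫ S.toTensorCoker F hA he = 0 := by
  refine biproduct.hom_ext' _ _ fun j => ?_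
  have h2 (i : κ) := twTensorIso_naturality F (c := c) (d := -1) rfl he hA
    (S.mem_φ i j) (d₂ := 0) rfl (show m + (0 + c) = e + 1 by omega)
    (show ((1 : ℕ) : ℤ) + (-1) = 0 by norm_num)
    (show ((1 : ℕ) : ℤ) + e = e + 1 by push_cast; ring)
  have h3 (i : κ) : act F (S.mem_φ i j) (show ((1 : ℕ) : ℤ) + e = e + 1 by push_cast; ring) ≫
      (twTensorIso F (c := c) (d := 0) rfl (show m + (0 + c) = e + 1 by omega) hA).inv ≫
      (twTensor F m c).map (biproduct.ι (fun _ : κ => twist 𝒜 0) i ≫ S.cokerπ) =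
      (twTensorIso F (c := c) (d := -1) rfl he hA).inv ≫ (twTensor F m c).map
        (mulHom (S.mem_φ i j) (show ((1 : ℕ) : ℤ) + (-1) = 0 by norm_num) ≫
          biproduct.ι (fun _ : κ => twist 𝒜 0) i ≫ S.cokerπ) := by
    rw [Functor.map_comp _ (mulHom _ _), ← Category.assoc, ← Category.assoc]
    congr 1
    rw [Iso.comp_inv_eq, Category.assoc, h2, Iso.inv_hom_id_assoc]
  have h4 : ∑ i, mulHom (S.mem_φ i j) (show ((1 : ℕ) : ℤ) + (-1) = 0 by norm_num) ≫
      biproduct.ι (fun _ : κ => twist 𝒜 0) i ≫ S.cokerπ = 0 := by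
    have := congrArg (biproduct.ι (fun _ : κ => twist 𝒜 (-1)) j ≫ ·) S.twistMatrix_cokerπ
    simp only [twistMatrix, comp_zero, biproduct.ι_matrix_assoc] at this
    rw [← this, biproduct.lift_eq, Preadditive.sum_comp]
    simp only [Category.assoc]
  have h5 := congrArg (twTensor F m c).map h4
  rw [Functor.map_sum, Functor.map_zero] at h5
  rw [comp_zero, ← Category.assoc]
  have h6 : biproduct.ι (fun _ : κ => tw F e) j ≫ S.mulφ F e = biproduct.lift fun i =>
      act F (S.mem_φ i j) (show ((1 : ℕ) : ℤ) + e = e + 1 by push_cast; ring) :=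
    biproduct.hom_ext _ _ fun i => by simp [matHom]
  rw [h6, toTensorCoker, biproduct.lift_desc, Finset.sum_congr rfl fun i _ => h3 i,
    ← Preadditive.comp_sum, h5, comp_zero]

/-- Tensoring preserves the surjectivity of the projection to the cokernel, and the tensored
projection factors through this map. -/
lemma isLocSurj_toTensorCoker : IsLocSurj (S.toTensorCoker F hA he) := by
  have h1 : IsLocSurj ((twTensor F m c).map S.cokerπ) :=
    ((isLocSurj_of_epi S.cokerπ).tensorRightMod_map _).tensorLeftMod_map _
  have h2 : (twTensor F m c).map S.cokerπ = (biproduct.lift fun j =>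
      (twTensor F m c).map (biproduct.π (fun _ : κ => twist 𝒜 0) j) ≫
        (twTensorIso F (c := c) (d := 0) rfl (show m + (0 + c) = e + 1 by omega) hA).hom) ≫
      S.toTensorCoker F hA he := by
    rw [toTensorCoker, biproduct.lift_desc]
    simp only [Category.assoc, Iso.hom_inv_id_assoc, ← Functor.map_comp]
    rw [← Functor.map_sum]
    congr 1
    simp only [← Category.assoc]
    rw [← Preadditive.sum_comp, biproduct.total, Category.id_comp]
  rw [h2] at h1
  exact h1.of_comp

lemma ofTensorCoker_mulφ : S.ofTensorCoker F hA he ≫ S.mulφ F (e + 1 + 1) = 0 :=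
  modulesHom_ext fun V s => section_ext _ fun x hx => by
    obtain ⟨W, hW, hxW, t, ht⟩ := S.isLocSurj_toTensorCoker F hA he V s x hx
    refine ⟨W, hW, hxW, ?_⟩
    rw [← app_res, ← app_res, ← ht, ← comp_app_apply, ← Category.assoc,
      toTensorCoker_ofTensorCoker, swap_mulφ_comp]
    rfl

/-- The twisted tensor product of `F` with the cokernel as the kernel of the first matrix. -/
def tensorCokerToSyz : (twTensor F m c).obj S.coker ⟶ S.syz F (e + 1 + 1) :=
  kernel.lift _ (S.ofTensorCoker F hA he) (S.ofTensorCoker_mulφ F hA he)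

lemma tensorCokerToSyz_ι : S.tensorCokerToSyz F hA he ≫ kernel.ι (S.mulφ F (e + 1 + 1)) =
    S.ofTensorCoker F hA he := kernel.lift_ι _ _ _

lemma toTensorCoker_toSyz :
    S.toTensorCoker F hA he ≫ S.tensorCokerToSyz F hA he = S.toSyz F (e + 1) :=
  (cancel_mono (kernel.ι _)).1 (by
    rw [Category.assoc, tensorCokerToSyz_ι, toSyz_ι, toTensorCoker_ofTensorCoker])

/-- The map `toSyz` from F(e+1)^N factors as a surjection onto the tensor product followed by this
map. Since `toSyz` is surjective, so is this map. The kernel of `toSyz` is locally the image of `φ`,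
which already dies in the tensor product, so this map is injective. -/
lemma isIso_tensorCokerToSyz : IsIso (S.tensorCokerToSyz F hA he) := by
  refine isIso_of_isLocSurj (fun V => ?_) (IsLocSurj.of_comp (f := S.toTensorCoker F hA he) ?_)
  · rw [injective_iff_map_eq_zero]
    intro s hs
    refine section_ext _ fun x hx => ?_
    obtain ⟨W, hW, hxW, t, ht⟩ := S.isLocSurj_toTensorCoker F hA he V s x hx
    have h0 : (S.toSyz F (e + 1)).app W t = 0 := by
      rw [← toTensorCoker_toSyz F S hA he, comp_app_apply, ht, app_res, hs, map_zero]
    obtain ⟨t', rfl⟩ := (S.isSES_syz F (e + 1)).exact W t h0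
    obtain ⟨W', hW', hxW', w, hw⟩ := S.swap.isLocSurj_toSyz F e W t' x hxW
    refine ⟨W', hW'.trans hW, hxW', ?_⟩
    rw [map_zero, ← res_res (M := (twTensor F m c).obj S.coker) hW' hW, ← ht, ← app_res, ← app_res,
      ← hw]
    refine (congrArg (fun f => (S.toTensorCoker F hA he).app W' (f.app W' w))
      (S.swap.toSyz_ι F e)).trans ?_
    exact congrArg (fun f => f.app W' w) (S.mulφ_toTensorCoker F hA he)
  · rw [toTensorCoker_toSyz]
    exact S.isLocSurj_toSyz F _

lemma subsingleton_H_coker_iff {i : ℕ} : Subsingleton (H i ((twTensor F m c).obj S.coker)) ↔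
    Subsingleton (H i (S.syz F (e + 1 + 1))) :=
  have := S.isIso_tensorCokerToSyz F hA he
  ⟨subsingleton_H_of_iso (asIso (S.tensorCokerToSyz F hA he)),
    subsingleton_H_of_iso (asIso (S.tensorCokerToSyz F hA he)).symm⟩

end ExactPair
end Cokernel
end Spinor
end QuadricSheaf

namespace QuadricSheaf
open CategoryTheory Opposite TopologicalSpace Limits Abelian AlgebraicGeometry MonoidalCategory

/-! ### Linear forms and homotopies on a smooth quadric -/

noncomputable section Quadric
attribute [local instance] MvPolynomial.gradedAlgebra Abelian.hasFiniteBiproducts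
variable {k : Type u} [Field k] {n : ℕ}

namespace SmoothQuadric
variable (Q : SmoothQuadric k n)

lemma form_ne_zero : Q.form ≠ 0 := by
  intro h
  have := Q.smooth 1 (by simp [h]) fun i => by simp [h]
  exact one_ne_zero (congrFun this 0)

/-- A matrix with coefficients in the coordinate ring. -/
abbrev toCoordRing {κ : Type} (P : Matrix κ κ (MvPolynomial (Fin (n + 2)) k)) : Matrix κ κ Q.coordRing :=
  P.map (Ideal.Quotient.mk (Ideal.span {Q.form}))

lemma toCoordRing_mul {κ : Type} [Fintype κ]
    (P P' : Matrix κ κ (MvPolynomial (Fin (n + 2)) k)) :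
    Q.toCoordRing (P * P') = Q.toCoordRing P * Q.toCoordRing P' := Matrix.map_mul

lemma toCoordRing_smul_one {κ : Type} [DecidableEq κ]
    (p : MvPolynomial (Fin (n + 2)) k) :
    Q.toCoordRing (p • (1 : Matrix κ κ _)) =
      Ideal.Quotient.mk (Ideal.span {Q.form}) p • (1 : Matrix κ κ _) := by
  ext i j
  by_cases h : i = j <;> simp [h]

/-- The Leibniz rule for matrices. Applied to `φψ = q` it provides the local homotopies. -/
lemma pderiv_mul {κ : Type} [Fintype κ] [DecidableEq κ]
    {P P' : Matrix κ κ (MvPolynomial (Fin (n + 2)) k)} {p : MvPolynomial (Fin (n + 2)) k}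
    (h : P * P' = p • (1 : Matrix κ κ _)) (i : Fin (n + 2)) :
    P * P'.map (MvPolynomial.pderiv i) + P.map (MvPolynomial.pderiv i) * P' =
      MvPolynomial.pderiv i p • (1 : Matrix κ κ _) := by
  refine Matrix.ext fun a b => ?_
  have := congrArg (MvPolynomial.pderiv i) (congrFun (congrFun h a) b)
  simp only [Matrix.mul_apply, map_sum, Derivation.leibniz, smul_eq_mul] at this
  simp only [Matrix.add_apply, Matrix.mul_apply, Matrix.map_apply]
  rw [← Finset.sum_add_distrib]
  refine Eq.trans (Finset.sum_congr rfl fun c _ => ?_) (this.trans ?_)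
  · ring
  · by_cases hab : a = b <;> simp [hab]

variable [IsAlgClosed k]

/-- Passage from common zeros in affine space to points of Proj. A prime containing q and all the g
i would contain every variable by the Nullstellensatz, hence the irrelevant ideal. -/
lemma exists_mem_nonvanishing {ι : Type*} (g : ι → MvPolynomial (Fin (n + 2)) k)
    (hg : ∀ v : Fin (n + 2) → k, MvPolynomial.eval v Q.form = 0 →
      (∀ i, MvPolynomial.eval v (g i) = 0) → v = 0) (x : Proj Q.grading) :
    ∃ i, x ∈ nonvanishing Q.grading (Ideal.Quotient.mk (Ideal.span {Q.form}) (g i)) := by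
  by_contra! H
  let P : Ideal (MvPolynomial (Fin (n + 2)) k) :=
    (idealAt Q.grading x).comap (Ideal.Quotient.mk (Ideal.span {Q.form}))
  have hx : (idealAt Q.grading x).IsPrime := ProjectiveSpectrum.isPrime (𝒜 := Q.grading) x
  have hP : P.IsPrime := hx.comap _
  have hX (j : Fin (n + 2)) : MvPolynomial.X j ∈ P := by
    have hI : Ideal.span (insert Q.form (Set.range g)) ≤ P := by
      rw [Ideal.span_le]
      rintro _ (rfl | ⟨i, rfl⟩)
      · refine Ideal.mem_comap.2 ?_
        rw [Ideal.Quotient.eq_zero_iff_mem.2 (Ideal.mem_span_singleton_self _)]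
        exact zero_mem _
      · exact not_not.1 (H i)
    refine (hP.radical_le_iff.2 hI) ?_
    rw [← MvPolynomial.vanishingIdeal_zeroLocus_eq_radical (K := k), MvPolynomial.mem_vanishingIdeal_iff]
    intro v hv
    rw [MvPolynomial.zeroLocus_span] at hv
    have h0 := hg v (by simpa using hv _ (Set.mem_insert _ _)) fun i => by
      simpa using hv _ (Set.mem_insert_of_mem _ ⟨i, rfl⟩)
    simp [h0]
  obtain ⟨j, _, ⟨p, hp, rfl⟩, hj, hpx⟩ := exists_denominator Q.grading x 1
  refine hpx ?_
  -- A form of positive degree has no constant term; the lower bound 1 on the degree of p is what is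
  -- needed.
  have h1 : p ∈ Ideal.span (MvPolynomial.X '' (Set.univ : Set (Fin (n + 2)))) := by
    rw [MvPolynomial.mem_ideal_span_X_image]
    intro d hd
    by_contra! hd0
    have : d = 0 := Finsupp.ext fun i => hd0 i trivial
    have h2 := MvPolynomial.IsHomogeneous.degree_eq_sum_deg_support hp hd
    rw [this] at h2
    simp at h2
    omega
  have h2 : Ideal.span (MvPolynomial.X '' (Set.univ : Set (Fin (n + 2)))) ≤ P := by
    rw [Ideal.span_le]
    rintro _ ⟨i, -, rfl⟩
    exact hX i
  exact h2 h1

/-- There are `n + 1` linear forms without common zero on the quadric. -/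
lemma exists_linear_forms : ∃ l : Fin (n + 1) → MvPolynomial (Fin (n + 2)) k,
    (∀ i, (l i).IsHomogeneous 1) ∧ ∀ v : Fin (n + 2) → k, MvPolynomial.eval v Q.form = 0 →
      (∀ i, MvPolynomial.eval v (l i) = 0) → v = 0 := by
  -- The forms define the projection from a point p off the quadric. Their common zeros are the
  -- multiples of p, and q(c p) = c² q(p) vanishes only for c = 0.
  obtain ⟨p, hp⟩ : ∃ p, MvPolynomial.eval p Q.form ≠ 0 := by
    by_contra! h
    exact Q.form_ne_zero (MvPolynomial.funext fun x => by simp [h])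
  have hsmul (c : k) : MvPolynomial.eval (c • p) Q.form = c ^ 2 * MvPolynomial.eval p Q.form := by
    rw [MvPolynomial.eval_eq, MvPolynomial.eval_eq, Finset.mul_sum]
    refine Finset.sum_congr rfl fun d hd => ?_
    refine Eq.trans ?_ (congrArg (fun e => c ^ e * (Q.form.coeff d * ∏ i ∈ d.support, p i ^ d i))
      (MvPolynomial.IsHomogeneous.degree_eq_sum_deg_support Q.isHomogeneous hd)).symm
    rw [← Finset.prod_pow_eq_pow_sum, mul_left_comm, ← Finset.prod_mul_distrib]
    simp only [Pi.smul_apply, smul_eq_mul, mul_pow]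
  obtain ⟨i, hi⟩ : ∃ i, p i ≠ 0 := by
    by_contra! h
    have h1 := hsmul 0
    rw [zero_smul, ← (show p = 0 from funext h)] at h1
    exact hp (by rw [h1]; simp)
  refine ⟨fun j => MvPolynomial.C (p i) * MvPolynomial.X (i.succAbove j) -
    MvPolynomial.C (p (i.succAbove j)) * MvPolynomial.X i, fun j =>
      (MvPolynomial.isHomogeneous_C_mul_X _ _).sub (MvPolynomial.isHomogeneous_C_mul_X _ _),
    fun v hv hl => ?_⟩
  have h1 : v = (v i / p i) • p := by
    funext j
    rcases Fin.eq_self_or_eq_succAbove i j with rfl | ⟨j, rfl⟩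
    · simp [hi]
    · have := hl j
      simp only [map_sub, map_mul, MvPolynomial.eval_C, MvPolynomial.eval_X] at this
      simp only [Pi.smul_apply, smul_eq_mul]
      field_simp
      linear_combination this
  rw [h1, hsmul, mul_eq_zero, or_iff_left hp] at hv
  rw [h1, pow_eq_zero_iff two_ne_zero |>.1 hv, zero_smul]

namespace SpinorFactorization
variable {Q} (S : Q.SpinorFactorization)

/-- The pair of matrices over the coordinate ring given by a spinor factorization. -/
def toExactPair : ExactPair Q.grading (Fin (2 ^ ((n + 1) / 2))) where
  φ := Q.toCoordRing S.φ
  ψ := Q.toCoordRing S.ψ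
  mem_φ i j := Q.mk_mem_grading (S.linear_φ i j)
  mem_ψ i j := Q.mk_mem_grading (S.linear_ψ i j)
  φ_mul_ψ := by
    rw [← Q.toCoordRing_mul, S.φ_mul_ψ, toCoordRing_smul_one,
      Ideal.Quotient.eq_zero_iff_mem.2 (Ideal.mem_span_singleton_self _)]
    exact Matrix.ext fun i j => zero_mul _
  ψ_mul_φ := by
    rw [← Q.toCoordRing_mul, S.ψ_mul_φ, toCoordRing_smul_one,
      Ideal.Quotient.eq_zero_iff_mem.2 (Ideal.mem_span_singleton_self _)]
    exact Matrix.ext fun i j => zero_mul _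
  exists_homotopy x := by
    -- Smoothness supplies a partial derivative of q that does not vanish at x; the homotopies are
    -- the corresponding derivatives of `φ` and `ψ`, which have constant entries.
    obtain ⟨i, hi⟩ := Q.exists_mem_nonvanishing (fun i => MvPolynomial.pderiv i Q.form) Q.smooth x
    have h1 {p : MvPolynomial (Fin (n + 2)) k} (hp : p.IsHomogeneous 1) :
        Ideal.Quotient.mk (Ideal.span {Q.form}) (MvPolynomial.pderiv i p) ∈ Q.grading 0 :=
      Q.mk_mem_grading hp.pderiv
    refine ⟨_, Q.mk_mem_grading (MvPolynomial.IsHomogeneous.pderiv (n := 2) Q.isHomogeneous), hi,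
      Q.toCoordRing (S.φ.map (MvPolynomial.pderiv i)),
      Q.toCoordRing (S.ψ.map (MvPolynomial.pderiv i)), fun a b => h1 (S.linear_φ a b),
      fun a b => h1 (S.linear_ψ a b), ?_, ?_⟩
    · rw [← Q.toCoordRing_smul_one, ← pderiv_mul S.φ_mul_ψ i, ← toCoordRing_mul, ← toCoordRing_mul]
      exact (Matrix.map_add _ (map_add _) _ _).symm
    · rw [← Q.toCoordRing_smul_one, ← pderiv_mul S.ψ_mul_φ i, ← toCoordRing_mul, ← toCoordRing_mul]
      exact (Matrix.map_add _ (map_add _) _ _).symm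

/-- The factorization with the two matrices exchanged. -/
def swap : Q.SpinorFactorization where
  φ := S.ψ
  ψ := S.φ
  linear_φ := S.linear_ψ
  linear_ψ := S.linear_φ
  φ_mul_ψ := S.ψ_mul_φ
  ψ_mul_φ := S.φ_mul_ψ

end SpinorFactorization
end SmoothQuadric
end Quadric
end QuadricSheaf

namespace QuadricSheaf

/-! ### Existence of spinor factorizations -/

section QuadraticForms
variable {k : Type*} [Field k] {R : Type*} [CommRing R] [Algebra k R]

/-- `q` is a sum of `r` products of elements of `W`. -/
def IsSumOfProducts (W : Submodule k R) (r : ℕ) (q : R) : Prop :=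
  ∃ a b : Fin r → R, (∀ i, a i ∈ W) ∧ (∀ i, b i ∈ W) ∧ q = ∑ i, a i * b i

namespace IsSumOfProducts
variable {W W' : Submodule k R} {r : ℕ} {q : R}

lemma mono (h : IsSumOfProducts W r q) (hW : W ≤ W') : IsSumOfProducts W' r q := by
  obtain ⟨a, b, ha, hb, rfl⟩ := h
  exact ⟨a, b, fun i => hW (ha i), fun i => hW (hb i), rfl⟩

lemma mul_add (h : IsSumOfProducts W r q) {c d : R} (hc : c ∈ W) (hd : d ∈ W) :
    IsSumOfProducts W (r + 1) (c * d + q) := by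
  obtain ⟨a, b, ha, hb, rfl⟩ := h
  refine ⟨Fin.cons c a, Fin.cons d b, Fin.cases hc ha, Fin.cases hd hb, ?_⟩
  rw [Fin.sum_univ_succ]
  simp

lemma of_le {s : ℕ} (h : IsSumOfProducts W r q) (hrs : r ≤ s) : IsSumOfProducts W s q := by
  induction s, hrs using Nat.le_induction with
  | base => exact h
  | succ s _ ih => simpa using ih.mul_add (zero_mem W) (zero_mem W)

end IsSumOfProducts

/-- A quadratic form is expanded in powers of one variable y, with coefficients in the remaining
ones. -/
lemma exists_eq_add_of_mem_mul {W W' : Submodule k R} {y q : R} (hW : W ≤ k ∙ y ⊔ W')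
    (hq : q ∈ W * W) : ∃ (c : k) (m : R) (q' : R), m ∈ W' ∧ q' ∈ W' * W' ∧
      q = c • y * y + y * m + q' := by
  induction hq using Submodule.mul_induction_on' with
  | mem_mul_mem a ha b hb =>
    obtain ⟨_, hα, a', ha', rfl⟩ := Submodule.mem_sup.1 (hW ha)
    obtain ⟨_, hβ, b', hb', rfl⟩ := Submodule.mem_sup.1 (hW hb)
    obtain ⟨α, rfl⟩ := Submodule.mem_span_singleton.1 hα
    obtain ⟨β, rfl⟩ := Submodule.mem_span_singleton.1 hβ
    refine ⟨α * β, α • b' + β • a', a' * b', add_mem (W'.smul_mem _ hb') (W'.smul_mem _ ha'),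
      Submodule.mul_mem_mul ha' hb', ?_⟩
    simp only [Algebra.smul_def, map_mul]
    ring
  | add a _ b _ ha hb =>
    obtain ⟨c, m, q', hm, hq', rfl⟩ := ha
    obtain ⟨c', m', q'', hm', hq'', rfl⟩ := hb
    refine ⟨c + c', m + m', q' + q'', add_mem hm hm', add_mem hq' hq'', ?_⟩
    simp only [Algebra.smul_def, map_add]
    ring

lemma span_range_cons {M : ℕ} (y : R) (v : Fin M → R) :
    Submodule.span k (Set.range (Fin.cons y v : Fin (M + 1) → R)) =
      k ∙ y ⊔ Submodule.span k (Set.range v) := by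
  rw [Fin.range_cons, Submodule.span_insert]

/-- A quadratic form in at least two variables over an algebraically closed field has a nontrivial
zero. -/
lemma exists_isotropic [IsAlgClosed k] {M : ℕ} {y : Fin (M + 2) → R} {q : R}
    (hq : q ∈ Submodule.span k (Set.range y) * Submodule.span k (Set.range y)) :
    ∃ (w : R) (y' : Fin (M + 1) → R) (m q' : R), w ∈ Submodule.span k (Set.range y) ∧
      Submodule.span k (Set.range y') ≤ Submodule.span k (Set.range y) ∧
      m ∈ Submodule.span k (Set.range y') ∧
      q' ∈ Submodule.span k (Set.range y') * Submodule.span k (Set.range y') ∧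
      q = w * m + q' := by
  obtain ⟨y₀, y, rfl⟩ : ∃ a v, y = Fin.cons a v := ⟨y 0, Fin.tail y, (Fin.cons_self_tail y).symm⟩
  obtain ⟨y₁, v, rfl⟩ : ∃ a v, y = Fin.cons a v := ⟨y 0, Fin.tail y, (Fin.cons_self_tail y).symm⟩
  obtain ⟨c, m, q', hm, hq', rfl⟩ := exists_eq_add_of_mem_mul (span_range_cons y₀ _).le hq
  have hmem₀ : y₀ ∈ Submodule.span k (Set.range (Fin.cons y₀ (Fin.cons y₁ v) : Fin (M + 2) → R)) :=
    Submodule.subset_span ⟨0, rfl⟩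
  have hmem₁ : y₁ ∈ Submodule.span k (Set.range (Fin.cons y₀ (Fin.cons y₁ v) : Fin (M + 2) → R)) :=
    Submodule.subset_span ⟨1, rfl⟩
  by_cases hc : c = 0
  · refine ⟨y₀, Fin.cons y₁ v, m, q', hmem₀, ?_, hm, hq', by simp [hc]⟩
    rw [span_range_cons y₀]
    exact le_sup_right
  obtain ⟨e, m', q'', hm', hq'', rfl⟩ := exists_eq_add_of_mem_mul (span_range_cons y₁ v).le hq'
  rw [span_range_cons] at hm
  obtain ⟨_, hd, m₀, hm₀, rfl⟩ := Submodule.mem_sup.1 hm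
  obtain ⟨d, rfl⟩ := Submodule.mem_span_singleton.1 hd
  -- The polynomial is the restriction of q to the first two variables at (s, 1). In the coordinates
  -- z = y₀ - s y₁ and y₁ the coefficient of y₁² is this value, so q becomes linear in y₁.
  obtain ⟨s, hs⟩ : ∃ s : k, c * s ^ 2 + d * s + e = 0 := by
    have h1 : (Polynomial.C c * Polynomial.X ^ 2 + Polynomial.C d * Polynomial.X +
        Polynomial.C e).degree = 2 := Polynomial.degree_quadratic hc
    obtain ⟨s, hs⟩ := IsAlgClosed.exists_root _ (h1.trans_ne two_ne_zero)
    exact ⟨s, by simpa using hs⟩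
  let z := y₀ - s • y₁
  have hz : z ∈ Submodule.span k (Set.range (Fin.cons z v : Fin (M + 1) → R)) :=
    Submodule.subset_span ⟨0, rfl⟩
  have hv : Submodule.span k (Set.range v) ≤
      Submodule.span k (Set.range (Fin.cons z v : Fin (M + 1) → R)) := by
    rw [span_range_cons]
    exact le_sup_right
  refine ⟨y₁, Fin.cons z v, (2 * c * s + d) • z + s • m₀ + m', c • z * z + z * m₀ + q'', hmem₁, ?_,
    add_mem (add_mem (Submodule.smul_mem _ _ hz) (Submodule.smul_mem _ _ (hv hm₀))) (hv hm'),
    add_mem (add_mem (Submodule.mul_mem_mul (Submodule.smul_mem _ _ hz) hz)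
      (Submodule.mul_mem_mul hz (hv hm₀))) (mul_le_mul' hv hv hq''), ?_⟩
  · rw [span_range_cons, sup_le_iff, Submodule.span_singleton_le_iff_mem]
    refine ⟨sub_mem hmem₀ (Submodule.smul_mem _ _ hmem₁), Submodule.span_mono ?_⟩
    rintro _ ⟨i, rfl⟩
    exact ⟨i.succ.succ, rfl⟩
  · have hs' := congrArg (algebraMap k R) hs
    simp only [map_add, map_mul, map_pow, map_zero] at hs'
    simp only [z, Algebra.smul_def, map_add, map_mul, map_ofNat]
    linear_combination y₁ ^ 2 * hs'

/-- An isotropic direction is split off: q = w m + q' with m and q' free of w. If m is nonzero as a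
form it is taken as one of the remaining variables, and collecting its multiples gives one product
plus a form in M variables. No diagonalization occurs, so characteristic two is included. -/
lemma isSumOfProducts_of_mem_mul [IsAlgClosed k] (M : ℕ) : ∀ {y : Fin M → R} {q : R}
    (_ : q ∈ Submodule.span k (Set.range y) * Submodule.span k (Set.range y)),
    IsSumOfProducts (Submodule.span k (Set.range y)) ((M + 1) / 2) q := by
  induction M using Nat.strong_induction_on with
  | _ M ih =>
    intro y q hq
    match M with
    | 0 =>
      refine ⟨0, 0, fun i => zero_mem _, fun i => zero_mem _, ?_⟩
      simpa [Set.range_eq_empty] using hq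
    | 1 =>
      have hy : Submodule.span k (Set.range y) ≤ k ∙ y 0 ⊔ ⊥ := by
        rw [sup_bot_eq, Submodule.span_le]
        rintro _ ⟨i, rfl⟩
        rw [Subsingleton.elim i 0]
        exact Submodule.mem_span_singleton_self _
      obtain ⟨c, m, q', hm, hq', rfl⟩ := exists_eq_add_of_mem_mul hy hq
      have h0 : y 0 ∈ Submodule.span k (Set.range y) := Submodule.subset_span ⟨0, rfl⟩
      refine ⟨fun _ => c • y 0, fun _ => y 0, fun _ => Submodule.smul_mem _ _ h0, fun _ => h0, ?_⟩
      rw [Submodule.mem_bot] at hm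
      rw [Submodule.bot_mul, Submodule.mem_bot] at hq'
      simp [hm, hq']
    | M + 2 =>
      obtain ⟨w, y', m, q', hw, hy', hm, hq', rfl⟩ := exists_isotropic hq
      obtain ⟨μ, hμ⟩ := (Submodule.mem_span_range_iff_exists_fun k).1 hm
      -- If the coefficients of m vanish, w has disappeared and q involves only M + 1 elements;
      -- otherwise one product accounts for the loss of two.
      by_cases h0 : μ = 0
      · have hm0 : m = 0 := by rw [← hμ, h0]; simp
        rw [hm0, mul_zero, zero_add]
        exact ((ih (M + 1) (by omega) hq').mono hy').of_le (by omega)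
      · obtain ⟨i, hi⟩ := Function.ne_iff.1 h0
        have hle : Submodule.span k (Set.range y') ≤
            k ∙ m ⊔ Submodule.span k (Set.range fun j => y' (i.succAbove j)) := by
          have h1 (j) : y' (i.succAbove j) ∈
              k ∙ m ⊔ Submodule.span k (Set.range fun j => y' (i.succAbove j)) :=
            Submodule.mem_sup_right (Submodule.subset_span ⟨j, rfl⟩)
          rw [Submodule.span_le]
          rintro _ ⟨j, rfl⟩
          rcases Fin.eq_self_or_eq_succAbove i j with rfl | ⟨j, rfl⟩
          · rw [Fin.sum_univ_succAbove _ j] at hμ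
            have h2 : y' j = (μ j)⁻¹ • (m - ∑ a, μ (j.succAbove a) • y' (j.succAbove a)) := by
              rw [← hμ, add_sub_cancel_right, smul_smul, inv_mul_cancel₀ hi, one_smul]
            rw [h2]
            exact Submodule.smul_mem _ _ (sub_mem
              (Submodule.mem_sup_left (Submodule.mem_span_singleton_self m))
              (sum_mem fun a _ => Submodule.smul_mem _ _ (h1 a)))
          · exact h1 j
        have hle' : Submodule.span k (Set.range fun j => y' (i.succAbove j)) ≤
            Submodule.span k (Set.range y) :=
          (Submodule.span_mono (Set.range_comp_subset_range _ y')).trans hy'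
        obtain ⟨c, m', q'', hm', hq'', rfl⟩ := exists_eq_add_of_mem_mul hle hq'
        have h3 := ((ih M (by omega) hq'').mono hle').mul_add (hy' hm) (d := w + c • m + m')
          (add_mem (add_mem hw (Submodule.smul_mem _ _ (hy' hm))) (hle' hm'))
        have h4 : (M + 2 + 1) / 2 = (M + 1) / 2 + 1 := by omega
        rw [h4]
        convert h3 using 1
        simp only [Algebra.smul_def]
        ring

/-- Each further product a b doubles the size: if `φψ = ψφ = q`, the block matrices [φ, a; b, -ψ]
and [ψ, a; b, -φ] factor q + a b. -/
lemma exists_matrix_factorization (W : Submodule k R) (r : ℕ) : ∀ {q : R}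
    (_ : IsSumOfProducts W (r + 1) q), ∃ φ ψ : Matrix (Fin (2 ^ r)) (Fin (2 ^ r)) R,
      (∀ i j, φ i j ∈ W) ∧ (∀ i j, ψ i j ∈ W) ∧ φ * ψ = q • (1 : Matrix _ _ R) ∧
        ψ * φ = q • (1 : Matrix _ _ R) := by
  induction r with
  | zero =>
    rintro _ ⟨a, b, ha, hb, rfl⟩
    refine ⟨Matrix.of fun _ _ => a 0, Matrix.of fun _ _ => b 0, fun _ _ => ha 0, fun _ _ => hb 0, ?_, ?_⟩
    all_goals
      ext i j
      have hij : i = j := Fin.ext (by have := i.2; have := j.2; omega)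
      simp [Matrix.mul_apply, hij, mul_comm]
  | succ r ih =>
    rintro _ ⟨a, b, ha, hb, rfl⟩
    obtain ⟨φ, ψ, hφ, hψ, h1, h2⟩ := ih ⟨fun i => a i.succ, fun i => b i.succ, fun i => ha _,
      fun i => hb _, rfl⟩
    let e : Fin (2 ^ (r + 1)) ≃ Fin (2 ^ r) ⊕ Fin (2 ^ r) :=
      (finCongr (by rw [pow_succ, mul_two])).trans finSumFinEquiv.symm
    let x : Matrix (Fin (2 ^ r)) (Fin (2 ^ r)) R := a 0 • 1
    let y : Matrix (Fin (2 ^ r)) (Fin (2 ^ r)) R := b 0 • 1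
    have hone (c : R) (hc : c ∈ W) (i j : Fin (2 ^ r)) :
        (c • (1 : Matrix (Fin (2 ^ r)) (Fin (2 ^ r)) R)) i j ∈ W := by
      by_cases hij : i = j <;> simp [hij, hc]
    have hq : (∑ i, a i * b i) • (1 : Matrix (Fin (2 ^ (r + 1))) (Fin (2 ^ (r + 1))) R) =
        (Matrix.fromBlocks ((∑ i, a i * b i) • (1 : Matrix (Fin (2 ^ r)) (Fin (2 ^ r)) R)) 0 0
          ((∑ i, a i * b i) • (1 : Matrix (Fin (2 ^ r)) (Fin (2 ^ r)) R))).submatrix e e := by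
      ext i j
      have he : (i = j) = (e i = e j) := by simp
      rw [Matrix.submatrix_apply, Matrix.smul_apply, Matrix.one_apply]
      simp only [he]
      rcases e i with i | i <;> rcases e j with j | j <;> simp [Matrix.one_apply]
    refine ⟨(Matrix.fromBlocks φ x y (-ψ)).submatrix e e,
      (Matrix.fromBlocks ψ x y (-φ)).submatrix e e, fun i j => ?_, fun i j => ?_, ?_, ?_⟩
    · rw [Matrix.submatrix_apply]
      rcases e i with i | i <;> rcases e j with j | j
      exacts [hφ i j, hone _ (ha 0) i j, hone _ (hb 0) i j, neg_mem (hψ i j)]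
    · rw [Matrix.submatrix_apply]
      rcases e i with i | i <;> rcases e j with j | j
      exacts [hψ i j, hone _ (ha 0) i j, hone _ (hb 0) i j, neg_mem (hφ i j)]
    · rw [Matrix.submatrix_mul_equiv, Matrix.fromBlocks_multiply, hq, Fin.sum_univ_succ, add_smul]
      congr 2
      · rw [h1, add_comm]; simp [x, y, smul_smul, mul_comm]
      · simp [x]
      · simp [y]
      · simp [x, y, h2, smul_smul]
    · rw [Matrix.submatrix_mul_equiv, Matrix.fromBlocks_multiply, hq, Fin.sum_univ_succ, add_smul]
      congr 2
      · rw [h2, add_comm]; simp [x, y, smul_smul, mul_comm]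
      · simp [x]
      · simp [y]
      · simp [x, y, h1, smul_smul]

end QuadraticForms

namespace SmoothQuadric
open MvPolynomial
variable {k : Type u} [Field k] [IsAlgClosed k] {n : ℕ}

/-- In n + 2 variables q is a sum of ⌊(n+3)/2⌋ = ⌊(n+1)/2⌋ + 1 products of linear forms, which gives
exactly the size 2^⌊(n+1)/2⌋. -/
lemma nonempty_spinorFactorization (Q : SmoothQuadric k n) : Nonempty Q.SpinorFactorization := by
  have hspan : homogeneousSubmodule (Fin (n + 2)) k 1 = Submodule.span k (Set.range X) :=
    homogeneousSubmodule_one_eq_span_X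
  have hq : Q.form ∈ Submodule.span k (Set.range (X : Fin (n + 2) → MvPolynomial _ k)) *
      Submodule.span k (Set.range X) := by
    rw [← hspan, ← pow_two, homogeneousSubmodule_one_pow]
    exact Q.isHomogeneous
  have h1 := isSumOfProducts_of_mem_mul (n + 2) hq
  rw [show (n + 2 + 1) / 2 = (n + 1) / 2 + 1 by omega] at h1
  obtain ⟨φ, ψ, hφ, hψ, h1, h2⟩ := exists_matrix_factorization _ _ h1
  rw [← hspan] at hφ hψ
  exact ⟨⟨φ, ψ, hφ, hψ, h1, h2⟩⟩

end SmoothQuadric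
end QuadricSheaf

namespace QuadricSheaf
open CategoryTheory Opposite TopologicalSpace Limits Abelian AlgebraicGeometry

/-! ### Qregularity in terms of matrix syzygies, and the conclusion -/

noncomputable section QuadricRegularity
attribute [local instance] MvPolynomial.gradedAlgebra Abelian.hasFiniteBiproducts
variable {k : Type u} [Field k] [IsAlgClosed k] {n : ℕ}

namespace SmoothQuadric
variable (Q : SmoothQuadric k n) {F : (Proj Q.grading).Modules} {m : ℤ}

lemma exists_linear_nonvanishing (x : Proj Q.grading) :
    ∃ a ∈ Q.grading 1, x ∈ nonvanishing Q.grading a := by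
  obtain ⟨i, hi⟩ := Q.exists_mem_nonvanishing (fun i => MvPolynomial.pderiv i Q.form) Q.smooth x
  exact ⟨_, Q.mk_mem_grading (MvPolynomial.IsHomogeneous.pderiv (n := 2) Q.isHomogeneous), hi⟩

lemma subsingleton_H_bundle_iff (S : Q.SpinorFactorization) {d : ℤ} (hd : d + n = m + 1) :
    Subsingleton (H n (tensor (Q.serreTwist F m) (Q.serreTwist S.bundle (-n)))) ↔
      Subsingleton (H n (S.toExactPair.syz F d)) := by
  -- Here e = m - 1 - n is the twist of F in the source of `φ`, two steps below the kernel, so d = m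
  -- + 1 - n.
  obtain rfl : m + (-1 + -n) + 1 + 1 = d := by omega
  exact S.toExactPair.subsingleton_H_coker_iff F Q.exists_linear_nonvanishing rfl

/-- Exchanging the matrices yields another spinor factorization, so the condition on all spinor
bundles controls both kernels. Conversely the vanishing for F itself is read off from one
factorization, hence the need for existence. -/
lemma isQregular_iff : Q.IsQregular F m ↔
    ∀ S : Q.SpinorFactorization, S.toExactPair.IsRegular F n m := by
  constructor
  · intro h S
    refine ⟨fun i hi hin d hd => ?_, fun d hd => (Q.subsingleton_H_bundle_iff S hd).1 (h.2 S),
      fun d hd => (Q.subsingleton_H_bundle_iff S.swap hd).1 (h.2 S.swap)⟩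
    obtain rfl : d = m - i := by omega
    exact h.1 i hi hin
  · intro h
    refine ⟨fun i hi hin => ?_, fun S => (Q.subsingleton_H_bundle_iff S
      (show m + 1 - n + n = m + 1 by ring)).2 ((h S).syz _ (by ring))⟩
    obtain ⟨S⟩ := Q.nonempty_spinorFactorization
    exact (h S).tw i hi hin _ (by ring)

/-- Linear forms without common zero on the quadric give an affine cover. -/
lemma exists_linear_cover : ∃ (l : Fin (n + 1) → MvPolynomial (Fin (n + 2)) k)
    (_ : ∀ i, (l i).IsHomogeneous 1),
    ⨆ i, nonvanishing Q.grading (Ideal.Quotient.mk (Ideal.span {Q.form}) (l i)) = ⊤ ∧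
    ∀ (B : GradedFamily fun i =>
      nonvanishing Q.grading (Ideal.Quotient.mk (Ideal.span {Q.form}) (l i))) d,
      Subsingleton (H (n + 1) (B.obj d)) := by
  obtain ⟨l, hl, hl0⟩ := Q.exists_linear_forms
  have hU : ⨆ i, nonvanishing Q.grading (Ideal.Quotient.mk (Ideal.span {Q.form}) (l i)) = ⊤ :=
    top_le_iff.1 fun x _ => Opens.mem_iSup.2 (Q.exists_mem_nonvanishing l hl0 x)
  exact ⟨l, hl, hU, GradedFamily.subsingleton_H_of_affine
    (fun i => Proj.isAffineOpen_basicOpen Q.grading _ (Q.mk_mem_grading (hl i)) one_pos) hU⟩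

lemma IsQregular.succ {Q : SmoothQuadric k n} {F : (Proj Q.grading).Modules}
    (hF : IsCoherent F) {m : ℤ} (hn : 1 ≤ n) (h : Q.IsQregular F m) : Q.IsQregular F (m + 1) := by
  have : F.IsQuasicoherent := hF.1
  obtain ⟨l, hl, hU, hvan⟩ := Q.exists_linear_cover
  have : Nonempty (Fin (2 ^ ((n + 1) / 2))) := ⟨⟨0, by positivity⟩⟩
  exact Q.isQregular_iff.2 fun S =>
    (Q.isQregular_iff.1 h S).succ (fun i => Q.mk_mem_grading (hl i)) hU hvan hn

lemma IsQregular.of_le {Q : SmoothQuadric k n} {F : (Proj Q.grading).Modules}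
    (hF : IsCoherent F) {m : ℤ} (hn : 1 ≤ n) (h : Q.IsQregular F m) {l : ℤ} (hl : m ≤ l) :
    Q.IsQregular F l := by
  induction l, hl using Int.leInduction with
  | base => exact h
  | succ l _ ih => exact ih.succ hF hn

lemma IsQregular.exists_eq_sum_mulSection {Q : SmoothQuadric k n} {F : (Proj Q.grading).Modules}
    (hF : IsCoherent F) {m : ℤ} (hn : 1 ≤ n) (h : Q.IsQregular F m) {m' : ℤ} (hm : 1 + m = m')
    (t : H0 (Q.serreTwist F m')) :
    ∃ (r : ℕ) (s : Fin r → H0 (Q.serreTwist F m)) (a : Fin r → H0 (Q.lineBundle 1)),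
      t = ∑ j, Q.mulSection F hm (a j) (s j) := by
  obtain rfl : m' = m + 1 := by omega
  have : F.IsQuasicoherent := hF.1
  obtain ⟨l, hl, hU, hvan⟩ := Q.exists_linear_cover
  obtain ⟨S⟩ := Q.nonempty_spinorFactorization
  let p : Fin (2 ^ ((n + 1) / 2)) := ⟨0, by positivity⟩
  obtain ⟨g, v, hgv⟩ := (Q.isQregular_iff.1 h S).exists_eq_sum
    (fun i => Q.mk_mem_grading (hl i)) hU hvan hn p t
  -- The list of products has length n + 1 + N: one for each form of the cover and one for each
  -- entry of a row of `φ`.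
  refine ⟨_, Fin.append g v, Fin.append (fun i => Q.linearSection (l i) (hl i))
    fun q => Q.linearSection (S.φ p q) (S.linear_φ p q), ?_⟩
  rw [Fin.sum_univ_add]
  simp only [Fin.append_left, Fin.append_right]
  refine hgv.trans (congrArg₂ (· + ·) (Finset.sum_congr rfl fun i _ => ?_)
    (Finset.sum_congr rfl fun q _ => ?_))
  · exact congrArg (Q.mulSection F hm _) (Fin.append_left g v i).symm
  · exact congrArg (Q.mulSection F hm _) (Fin.append_right g v q).symm

end SmoothQuadric
end QuadricRegularity
end QuadricSheaf

theorem mainTheorem5 {k : Type u} [Field k] [IsAlgClosed k] {n : ℕ} (hn : 2 ≤ n)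
    (Q : QuadricSheaf.SmoothQuadric k n) (F : Q.scheme.Modules) (hF : QuadricSheaf.IsCoherent F)
    (m : ℤ) (hm : Q.IsQregular F m) :
    (∀ l : ℤ, m ≤ l → Q.IsQregular F l) ∧
    ∀ l : ℤ, m < l →
      ∀ t : QuadricSheaf.H0 (Q.serreTwist F l),
        ∃ (r : ℕ) (s : Fin r → QuadricSheaf.H0 (Q.serreTwist F (l - 1)))
          (a : Fin r → QuadricSheaf.H0 (Q.lineBundle 1)),
          t = ∑ j, Q.mulSection F (add_sub_cancel 1 l) (a j) (s j) := by
  exact ⟨fun l hl => hm.of_le hF (by omega) hl, fun l hl t =>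
    (hm.of_le hF (by omega) (show m ≤ l - 1 by omega)).exists_eq_sum_mulSection hF (by omega) _ t⟩
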